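/- Let $n\ge 3$, $M>0$, $F(r)=1-\frac{2M}{r}$, $\Omega=(2M,\infty)\times\mathbb S^{n-1}$, and $$\square_{g_S}=\frac1F\partial_t^2-\frac{1}{r^{n-1}}\partial_r\big(r^{n-1}F\,\partial_r\,\cdot\big)-\frac1{r^2}\Delta_{\mathbb S^{n-1}},$$ and let $s=r+2M\ln(r-2M)$ be the tortoise coordinate. Let $D,V\in C(2M,\infty)$ satisfy $0\le D\le\mu_1r^{-\beta}$ and $0\le V\le\mu_2r^{-\gamma}$ on $(2M,\infty)$, with $\mu_1,\mu_2\ge0$, $\beta>1$, $\gamma>2$. Let $u_0,u_1$ be nonnegative integrable functions on $\Omega$, not both zero almost everywhere, supported in $\{2M+R_1\le r\le 2M+R_2\}$ for some $0<R_1<R_2$, and let $R>0$ be such that $u_0,u_1$ are supported in $\{|s|\le R\}$. For $p>1$ and $\varepsilon>0$ consider $$\square_{g_S}u+D(r)u_t+V(r)u=|u|^p\ \text{ in }(0,T)\times\Omega,\qquad u(0)=\varepsilon u_0,\quad u_t(0)=\varepsilon u_1 .$$ A weak solution on $[0,T)$ is a function $u$ with $u,|u|^p\in L^1_{loc}([0,T)\times\Omega)$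 such that, with $dx=r^{n-1}\,dr\,d\omega$, $$\int_0^T\!\!\int_\Omega u\,(\square_{g_S}\varphi-D\varphi_t+V\varphi)\,dx\,dt=\int_0^T\!\!\int_\Omega|u|^p\varphi\,dx\,dt+\varepsilon\int_\Omega\Big(\frac{u_1}{F}\varphi+Du_0\varphi-\frac{u_0}{F}\varphi_t\Big)\Big|_{t=0}dx$$ for all $C^2$ functions $\varphi$ with compact support in $(-\infty,T)\times\Omega$. Let $T_\varepsilon\in[0,\infty]$ be the supremum of all $T$ for which there is a weak solution on $[0,T)$ that vanishes almost everywhere outside $\{|s|\le t+R\}$. Let $\gamma(p,n)=2+(n+1)p-(n-1)p^2$ and let $p_S(n)$ be its positive root in $p$. (i) If $1<p<p_S(n)$, then $T_\varepsilon<\infty$ for every $\varepsilon>0$ (every weak solution with this support property blows up in finite time). Moreover there are constants $C,\varepsilon_0>0$, independent of $\varepsilon$, such that for all $0<\varepsilon\le\varepsilon_0$ $$T_\varepsilon\le\begin{cases}C\varepsilon^{-\frac{2(p-1)}{n+1-(n-1)p}}, & 1<p\le\frac n{n-1},\\[2pt] C\varepsilon^{-\frac{2p(p-1)}{\gamma(p,n)}},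 & \frac n{n-1}<p<p_S(n).\end{cases}$$ (ii) If $V=0$ and $p=p_S(n)$, then there are constants $C,\varepsilon_0>0$, independent of $\varepsilon$, such that $T_\varepsilon\le\exp\big(C\varepsilon^{-p(p-1)}\big)$ for all $0<\varepsilon\le\varepsilon_0$. -/

import Mathlib

open MeasureTheory Set
open scoped ENNReal

namespace Schwarzschild

noncomputable section

/-- The metric coefficient `F(r) = 1 - 2M/r`. -/
def F (M r : ℝ) : ℝ := 1 - 2 * M / r

/-- The tortoise coordinate `s = r + 2M ln(r - 2M)`. -/
def tortoise (M r : ℝ) : ℝ := r + 2 * M * Real.log (r - 2 * M)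

/-- The exterior `Ω = (2M, ∞) × S^{n-1}`, in polar coordinates `x = r ω`. The Lebesgue measure
of `ℝⁿ` restricted to it is `r^{n-1} dr dω`. -/
def exterior (n : ℕ) (M : ℝ) : Set (EuclideanSpace ℝ (Fin n)) := {x | 2 * M < ‖x‖}

/-- The Laplace-Beltrami operator of the unit sphere acting on the angular variable of `f`:
the value at `x = r ω` is the Laplacian on `ℝⁿ`, at the point `ω`, of the extension of
`ω ↦ f (r ω)` that is homogeneous of degree zero. -/
def sphereLaplacian {n : ℕ} (f : EuclideanSpace ℝ (Fin n) → ℝ)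
    (x : EuclideanSpace ℝ (Fin n)) : ℝ :=
  Laplacian.laplacian (fun y : EuclideanSpace ℝ (Fin n) => f ((‖x‖ / ‖y‖) • y)) (‖x‖⁻¹ • x)

/-- The spatial operator `r^{1-n} ∂_r (r^{n-1} F ∂_r f) + r^{-2} Δ_{S^{n-1}} f`. -/
def spatialOp {n : ℕ} (M : ℝ) (f : EuclideanSpace ℝ (Fin n) → ℝ)
    (x : EuclideanSpace ℝ (Fin n)) : ℝ :=
  (‖x‖ ^ (n - 1))⁻¹ *
      deriv (fun r : ℝ => r ^ (n - 1) * F M r * deriv (fun q : ℝ => f (q • (‖x‖⁻¹ • x))) r) ‖x‖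
    + (‖x‖ ^ 2)⁻¹ * sphereLaplacian f x

/-- The d'Alembertian `F⁻¹ ∂_t² - r^{1-n} ∂_r (r^{n-1} F ∂_r) - r^{-2} Δ_{S^{n-1}}` of the
Schwarzschild metric. -/
def box {n : ℕ} (M : ℝ) (φ : ℝ × EuclideanSpace ℝ (Fin n) → ℝ)
    (z : ℝ × EuclideanSpace ℝ (Fin n)) : ℝ :=
  (F M ‖z.2‖)⁻¹ * iteratedDeriv 2 (fun t => φ (t, z.2)) z.1 - spatialOp M (fun x => φ (z.1, x)) z.2

/-- `u` is a weak solution on `[0, T) × Ω` of `□u + D(r) u_t + V(r) u = |u|^p` with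
`u(0) = f`, `u_t(0) = g`: both `u` and `|u|^p` are locally integrable on `[0, T) × Ω`, and the
equation holds after multiplication by an arbitrary `C²` test function whose support is compact in
`(-∞, T) × Ω`, integration with respect to `r^{n-1} dr dω dt` over `(0, T) × Ω`, and moving all
derivatives to the test function. -/
structure IsWeakSolution (n : ℕ) (M : ℝ) (D V : ℝ → ℝ) (p : ℝ)
    (f g : EuclideanSpace ℝ (Fin n) → ℝ) (T : ℝ)
    (u : ℝ × EuclideanSpace ℝ (Fin n) → ℝ) : Prop where
  locallyIntegrable : LocallyIntegrableOn u (Ico 0 T ×ˢ exterior n M)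
  locallyIntegrable_rpow :
    LocallyIntegrableOn (fun z => |u z| ^ p) (Ico 0 T ×ˢ exterior n M)
  weak_eq : ∀ φ : ℝ × EuclideanSpace ℝ (Fin n) → ℝ,
    ContDiff ℝ 2 φ → HasCompactSupport φ → tsupport φ ⊆ Iio T ×ˢ exterior n M →
    ∫ z in Ioo 0 T ×ˢ exterior n M,
        u z * (box M φ z - D ‖z.2‖ * deriv (fun t => φ (t, z.2)) z.1 + V ‖z.2‖ * φ z)
      = (∫ z in Ioo 0 T ×ˢ exterior n M, |u z| ^ p * φ z)
        + ∫ x in exterior n M,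
            ((F M ‖x‖)⁻¹ * g x * φ (0, x) + D ‖x‖ * f x * φ (0, x)
              - (F M ‖x‖)⁻¹ * f x * deriv (fun t => φ (t, x)) 0)

/-- The support property `supp u ⊆ {|s| ≤ t + R} × S^{n-1}` on `(0, T) × Ω`. -/
def FiniteSpeed (n : ℕ) (M R T : ℝ) (u : ℝ × EuclideanSpace ℝ (Fin n) → ℝ) : Prop :=
  ∀ᵐ z ∂(volume.restrict (Ioo 0 T ×ˢ exterior n M)),
    u z ≠ 0 → |tortoise M ‖z.2‖| ≤ z.1 + R

/-- The lifespan for data `f`, `g`: the supremum of all `T` for which some weak solution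
on `[0, T) × Ω` with the support property exists. No weak solution with the support property
lives longer; all of them blow up in finite time when it is not `∞`. -/
def lifespan (n : ℕ) (M : ℝ) (D V : ℝ → ℝ) (p : ℝ)
    (f g : EuclideanSpace ℝ (Fin n) → ℝ) (R : ℝ) : ℝ≥0∞ :=
  ⨆ (T : ℝ) (_ : ∃ u, IsWeakSolution n M D V p f g T u ∧ FiniteSpeed n M R T u), ENNReal.ofReal T

/-- The quadratic polynomial `γ(p, n) = 2 + (n + 1) p - (n - 1) p²`. -/
def straussGamma (p : ℝ) (n : ℕ) : ℝ := 2 + ((n : ℝ) + 1) * p - ((n : ℝ) - 1) * p ^ 2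

/-- The Strauss exponent `p_S(n)`, the positive root of `γ(·, n)`. -/
def straussExponent (n : ℕ) : ℝ :=
  ((n : ℝ) + 1 + Real.sqrt (((n : ℝ) + 1) ^ 2 + 8 * ((n : ℝ) - 1))) / (2 * ((n : ℝ) - 1))

/-- `p_S(n)` is the unique positive root of `γ(·, n)`. -/
theorem eq_straussExponent_iff (n : ℕ) (hn : 2 ≤ n) (q : ℝ) :
    (0 < q ∧ straussGamma q n = 0) ↔ q = straussExponent n := by
  have h2 : (2 : ℝ) ≤ n := by exact_mod_cast hn
  have ha : (0 : ℝ) < (n : ℝ) - 1 := by linarith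
  have hd : (0 : ℝ) ≤ ((n : ℝ) + 1) ^ 2 + 8 * ((n : ℝ) - 1) := by nlinarith
  have hs := Real.sq_sqrt hd
  have hs0 := Real.sqrt_nonneg (((n : ℝ) + 1) ^ 2 + 8 * ((n : ℝ) - 1))
  unfold straussGamma straussExponent
  set w := Real.sqrt (((n : ℝ) + 1) ^ 2 + 8 * ((n : ℝ) - 1)) with hw
  rw [eq_div_iff (by positivity)]
  constructor
  · rintro ⟨hq, h⟩
    have hwn : (n : ℝ) + 1 < w := by
      by_contra hc
      push Not at hc
      nlinarith
    have h1 : (q * (2 * ((n : ℝ) - 1)) - ((n : ℝ) + 1) - w)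
        * (q * (2 * ((n : ℝ) - 1)) - ((n : ℝ) + 1) + w) = 0 := by
      linear_combination (-4 * ((n : ℝ) - 1)) * h - hs
    rcases mul_eq_zero.mp h1 with h3 | h3
    · linarith
    · have : 0 < q * (2 * ((n : ℝ) - 1)) := by positivity
      linarith
  · intro h
    have hq : 0 < q := by
      by_contra hc
      push Not at hc
      nlinarith
    refine ⟨hq, ?_⟩
    have h1 : (4 * ((n : ℝ) - 1)) * (2 + ((n : ℝ) + 1) * q - ((n : ℝ) - 1) * q ^ 2) = 0 := by
      have : w = q * (2 * ((n : ℝ) - 1)) - ((n : ℝ) + 1) := by linarith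
      rw [this] at hs
      linear_combination -hs
    rcases mul_eq_zero.mp h1 with h3 | h3
    · linarith
    · exact h3

end

end Schwarzschild

/-!
The proof is a test function argument. Every test function is radial and has the form
`Ψ(t, r) * η ((t + delay r) / θ)`, where `Ψ` is a superposition of separated solutions `e^{-lt} φ(r)`
of the adjoint linear equation (`IsMode`) and `η` is a cutoff in time. The modes are exact solutions,
so only derivatives of the cutoff survive in the weak formulation
(`IsWeakSolution.waveSum_eq`). The cutoff is delayed near the horizon by `delay = -2 M log F`; a
cutoff in `t` alone would leave coefficients of size `1 / F`. The finite speed of propagation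
confines a solution to a region that stays away from the horizon as long as `t ≤ T`, so modes are
only needed on a compact interval `[a, b]` of radii, with bounds independent of `a > 2 M` and `b`.
Since `|η'|` and `|η''|` are at most a multiple of `η ^ (1 / p)`, Hölder's inequality
(`IsWeakSolution.lintegral_le`) bounds the integral of `|u| ^ p Ψ η` plus a nonnegative data term by
`(∫ |u| ^ p η) ^ (1 / p)` over the transition region `θ / 2 ≤ t + delay ≤ θ` times an explicit
integral `(∫ G ^ p') ^ (1 / p')`.

A mode is written as `φ = r^{-(n-1)/2} e^{l s} k`, with `s` the tortoise coordinate. The logarithmic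
derivative of the profile `k` satisfies a Riccati equation, is nonnegative, and is bounded by
explicit barriers through a comparison principle (`IsMode.profileLogDeriv_le`). This gives the bounds
for `l = 0` and `l = 1` with a potential (`exists_mode_zero_bound`, `exists_mode_one_bound`) and,
without potential, bounds uniform in `0 < l ≤ 1` (`exists_mode_uniform_bound`).

Subcritical case. The bounded mode with `l = 0` gives the upper bound
`∫ |u| ^ p η ≤ C (θ ^ (n + 1 - 2 p') + θ ^ (1 - p'))`. The mode with `l = 1` sees the data and, as it
is concentrated near the boundary of the cone, gives
`∫ |u| ^ p η ≥ c ε ^ p θ ^ (n - (n - 1) p / 2)`. For `p < p_S` the two are incompatible for large `θ`,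
and comparing them yields the lifespan.

Critical case. For `q = (n - 1) / 2 - 1 / p` the dyadic superposition `∑ λ ^ q e^{-λ t} φ_λ` over
`λ = 2 ^ (-j)` has size `θ ^ (-q)` in the transition region, while its time derivative is bounded by
`θ ^ (-(n - 1) / 2) (1 + t + R - s) ^ (-1 / p')` (`superposition_ge`, `exists_superposition_le`). At
`p = p_S` all powers of `θ` cancel and only a logarithm is left, so the functional
`A(θ) = ∫ |u| ^ p Ψ η` satisfies a discrete differential inequality on a geometric sequence of times
(`IsSetting.exists_growth`), whose solutions exist for at most `C ε ^ (-p (p - 1))` steps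
(`exists_length_le`).
-/

namespace Schwarzschild

/-! ### Linear ordinary differential equations -/

theorem abs_max_neg_min_le {B : ℝ} (hB : 0 ≤ B) (x : ℝ) : |max (-B) (min B x)| ≤ min B |x| := by
  rcases le_total B x with h | h
  · rw [min_eq_left h, max_eq_right (by linarith), abs_of_nonneg hB, abs_of_nonneg (hB.trans h),
      min_eq_left h]
  · rw [min_eq_right h]
    rcases le_total (-B) x with h' | h'
    · rw [max_eq_right h', min_eq_right (abs_le.2 ⟨h', h⟩)]
    · rw [max_eq_left h', abs_neg, abs_of_nonneg hB, abs_of_nonpos (by linarith), min_eq_left]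
      linarith

theorem abs_max_neg_min_sub_le (B x y : ℝ) :
    |max (-B) (min B x) - max (-B) (min B y)| ≤ |x - y| := by
  have h : ∀ u v : ℝ, u ≤ v →
      |max (-B) (min B v) - max (-B) (min B u)| ≤ v - u := fun u v huv => by
    rw [abs_of_nonneg (sub_nonneg.2 (max_le_max_left _ (min_le_min_left B huv)))]
    simp only [max_def, min_def]
    split_ifs <;> linarith
  rcases le_total x y with hxy | hxy
  · rw [abs_sub_comm, abs_sub_comm x, abs_of_nonneg (sub_nonneg.2 hxy)]
    exact h x y hxy
  · rw [abs_of_nonneg (sub_nonneg.2 hxy)]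
    exact h y x hxy

/-- Global solvability of a linear system `f' = A g`, `g' = Q f` on a compact interval. The
Picard-Lindelöf theorem is applied to the vector field with clamped arguments, which is bounded;
Grönwall's inequality shows that the clamping never acts on the solution. -/
theorem exists_linear_system {a b : ℝ} (hab : a < b) {A Q : ℝ → ℝ}
    (hA : ContinuousOn A (Icc a b)) (hQ : ContinuousOn Q (Icc a b)) (x₀ y₀ : ℝ) :
    ∃ f g : ℝ → ℝ, f a = x₀ ∧ g a = y₀ ∧ ∀ r ∈ Icc a b,
      HasDerivWithinAt f (A r * g r) (Icc a b) r ∧ HasDerivWithinAt g (Q r * f r) (Icc a b) r := by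
  obtain ⟨K₁, hK₁⟩ := isCompact_Icc.exists_bound_of_continuousOn hA
  obtain ⟨K₂, hK₂⟩ := isCompact_Icc.exists_bound_of_continuousOn hQ
  set K : ℝ := max 0 (max K₁ K₂) with hKdef
  have hK0 : 0 ≤ K := le_max_left _ _
  have hAK : ∀ t ∈ Icc a b, |A t| ≤ K := fun t ht =>
    (hK₁ t ht).trans ((le_max_left _ _).trans (le_max_right _ _))
  have hQK : ∀ t ∈ Icc a b, |Q t| ≤ K := fun t ht =>
    (hK₂ t ht).trans ((le_max_right _ _).trans (le_max_right _ _))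
  set B : ℝ := ‖((x₀, y₀) : ℝ × ℝ)‖ * Real.exp (K * (b - a)) with hB
  have hB0 : 0 ≤ B := by positivity
  set cl : ℝ → ℝ := fun x => max (-B) (min B x) with hcl
  have hcl1 : ∀ x, |cl x| ≤ B := fun x => (abs_max_neg_min_le hB0 x).trans (min_le_left _ _)
  have hcl2 : ∀ x, |cl x| ≤ |x| := fun x => (abs_max_neg_min_le hB0 x).trans (min_le_right _ _)
  have hcl3 : ∀ x, |x| ≤ B → cl x = x := fun x hx => by
    rw [abs_le] at hx
    simp only [hcl]
    rw [min_eq_right hx.2, max_eq_right hx.1]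
  set v : ℝ → ℝ × ℝ → ℝ × ℝ := fun t w => (A t * cl w.2, Q t * cl w.1) with hv
  have hPL : IsPicardLindelof v (⟨a, left_mem_Icc.2 hab.le⟩ : Icc a b) (x₀, y₀)
      (K * B * (b - a)).toNNReal 0 (K * B).toNNReal K.toNNReal := by
    have hKB : 0 ≤ K * B := mul_nonneg hK0 hB0
    refine ⟨?_, ?_, ?_, ?_⟩
    · intro t ht
      refine (LipschitzWith.of_dist_le_mul fun w w' => ?_).lipschitzOnWith
      rw [Real.coe_toNNReal _ hK0, Prod.dist_eq, Prod.dist_eq]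
      simp only [hv, Real.dist_eq]
      refine max_le ?_ ?_
      · rw [← mul_sub, abs_mul]
        exact mul_le_mul (hAK t ht) ((abs_max_neg_min_sub_le B _ _).trans (le_max_right _ _))
          (abs_nonneg _) hK0
      · rw [← mul_sub, abs_mul]
        exact mul_le_mul (hQK t ht) ((abs_max_neg_min_sub_le B _ _).trans (le_max_left _ _))
          (abs_nonneg _) hK0
    · intro w _
      exact (hA.mul continuousOn_const).prodMk (hQ.mul continuousOn_const)
    · intro t ht w _
      rw [Real.coe_toNNReal _ hKB, Prod.norm_def]
      simp only [hv, Real.norm_eq_abs, abs_mul]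
      exact max_le (mul_le_mul (hAK t ht) (hcl1 _) (abs_nonneg _) hK0)
        (mul_le_mul (hQK t ht) (hcl1 _) (abs_nonneg _) hK0)
    · have h1 : 0 ≤ b - a := by linarith
      rw [Real.coe_toNNReal _ hKB, Real.coe_toNNReal _ (mul_nonneg hKB h1)]
      simp [max_eq_left h1]
  obtain ⟨α, hα0, hα⟩ := hPL.exists_eq_forall_mem_Icc_hasDerivWithinAt₀
  have hcont : ContinuousOn α (Icc a b) := fun t ht => (hα t ht).continuousWithinAt
  have hbd : ∀ t ∈ Icc a b, ‖α t‖ ≤ B := by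
    intro t ht
    have h := norm_le_gronwallBound_of_norm_deriv_right_le (δ := ‖((x₀, y₀) : ℝ × ℝ)‖) (K := K)
      (ε := 0) (f := α) (f' := fun t => v t (α t)) (a := a) (b := b) hcont
      (fun s hs => (hα s (Ico_subset_Icc_self hs)).mono_of_mem_nhdsWithin
        (Filter.mem_of_superset (Icc_mem_nhdsGE hs.2) (Icc_subset_Icc_left hs.1)))
      (by simp only at hα0; rw [hα0]) (fun s hs => by
        have hs' := Ico_subset_Icc_self hs
        rw [add_zero, Prod.norm_def]
        simp only [hv, Real.norm_eq_abs, abs_mul]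
        exact max_le (mul_le_mul (hAK s hs') ((hcl2 _).trans (norm_snd_le (α s))) (abs_nonneg _) hK0)
          (mul_le_mul (hQK s hs') ((hcl2 _).trans (norm_fst_le (α s))) (abs_nonneg _) hK0)) t ht
    rw [gronwallBound_ε0] at h
    refine h.trans (mul_le_mul_of_nonneg_left (Real.exp_le_exp.2 ?_) (norm_nonneg _))
    exact mul_le_mul_of_nonneg_left (by linarith [ht.2]) hK0
  refine ⟨fun t => (α t).1, fun t => (α t).2, ?_, ?_, fun r hr => ⟨?_, ?_⟩⟩
  · simp only at hα0; simp [hα0]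
  · simp only at hα0; simp [hα0]
  · have h := (hα r hr).fst
    simp only [hv, hcl3 _ ((norm_snd_le (α r)).trans (hbd r hr))] at h
    exact h
  · have h := (hα r hr).snd
    simp only [hv, hcl3 _ ((norm_fst_le (α r)).trans (hbd r hr))] at h
    exact h

/-- A linear differential inequality `w' + c w ≥ 0` preserves nonnegativity: the integrating factor
`exp ∫ c` makes `w` nondecreasing. -/
theorem nonneg_of_deriv_add_mul_nonneg {a b : ℝ} {w w' c : ℝ → ℝ}
    (hc : ContinuousOn c (Icc a b)) (hw : ContinuousOn w (Icc a b))
    (hd : ∀ r ∈ Ioo a b, HasDerivAt w (w' r) r) (h : ∀ r ∈ Ioo a b, 0 ≤ w' r + c r * w r)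
    (ha : 0 ≤ w a) : ∀ r ∈ Icc a b, 0 ≤ w r := by
  intro r hr
  have hab : a ≤ b := hr.1.trans hr.2
  set c' : ℝ → ℝ := IccExtend hab ((Icc a b).domRestrict c) with hc'
  have hc'c : Continuous c' := (continuousOn_iff_continuous_domRestrict.1 hc).Icc_extend'
  set I : ℝ → ℝ := fun s => ∫ t in a..s, c' t with hI
  have hId : ∀ s, HasDerivAt I (c' s) s := fun s => hc'c.integral_hasStrictDerivAt a s |>.hasDerivAt
  have hm : MonotoneOn (fun s => Real.exp (I s) * w s) (Icc a b) := by
    refine monotoneOn_of_deriv_nonneg (convex_Icc a b) ?_ ?_ ?_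
    · exact ((Real.continuous_exp.comp
        (continuous_iff_continuousAt.2 fun s => (hId s).continuousAt)).continuousOn).mul hw
    · intro s hs
      rw [interior_Icc] at hs
      exact ((hId s).exp.mul (hd s hs)).differentiableAt.differentiableWithinAt
    · intro s hs
      rw [interior_Icc] at hs
      have e' : deriv (fun s => Real.exp (I s) * w s) s
          = Real.exp (I s) * c' s * w s + Real.exp (I s) * w' s :=
        ((hId s).exp.mul (hd s hs)).deriv
      rw [e']
      have e : c' s = c s := IccExtend_of_mem hab _ (Ioo_subset_Icc_self hs)
      have := mul_nonneg (Real.exp_pos (I s)).le (h s hs)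
      rw [e]
      linarith
  have h1 := hm (left_mem_Icc.2 hab) hr hr.1
  have h2 : 0 ≤ Real.exp (I r) * w r := (mul_nonneg (Real.exp_pos _).le ha).trans h1
  exact nonneg_of_mul_nonneg_right h2 (Real.exp_pos _)

/-- A positive function whose logarithmic derivative is at most `Y'` grows at most like `exp Y`. -/
theorem le_mul_exp_sub_of_deriv_le {a b : ℝ} {f f' Y Y' : ℝ → ℝ}
    (hf : ContinuousOn f (Icc a b)) (hfd : ∀ r ∈ Ioo a b, HasDerivAt f (f' r) r)
    (hY : ContinuousOn Y (Icc a b)) (hYd : ∀ r ∈ Ioo a b, HasDerivAt Y (Y' r) r)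
    (h : ∀ r ∈ Ioo a b, f' r ≤ Y' r * f r) :
    ∀ r ∈ Icc a b, ∀ s ∈ Icc a b, r ≤ s → f s ≤ f r * Real.exp (Y s - Y r) := by
  have hm : AntitoneOn (fun s => Real.exp (-Y s) * f s) (Icc a b) := by
    refine antitoneOn_of_deriv_nonpos (convex_Icc a b) ?_ ?_ ?_
    · exact (Real.continuous_exp.comp_continuousOn hY.neg).mul hf
    · intro s hs
      rw [interior_Icc] at hs
      exact ((hYd s hs).neg.exp.mul (hfd s hs)).differentiableAt.differentiableWithinAt
    · intro s hs
      rw [interior_Icc] at hs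
      have e : deriv (fun s => Real.exp (-Y s) * f s) s
          = Real.exp (-Y s) * -Y' s * f s + Real.exp (-Y s) * f' s :=
        ((hYd s hs).neg.exp.mul (hfd s hs)).deriv
      rw [e]
      nlinarith [mul_nonneg (Real.exp_pos (-Y s)).le (sub_nonneg.2 (h s hs))]
  intro r hr s hs hrs
  have h1 : Real.exp (-Y s) * f s ≤ Real.exp (-Y r) * f r := hm hr hs hrs
  have h2 := mul_le_mul_of_nonneg_left h1 (Real.exp_pos (Y s)).le
  rw [← mul_assoc, ← Real.exp_add, add_neg_cancel, Real.exp_zero, one_mul, ← mul_assoc,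
    ← Real.exp_add, mul_comm] at h2
  rwa [sub_eq_add_neg]

/-! ### Radial solutions of the stationary dual equation -/

theorem F_pos {M r : ℝ} (hM : 0 < M) (hr : 2 * M < r) : 0 < F M r := by
  have : 0 < r := by linarith
  rw [F, sub_pos, div_lt_one this]
  exact hr

theorem F_lt_one {M r : ℝ} (hM : 0 < M) (hr : 2 * M < r) : F M r < 1 := by
  have : 0 < r := by linarith
  rw [F]
  linarith [div_pos (by linarith : 0 < 2 * M) this]

theorem hasDerivAt_F {M r : ℝ} (hr : r ≠ 0) : HasDerivAt (F M) (2 * M / r ^ 2) r := by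
  have h := ((hasDerivAt_inv hr).const_mul (2 * M)).const_sub 1
  unfold F
  convert! h using 1
  ring

theorem hasDerivAt_tortoise {M r : ℝ} (hM : 0 < M) (hr : 2 * M < r) :
    HasDerivAt (tortoise M) (F M r)⁻¹ r := by
  have h0 : r - 2 * M ≠ 0 := by linarith
  have h1 : r ≠ 0 := by linarith
  have h := (hasDerivAt_id r).add ((((hasDerivAt_id r).sub_const (2 * M)).log h0).const_mul (2 * M))
  unfold tortoise
  convert! h using 1
  have : F M r = (r - 2 * M) / r := by rw [F]; field_simp
  rw [this]
  simp only [id]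
  field_simp
  ring

theorem continuousOn_F {M : ℝ} : ContinuousOn (F M) {0}ᶜ := fun _ hr =>
  (hasDerivAt_F (M := M) hr).continuousAt.continuousWithinAt

theorem continuousOn_tortoise {M : ℝ} (hM : 0 < M) : ContinuousOn (tortoise M) (Ioi (2 * M)) :=
  fun _ hr => (hasDerivAt_tortoise hM hr).continuousAt.continuousWithinAt

/-- Half the dimension of the sphere, `(n - 1) / 2`: the decay rate of free radial waves. -/
noncomputable def decayRate (n : ℕ) : ℝ := ((n : ℝ) - 1) / 2

theorem one_le_decayRate {n : ℕ} (hn : 3 ≤ n) : 1 ≤ decayRate n := by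
  have : (3 : ℝ) ≤ n := by exact_mod_cast hn
  rw [decayRate]
  linarith

/-- `φ`, with derivative `φ'`, solves `r^{1-n} (r^{n-1} F φ')' = (l² / F + l D + V) φ` on `(a, b)`,
so that `e^{-lt} φ(r)` solves the adjoint of the linear wave equation. The initial condition at `a`
makes `e^{-l s} φ` stationary at `a`, where `s` is the tortoise coordinate. -/
structure IsMode (n : ℕ) (M : ℝ) (D V : ℝ → ℝ) (a b l : ℝ) (φ φ' : ℝ → ℝ) : Prop where
  continuousOn : ContinuousOn φ (Icc a b)
  continuousOn_deriv : ContinuousOn φ' (Icc a b)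
  hasDerivAt : ∀ r ∈ Ioo a b, HasDerivAt φ (φ' r) r
  hasDerivAt_deriv : ∀ r ∈ Ioo a b, HasDerivAt φ'
    (((l ^ 2 / F M r + l * D r + V r) * φ r
      - (2 * decayRate n * F M r / r + 2 * M / r ^ 2) * φ' r) / F M r) r
  initial : φ a = Real.exp (l * tortoise M a)
  initial_deriv : φ' a = l / F M a * φ a
  pos : ∀ r ∈ Icc a b, 0 < φ r
  deriv_nonneg : ∀ r ∈ Icc a b, 0 ≤ φ' r

theorem hasDerivAt_pow_pred {n : ℕ} (hn : 3 ≤ n) {r : ℝ} (hr : r ≠ 0) :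
    HasDerivAt (fun r : ℝ => r ^ (n - 1)) (2 * decayRate n / r * r ^ (n - 1)) r := by
  obtain ⟨m, rfl⟩ : ∃ m, n = m + 2 := ⟨n - 2, by omega⟩
  have h := hasDerivAt_pow (m + 1) r
  convert! h using 1
  simp only [decayRate]
  push_cast
  rw [pow_succ]
  field_simp
  ring

theorem exists_isMode {n : ℕ} (hn : 3 ≤ n) {M : ℝ} (hM : 0 < M) {D V : ℝ → ℝ}
    (hDc : ContinuousOn D (Ioi (2 * M))) (hVc : ContinuousOn V (Ioi (2 * M)))
    (hD : ∀ r, 2 * M < r → 0 ≤ D r) (hV : ∀ r, 2 * M < r → 0 ≤ V r)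
    {a b l : ℝ} (ha : 2 * M < a) (hab : a < b) (hl : 0 ≤ l) :
    ∃ φ φ', IsMode n M D V a b l φ φ' := by
  have hsub : Icc a b ⊆ Ioi (2 * M) := fun r hr => lt_of_lt_of_le ha hr.1
  have hne : ∀ r ∈ Icc a b, r ≠ 0 := fun r hr => by have := hsub hr; simp only [mem_Ioi] at this; linarith
  have hFp : ∀ r ∈ Icc a b, 0 < F M r := fun r hr => F_pos hM (hsub hr)
  have hFc : ContinuousOn (F M) (Icc a b) := continuousOn_F.mono fun r hr => hne r hr
  set P : ℝ → ℝ := fun r => r ^ (n - 1) * F M r with hP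
  have hPc : ContinuousOn P (Icc a b) := (continuous_pow _).continuousOn.mul hFc
  have hPp : ∀ r ∈ Icc a b, 0 < P r := fun r hr =>
    mul_pos (pow_pos (by have := hsub hr; simp only [mem_Ioi] at this; linarith) _) (hFp r hr)
  set Q : ℝ → ℝ := fun r => r ^ (n - 1) * (l ^ 2 / F M r + l * D r + V r) with hQ
  have hQc : ContinuousOn Q (Icc a b) := (continuous_pow _).continuousOn.mul
    (((continuousOn_const.div hFc fun r hr => (hFp r hr).ne').add
      (continuousOn_const.mul (hDc.mono hsub))).add (hVc.mono hsub))
  have hQp : ∀ r ∈ Icc a b, 0 ≤ Q r := fun r hr => by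
    have h1 : 0 < r := by have := hsub hr; simp only [mem_Ioi] at this; linarith
    have h2 := hD r (hsub hr)
    have h3 := hV r (hsub hr)
    have h4 := hFp r hr
    positivity
  obtain ⟨f, g, hfa, hga, hfg⟩ := exists_linear_system hab (A := fun r => (P r)⁻¹) (Q := Q)
    (hPc.inv₀ fun r hr => (hPp r hr).ne') hQc (Real.exp (l * tortoise M a))
    (P a * (l / F M a * Real.exp (l * tortoise M a)))
  have hae : a ∈ Icc a b := left_mem_Icc.2 hab.le
  have hfc : ContinuousOn f (Icc a b) := fun r hr => (hfg r hr).1.continuousWithinAt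
  have hgc : ContinuousOn g (Icc a b) := fun r hr => (hfg r hr).2.continuousWithinAt
  have hfd : ∀ r ∈ Ioo a b, HasDerivAt f ((P r)⁻¹ * g r) r := fun r hr =>
    (hfg r (Ioo_subset_Icc_self hr)).1.hasDerivAt (Icc_mem_nhds hr.1 hr.2)
  have hgd : ∀ r ∈ Ioo a b, HasDerivAt g (Q r * f r) r := fun r hr =>
    (hfg r (Ioo_subset_Icc_self hr)).2.hasDerivAt (Icc_mem_nhds hr.1 hr.2)
  -- `f g` is nondecreasing, hence nonnegative, hence `f²` is nondecreasing and `f` has no zero.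
  have hga0 : 0 ≤ g a := by
    rw [hga]
    have := hPp a hae
    have := hFp a hae
    positivity
  have hfg0 : ∀ r ∈ Icc a b, 0 ≤ f r * g r := by
    intro r hr
    have hm : MonotoneOn (fun r => f r * g r) (Icc a b) := by
      refine monotoneOn_of_hasDerivWithinAt_nonneg (f' := fun r => (P r)⁻¹ * g r * g r + f r * (Q r * f r))
        (convex_Icc a b) (hfc.mul hgc) ?_ ?_
      · intro s hs
        rw [interior_Icc] at hs ⊢
        exact ((hfd s hs).mul (hgd s hs)).hasDerivWithinAt
      · intro s hs
        rw [interior_Icc] at hs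
        have h1 := hPp s (Ioo_subset_Icc_self hs)
        have h2 := hQp s (Ioo_subset_Icc_self hs)
        have h3 := mul_nonneg h2 (mul_self_nonneg (f s))
        have h4 := mul_nonneg (inv_pos.2 h1).le (mul_self_nonneg (g s))
        nlinarith
    have h1 := hm hae hr hr.1
    have h2 : 0 ≤ f a * g a := mul_nonneg (by rw [hfa]; positivity) hga0
    exact h2.trans h1
  have hsq : ∀ r ∈ Icc a b, f r ≠ 0 := by
    intro r hr
    have hm : MonotoneOn (fun r => f r * f r) (Icc a b) := by
      refine monotoneOn_of_hasDerivWithinAt_nonneg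
        (f' := fun r => (P r)⁻¹ * g r * f r + f r * ((P r)⁻¹ * g r))
        (convex_Icc a b) (hfc.mul hfc) ?_ ?_
      · intro s hs
        rw [interior_Icc] at hs ⊢
        exact ((hfd s hs).mul (hfd s hs)).hasDerivWithinAt
      · intro s hs
        rw [interior_Icc] at hs
        have h1 := hPp s (Ioo_subset_Icc_self hs)
        have h4 := mul_nonneg (inv_pos.2 h1).le (hfg0 s (Ioo_subset_Icc_self hs))
        nlinarith
    have h1 : f a * f a ≤ f r * f r := hm hae hr hr.1
    have h2 : 0 < f a * f a := by rw [hfa]; positivity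
    intro h0
    rw [h0] at h1
    linarith
  have hpos : ∀ r ∈ Icc a b, 0 < f r := by
    intro r hr
    by_contra hneg
    push Not at hneg
    have h1 : (0 : ℝ) ∈ f '' Icc a r :=
      intermediate_value_Icc' hr.1 (hfc.mono (Icc_subset_Icc_right hr.2))
        ⟨hneg, by rw [hfa]; positivity⟩
    obtain ⟨s, hs, hs0⟩ := h1
    exact hsq s ⟨hs.1, hs.2.trans hr.2⟩ hs0
  refine ⟨f, fun r => (P r)⁻¹ * g r, hfc, (hPc.inv₀ fun r hr => (hPp r hr).ne').mul hgc, hfd,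
    ?_, hfa, ?_, hpos, ?_⟩
  · intro r hr
    have hrI := Ioo_subset_Icc_self hr
    have hPd : HasDerivAt P (2 * decayRate n / r * r ^ (n - 1) * F M r
        + r ^ (n - 1) * (2 * M / r ^ 2)) r :=
      (hasDerivAt_pow_pred hn (hne r hrI)).mul (hasDerivAt_F (hne r hrI))
    have h := (hPd.inv (hPp r hrI).ne').mul (hgd r hr)
    convert! h using 1
    have h1 := hne r hrI
    have h2 := (hFp r hrI).ne'
    simp only [hP, hQ, Pi.inv_apply]
    have h3 : r ^ (n - 1) ≠ 0 := pow_ne_zero _ h1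
    field_simp
    ring
  · simp only [hga, hfa]
    rw [inv_mul_cancel_left₀ (hPp a hae).ne']
  · intro r hr
    have h1 := hfg0 r hr
    have h2 := nonneg_of_mul_nonneg_right h1 (hpos r hr)
    exact mul_nonneg (inv_pos.2 (hPp r hr)).le h2

section Profile

variable {n : ℕ} {M : ℝ} {D V : ℝ → ℝ} {a b l : ℝ} {φ φ' : ℝ → ℝ}

/-- The logarithmic derivative of the profile `k` in `φ = r^{-(n-1)/2} e^{l s} k`. -/
noncomputable def profileLogDeriv (n : ℕ) (M l : ℝ) (φ φ' : ℝ → ℝ) (r : ℝ) : ℝ :=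
  φ' r / φ r + decayRate n / r - l / F M r

/-- The potential of the equation for the profile `k`. -/
noncomputable def profilePotential (n : ℕ) (M : ℝ) (D V : ℝ → ℝ) (l r : ℝ) : ℝ :=
  l * D r + V r + decayRate n * (decayRate n - 1) * F M r / r ^ 2
    + decayRate n * (2 * M) / r ^ 3

theorem IsMode.hasDerivAt_profileLogDeriv (hM : 0 < M) (ha : 2 * M < a)
    (h : IsMode n M D V a b l φ φ') {r : ℝ} (hr : r ∈ Ioo a b) :
    HasDerivAt (profileLogDeriv n M l φ φ')
      ((profilePotential n M D V l r - (2 * M / r ^ 2 + 2 * l) * profileLogDeriv n M l φ φ' r)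
        / F M r - profileLogDeriv n M l φ φ' r ^ 2) r := by
  have hr2 : 2 * M < r := ha.trans hr.1
  have hr0 : r ≠ 0 := by linarith
  have hF := (F_pos hM hr2).ne'
  have hφ := (h.pos r (Ioo_subset_Icc_self hr)).ne'
  have h1 := (((h.hasDerivAt_deriv r hr).div (h.hasDerivAt r hr) hφ).add
    ((hasDerivAt_inv hr0).const_mul (decayRate n))).sub
    (((hasDerivAt_F (M := M) hr0).inv hF).const_mul l)
  convert! h1 using 1
  simp only [profileLogDeriv, profilePotential]
  field_simp
  ring

theorem IsMode.continuousOn_profileLogDeriv (hM : 0 < M) (ha : 2 * M < a)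
    (h : IsMode n M D V a b l φ φ') : ContinuousOn (profileLogDeriv n M l φ φ') (Icc a b) := by
  have h0 : ∀ r ∈ Icc a b, r ≠ 0 := fun r hr => by have := hr.1; linarith
  exact ((h.continuousOn_deriv.div h.continuousOn fun r hr => (h.pos r hr).ne').add
    (continuousOn_const.div continuousOn_id h0)).sub
    (continuousOn_const.div (continuousOn_F.mono h0) fun r hr => (F_pos hM (ha.trans_le hr.1)).ne')

theorem IsMode.profileLogDeriv_left (hab : a < b)
    (h : IsMode n M D V a b l φ φ') :
    profileLogDeriv n M l φ φ' a = decayRate n / a := by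
  have := (h.pos a (left_mem_Icc.2 hab.le)).ne'
  rw [profileLogDeriv, h.initial_deriv, mul_div_assoc, div_self this]
  ring

theorem IsMode.profileLogDeriv_nonneg (hn : 3 ≤ n) (hM : 0 < M)
    (hD : ∀ r, 2 * M < r → 0 ≤ D r) (hV : ∀ r, 2 * M < r → 0 ≤ V r) (ha : 2 * M < a) (hab : a < b)
    (hl : 0 ≤ l) (h : IsMode n M D V a b l φ φ') :
    ∀ r ∈ Icc a b, 0 ≤ profileLogDeriv n M l φ φ' r := by
  have hν := one_le_decayRate hn
  have h0 : ∀ r ∈ Icc a b, r ≠ 0 := fun r hr => by have := hr.1; linarith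
  have hFp : ∀ r ∈ Icc a b, 0 < F M r := fun r hr => F_pos hM (ha.trans_le hr.1)
  have hzc := h.continuousOn_profileLogDeriv hM ha
  refine nonneg_of_deriv_add_mul_nonneg
    (c := fun r => (2 * M / r ^ 2 + 2 * l) / F M r + profileLogDeriv n M l φ φ' r) ?_ hzc
    (fun r hr => h.hasDerivAt_profileLogDeriv hM ha hr) ?_ ?_
  · refine ContinuousOn.add (ContinuousOn.div ?_ (continuousOn_F.mono h0)
      fun r hr => (hFp r hr).ne') hzc
    exact (continuousOn_const.div (continuousOn_id.pow 2) fun r hr => pow_ne_zero 2 (h0 r hr)).add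
      continuousOn_const
  · intro r hr
    have hr2 : 2 * M < r := ha.trans hr.1
    have hF := F_pos hM hr2
    have hq : 0 ≤ profilePotential n M D V l r := by
      have h1 := hD r hr2
      have h2 := hV r hr2
      have h3 : 0 ≤ decayRate n - 1 := by linarith
      have h4 : 0 < r := by linarith
      unfold profilePotential
      positivity
    have e : (profilePotential n M D V l r - (2 * M / r ^ 2 + 2 * l) * profileLogDeriv n M l φ φ' r)
        / F M r - profileLogDeriv n M l φ φ' r ^ 2
        + ((2 * M / r ^ 2 + 2 * l) / F M r + profileLogDeriv n M l φ φ' r)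
          * profileLogDeriv n M l φ φ' r = profilePotential n M D V l r / F M r := by ring
    rw [e]
    positivity
  · rw [h.profileLogDeriv_left hab]
    have : 0 < a := by linarith
    positivity

/-- Comparison principle for the Riccati equation of the logarithmic derivative. -/
theorem IsMode.profileLogDeriv_le (hM : 0 < M) (ha : 2 * M < a)
    (h : IsMode n M D V a b l φ φ') {c : ℝ} (hac : a ≤ c) {y y' : ℝ → ℝ}
    (hy : ContinuousOn y (Icc c b)) (hyd : ∀ r ∈ Ioo c b, HasDerivAt y (y' r) r)
    (hsup : ∀ r ∈ Ioo c b, profilePotential n M D V l r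
      ≤ F M r * y' r + 2 * M / r ^ 2 * y r + 2 * l * y r + F M r * y r ^ 2)
    (hc : profileLogDeriv n M l φ φ' c ≤ y c) :
    ∀ r ∈ Icc c b, profileLogDeriv n M l φ φ' r ≤ y r := by
  have hsub : Icc c b ⊆ Icc a b := Icc_subset_Icc_left hac
  have h0 : ∀ r ∈ Icc a b, r ≠ 0 := fun r hr => by have := hr.1; linarith
  have hFp : ∀ r ∈ Icc a b, 0 < F M r := fun r hr => F_pos hM (ha.trans_le hr.1)
  have hzc := (h.continuousOn_profileLogDeriv hM ha).mono hsub
  have key := nonneg_of_deriv_add_mul_nonneg (a := c) (b := b)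
    (w := fun r => y r - profileLogDeriv n M l φ φ' r)
    (c := fun r => (2 * M / r ^ 2 + 2 * l) / F M r + (y r + profileLogDeriv n M l φ φ' r)) ?_
    (hy.sub hzc)
    (fun r hr => (hyd r hr).sub (h.hasDerivAt_profileLogDeriv hM ha
      ⟨hac.trans_lt hr.1, hr.2⟩)) ?_ (sub_nonneg.2 hc)
  · exact fun r hr => sub_nonneg.1 (key r hr)
  · refine ContinuousOn.add (ContinuousOn.div ?_ (continuousOn_F.mono fun r hr => h0 r (hsub hr))
      fun r hr => (hFp r (hsub hr)).ne') (hy.add hzc)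
    exact (continuousOn_const.div (continuousOn_id.pow 2)
      fun r hr => pow_ne_zero 2 (h0 r (hsub hr))).add continuousOn_const
  · intro r hr
    have hF := hFp r (hsub (Ioo_subset_Icc_self hr))
    have := hsup r hr
    have e : y' r - ((profilePotential n M D V l r
        - (2 * M / r ^ 2 + 2 * l) * profileLogDeriv n M l φ φ' r)
        / F M r - profileLogDeriv n M l φ φ' r ^ 2)
        + ((2 * M / r ^ 2 + 2 * l) / F M r + (y r + profileLogDeriv n M l φ φ' r))
          * (y r - profileLogDeriv n M l φ φ' r)
        = (F M r * y' r + 2 * M / r ^ 2 * y r + 2 * l * y r + F M r * y r ^ 2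
          - profilePotential n M D V l r) / F M r := by
      field_simp
      ring
    rw [e]
    exact div_nonneg (by linarith) hF.le

/-- The profile `k` in `φ = r^{-(n-1)/2} e^{l s} k`. -/
noncomputable def profile (n : ℕ) (M l : ℝ) (φ : ℝ → ℝ) (r : ℝ) : ℝ :=
  r ^ decayRate n * Real.exp (-(l * tortoise M r)) * φ r

theorem eq_profile {r : ℝ} (hr : 0 < r) :
    φ r = r ^ (-decayRate n) * Real.exp (l * tortoise M r) * profile n M l φ r := by
  rw [profile, Real.rpow_neg hr.le, Real.exp_neg]
  have := (Real.rpow_pos_of_pos hr (decayRate n)).ne'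
  field_simp

theorem IsMode.hasDerivAt_profile (hM : 0 < M) (ha : 2 * M < a)
    (h : IsMode n M D V a b l φ φ') {r : ℝ} (hr : r ∈ Ioo a b) :
    HasDerivAt (profile n M l φ) (profileLogDeriv n M l φ φ' r * profile n M l φ r) r := by
  have hr2 : 2 * M < r := ha.trans hr.1
  have hr0 : 0 < r := by linarith
  have hF := (F_pos hM hr2).ne'
  have hφ := (h.pos r (Ioo_subset_Icc_self hr)).ne'
  have h1 := (((Real.hasDerivAt_rpow_const (p := decayRate n) (Or.inl hr0.ne'))).mul
    (((hasDerivAt_tortoise hM hr2).const_mul l).neg.exp)).mul (h.hasDerivAt r hr)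
  convert! h1 using 1
  simp only [profileLogDeriv, profile, Pi.mul_apply, Pi.neg_apply]
  rw [Real.rpow_sub_one hr0.ne']
  field_simp
  ring

theorem IsMode.continuousOn_profile (hM : 0 < M) (ha : 2 * M < a)
    (h : IsMode n M D V a b l φ φ') : ContinuousOn (profile n M l φ) (Icc a b) := by
  have h0 : ∀ r ∈ Icc a b, r ≠ 0 := fun r hr => by have := hr.1; linarith
  exact ((continuousOn_id.rpow_const fun r hr => Or.inl (h0 r hr)).mul
    (Real.continuous_exp.comp_continuousOn (continuousOn_const.mul
      ((continuousOn_tortoise hM).mono fun r hr => ha.trans_le hr.1)).neg)).mul h.continuousOn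

theorem IsMode.profile_left (h : IsMode n M D V a b l φ φ') :
    profile n M l φ a = a ^ decayRate n := by
  rw [profile, h.initial, mul_assoc, ← Real.exp_add, neg_add_cancel, Real.exp_zero, mul_one]

theorem IsMode.profile_pos (hM : 0 < M) (ha : 2 * M < a) (h : IsMode n M D V a b l φ φ') {r : ℝ}
    (hr : r ∈ Icc a b) : 0 < profile n M l φ r := by
  have h1 := h.pos r hr
  have h2 : 0 < r := by linarith [hr.1]
  unfold profile
  positivity

theorem IsMode.profile_le (hM : 0 < M) (ha : 2 * M < a)
    (h : IsMode n M D V a b l φ φ') {c : ℝ} (hac : a ≤ c) {y Y : ℝ → ℝ}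
    (hY : ContinuousOn Y (Icc c b)) (hYd : ∀ r ∈ Ioo c b, HasDerivAt Y (y r) r)
    (hz : ∀ r ∈ Icc c b, profileLogDeriv n M l φ φ' r ≤ y r) {r : ℝ} (hr : r ∈ Icc c b) :
    profile n M l φ r ≤ profile n M l φ c * Real.exp (Y r - Y c) := by
  have hsub : Icc c b ⊆ Icc a b := Icc_subset_Icc_left hac
  refine le_mul_exp_sub_of_deriv_le ((h.continuousOn_profile hM ha).mono hsub)
    (fun s hs => h.hasDerivAt_profile hM ha ⟨hac.trans_lt hs.1, hs.2⟩) hY hYd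
    (fun s hs => ?_) c ⟨le_rfl, hr.1.trans hr.2⟩ r hr hr.1
  exact mul_le_mul_of_nonneg_right (hz s (Ioo_subset_Icc_self hs))
    (h.profile_pos hM ha (hsub (Ioo_subset_Icc_self hs))).le

/-- The profile is nondecreasing, which bounds the mode from below. -/
theorem IsMode.le_profile (hn : 3 ≤ n) (hM : 0 < M)
    (hD : ∀ r, 2 * M < r → 0 ≤ D r) (hV : ∀ r, 2 * M < r → 0 ≤ V r) (ha : 2 * M < a) (hab : a < b)
    (hl : 0 ≤ l) (h : IsMode n M D V a b l φ φ') {r : ℝ} (hr : r ∈ Icc a b) :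
    (2 * M) ^ decayRate n ≤ profile n M l φ r := by
  have hm : MonotoneOn (profile n M l φ) (Icc a b) := by
    refine monotoneOn_of_hasDerivWithinAt_nonneg (convex_Icc a b) (h.continuousOn_profile hM ha)
      (f' := fun r => profileLogDeriv n M l φ φ' r * profile n M l φ r) ?_ ?_
    · intro s hs
      rw [interior_Icc] at hs ⊢
      exact (h.hasDerivAt_profile hM ha hs).hasDerivWithinAt
    · intro s hs
      rw [interior_Icc] at hs
      exact mul_nonneg (h.profileLogDeriv_nonneg hn hM hD hV ha hab hl s (Ioo_subset_Icc_self hs))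
        (h.profile_pos hM ha (Ioo_subset_Icc_self hs)).le
  have h1 := hm (left_mem_Icc.2 hab.le) hr hr.1
  rw [h.profile_left] at h1
  refine le_trans (Real.rpow_le_rpow (by positivity) ha.le ?_) h1
  linarith [one_le_decayRate hn]

theorem IsMode.monotoneOn (h : IsMode n M D V a b l φ φ') : MonotoneOn φ (Icc a b) := by
  refine monotoneOn_of_hasDerivWithinAt_nonneg (convex_Icc a b) h.continuousOn (f' := φ') ?_ ?_
  · intro s hs
    rw [interior_Icc] at hs ⊢
    exact (h.hasDerivAt s hs).hasDerivWithinAt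
  · intro s hs
    rw [interior_Icc] at hs
    exact h.deriv_nonneg s (Ioo_subset_Icc_self hs)

end Profile

/-! ### Uniform bounds for the radial solutions -/

theorem rpow_neg_le_mul_rpow_neg {M r e e' : ℝ} (hM : 0 < M) (hr : 2 * M ≤ r) (he : e ≤ e') :
    r ^ (-e') ≤ (2 * M) ^ (e - e') * r ^ (-e) := by
  have hr0 : 0 < r := by linarith
  have h1 : r ^ (-e') = r ^ (e - e') * r ^ (-e) := by
    rw [← Real.rpow_add hr0]; congr 1; ring
  rw [h1]
  exact mul_le_mul_of_nonneg_right
    (Real.rpow_le_rpow_of_nonpos (by linarith) hr (by linarith)) (Real.rpow_nonneg hr0.le _)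

section Bounds

variable {n : ℕ} {M : ℝ} {D V : ℝ → ℝ} {a b l : ℝ} {φ φ' : ℝ → ℝ}

theorem profilePotential_le (hn : 3 ≤ n) (hM : 0 < M) {r : ℝ} (hr : 2 * M < r) :
    profilePotential n M D V l r ≤ l * D r + V r + decayRate n ^ 2 / r ^ 2 := by
  have hν := one_le_decayRate hn
  have hr0 : 0 < r := by linarith
  have hF := F_pos hM hr
  have e : profilePotential n M D V l r = l * D r + V r
      + (decayRate n * (decayRate n - 1) * F M r + decayRate n * (2 * M / r)) / r ^ 2 := by
    rw [profilePotential]; field_simp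
    ring
  have hx : 2 * M / r = 1 - F M r := by rw [F]; ring
  have hF1 := F_lt_one hM hr
  rw [e, hx]
  gcongr
  have h1 : 0 ≤ decayRate n - 1 := by linarith
  have h2 : 0 ≤ 1 - F M r := by linarith
  nlinarith [mul_nonneg h1 h2, mul_nonneg (mul_nonneg h1 h2) (by linarith : 0 ≤ decayRate n)]

/-- The logarithmic derivative of `e^{-l s} φ` is bounded by that of the profile. -/
theorem IsMode.abs_deriv_sub_le (hn : 3 ≤ n) (hM : 0 < M) (ha : 2 * M < a)
    (h : IsMode n M D V a b l φ φ') {r B : ℝ} (hr : r ∈ Icc a b)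
    (h0 : 0 ≤ profileLogDeriv n M l φ φ' r) (hB : profileLogDeriv n M l φ φ' r ≤ B) :
    |φ' r - l / F M r * φ r| ≤ (decayRate n / (2 * M) + B) * φ r := by
  have hν := one_le_decayRate hn
  have hφ := h.pos r hr
  have hr2 : 2 * M < r := ha.trans_le hr.1
  have hr0 : 0 < r := by linarith
  have e : φ' r - l / F M r * φ r
      = (profileLogDeriv n M l φ φ' r - decayRate n / r) * φ r := by
    rw [profileLogDeriv]; field_simp
    ring
  have h1 : decayRate n / r ≤ decayRate n / (2 * M) := by gcongr
  have h2 : 0 ≤ decayRate n / r := by positivity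
  rw [e, abs_mul, abs_of_pos hφ]
  refine mul_le_mul_of_nonneg_right (abs_le.2 ⟨?_, ?_⟩) hφ.le <;> linarith

/-- The mode with exponent `0` stays bounded for every admissible potential: this is where `γ > 2`
enters. -/
theorem exists_mode_zero_bound (hn : 3 ≤ n) (hM : 0 < M) {γ μ₂ : ℝ} (hγ : 2 < γ) (hγ' : γ ≤ 5 / 2)
    (hμ₂ : 0 ≤ μ₂) (hD : ∀ r, 2 * M < r → 0 ≤ D r)
    (hV : ∀ r, 2 * M < r → 0 ≤ V r ∧ V r ≤ μ₂ * r ^ (-γ)) :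
    ∃ C > (0 : ℝ), ∀ a b φ φ', 2 * M < a → a < b → IsMode n M D V a b 0 φ φ' →
      ∀ r ∈ Icc a b, 1 ≤ φ r ∧ φ r ≤ C ∧ |φ' r| ≤ C * φ r := by
  have hν := one_le_decayRate hn
  have hn3 : (3 : ℝ) ≤ 2 * decayRate n + 1 := by linarith
  set A := 2 * μ₂ with hA
  have hA0 : 0 ≤ A := by positivity
  set C₁ := Real.exp (A * (2 * M) ^ (2 - γ) / (γ - 2)) with hC₁
  set C₂ := decayRate n / (2 * M) + (decayRate n / (2 * M) + A * (2 * M) ^ (1 - γ)) with hC₂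
  have hC₂0 : 0 ≤ C₂ := by positivity
  refine ⟨C₁ + C₂, by positivity, fun a b φ φ' ha hab h r hr => ?_⟩
  have ha0 : 0 < a := by linarith
  have hz : ∀ s ∈ Icc a b, profileLogDeriv n M 0 φ φ' s ≤ decayRate n / s + A * s ^ (1 - γ) := by
    refine h.profileLogDeriv_le hM ha le_rfl
      (y' := fun s => -decayRate n / s ^ 2 + A * ((1 - γ) * s ^ (-γ))) ?_ ?_ ?_ ?_
    · have h0 : ∀ s ∈ Icc a b, s ≠ 0 := fun s hs => by have := hs.1; linarith
      exact (continuousOn_const.div continuousOn_id h0).add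
        (continuousOn_const.mul (continuousOn_id.rpow_const fun s hs => Or.inl (h0 s hs)))
    · intro s hs
      have hs0 : s ≠ 0 := by have := hs.1; linarith
      have h1 := ((hasDerivAt_inv hs0).const_mul (decayRate n)).add
        ((Real.hasDerivAt_rpow_const (p := 1 - γ) (Or.inl hs0)).const_mul A)
      convert! h1 using 1
      rw [show (1 - γ - 1) = -γ by ring]
      ring
    · intro s hs
      have hs2 : 2 * M < s := ha.trans hs.1
      have hs0 : 0 < s := by linarith
      set w := s ^ (-γ) with hw
      have hw0 : 0 < w := Real.rpow_pos_of_pos hs0 _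
      have hw1 : s ^ (1 - γ) = s * w := by
        rw [hw, sub_eq_add_neg, Real.rpow_add hs0, Real.rpow_one]
      have hVs := (hV s hs2).2
      have hF := F_pos hM hs2
      have hF1 := F_lt_one hM hs2
      have hx : 2 * M = (1 - F M s) * s := by rw [F]; field_simp; ring
      rw [hw1, profilePotential]
      have e : F M s * (-decayRate n / s ^ 2 + A * ((1 - γ) * w))
          + 2 * M / s ^ 2 * (decayRate n / s + A * (s * w))
          + 2 * 0 * (decayRate n / s + A * (s * w))
          + F M s * (decayRate n / s + A * (s * w)) ^ 2
          = decayRate n * (decayRate n - 1) * F M s / s ^ 2 + decayRate n * (2 * M) / s ^ 3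
            + A * w * (F M s * (2 * decayRate n + 1 - γ) + (1 - F M s)) + F M s * (A * (s * w)) ^ 2
            := by
        rw [hx]
        field_simp
        ring
      rw [e]
      have h1 : 1 / 2 ≤ F M s * (2 * decayRate n + 1 - γ) + (1 - F M s) := by nlinarith
      have h2 : μ₂ * w ≤ A * w * (F M s * (2 * decayRate n + 1 - γ) + (1 - F M s)) := by
        have := mul_le_mul_of_nonneg_left h1 (mul_nonneg hA0 hw0.le)
        rw [hA] at this ⊢
        linarith
      have h3 : 0 ≤ F M s * (A * (s * w)) ^ 2 := by positivity
      linarith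
    · rw [h.profileLogDeriv_left hab]
      have := Real.rpow_nonneg ha0.le (1 - γ)
      nlinarith
  have hr2 : 2 * M < r := ha.trans_le hr.1
  have hr0 : 0 < r := by linarith
  have hφ1 : 1 ≤ φ r := by
    have := h.monotoneOn (left_mem_Icc.2 hab.le) hr hr.1
    rwa [h.initial, zero_mul, Real.exp_zero] at this
  refine ⟨hφ1, ?_, ?_⟩
  · have hk := h.profile_le hM ha le_rfl
      (Y := fun s => decayRate n * Real.log s - A * s ^ (2 - γ) / (γ - 2))
      (y := fun s => decayRate n / s + A * s ^ (1 - γ)) ?_ ?_ hz hr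
    · rw [h.profile_left] at hk
      have e := eq_profile (φ := φ) (n := n) (M := M) (l := 0) hr0
      rw [zero_mul, Real.exp_zero, mul_one] at e
      have h1 : a ^ decayRate n * Real.exp (decayRate n * Real.log r - A * r ^ (2 - γ) / (γ - 2)
          - (decayRate n * Real.log a - A * a ^ (2 - γ) / (γ - 2)))
          ≤ r ^ decayRate n * C₁ := by
        rw [Real.rpow_def_of_pos ha0 (decayRate n), Real.rpow_def_of_pos hr0 (decayRate n), hC₁, ← Real.exp_add, ← Real.exp_add]
        refine Real.exp_le_exp.2 ?_
        have h2 : A * a ^ (2 - γ) / (γ - 2) ≤ A * (2 * M) ^ (2 - γ) / (γ - 2) := by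
          have : a ^ (2 - γ) ≤ (2 * M) ^ (2 - γ) :=
            Real.rpow_le_rpow_of_nonpos (by linarith) ha.le (by linarith)
          have h5 : 0 < γ - 2 := by linarith
          gcongr
        have h3 : 0 ≤ A * r ^ (2 - γ) / (γ - 2) := by
          have h5 : 0 < γ - 2 := by linarith
          positivity
        linarith
      have h2 := hk.trans h1
      have h3 : φ r ≤ C₁ := by
        rw [e]
        calc r ^ (-decayRate n) * profile n M 0 φ r
            ≤ r ^ (-decayRate n) * (r ^ decayRate n * C₁) := by gcongr
          _ = C₁ := by
            rw [← mul_assoc, ← Real.rpow_add hr0, neg_add_cancel, Real.rpow_zero, one_mul]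
      linarith
    · have h0 : ∀ s ∈ Icc a b, s ≠ 0 := fun s hs => by have := hs.1; linarith
      exact (continuousOn_const.mul (continuousOn_id.log h0)).sub
        ((continuousOn_const.mul (continuousOn_id.rpow_const fun s hs => Or.inl (h0 s hs))).div_const _)
    · intro s hs
      have hs0 : s ≠ 0 := by have := hs.1; linarith
      have h1 := ((Real.hasDerivAt_log hs0).const_mul (decayRate n)).sub
        (((Real.hasDerivAt_rpow_const (p := 2 - γ) (Or.inl hs0)).const_mul A).div_const (γ - 2))
      convert! h1 using 1
      rw [show (2 - γ - 1) = 1 - γ by ring]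
      have : γ - 2 ≠ 0 := by linarith
      field_simp
      ring
  · have h1 := h.abs_deriv_sub_le hn hM ha hr
      (h.profileLogDeriv_nonneg hn hM hD (fun r hr => (hV r hr).1) ha hab le_rfl r hr)
      (B := decayRate n / (2 * M) + A * (2 * M) ^ (1 - γ)) ((hz r hr).trans ?_)
    · rw [zero_div, zero_mul, sub_zero] at h1
      refine h1.trans (mul_le_mul_of_nonneg_right ?_ (by linarith))
      rw [← hC₂]
      have : 0 < C₁ := by positivity
      linarith
    · have : r ^ (1 - γ) ≤ (2 * M) ^ (1 - γ) :=
        Real.rpow_le_rpow_of_nonpos (by linarith) hr2.le (by linarith)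
      gcongr

/-- Bounds for the mode with exponent `1`: the profile stays bounded because `D` and `V` are
integrable at infinity. -/
theorem exists_mode_one_bound (hn : 3 ≤ n) (hM : 0 < M) {β γ μ₁ μ₂ : ℝ} (hβ : 1 < β) (hβ' : β ≤ 2)
    (hγ : 2 < γ) (hμ₁ : 0 ≤ μ₁) (hμ₂ : 0 ≤ μ₂)
    (hD : ∀ r, 2 * M < r → 0 ≤ D r ∧ D r ≤ μ₁ * r ^ (-β))
    (hV : ∀ r, 2 * M < r → 0 ≤ V r ∧ V r ≤ μ₂ * r ^ (-γ)) :
    ∃ C > (0 : ℝ), ∀ a b φ φ', 2 * M < a → a ≤ 4 * M → a < b → IsMode n M D V a b 1 φ φ' →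
      ∀ r ∈ Icc a b, φ r ≤ C * (r ^ (-decayRate n) * Real.exp (tortoise M r)) ∧
        |φ' r - 1 / F M r * φ r| ≤ C * φ r := by
  have hν := one_le_decayRate hn
  set B := μ₁ + μ₂ * (2 * M) ^ (β - γ) + decayRate n ^ 2 * (2 * M) ^ (β - 2) with hB
  have hB0 : 0 ≤ B := by positivity
  set A := B * (1 + 1 / M) ^ β + decayRate n / (2 * M) * (4 * M + 2) ^ β with hA
  have hA0 : 0 ≤ A := by positivity
  set C₁ := (4 * M) ^ decayRate n * Real.exp (A / (β - 1)) with hC₁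
  set C₂ := decayRate n / (2 * M) + A with hC₂
  have hC₂0 : 0 ≤ C₂ := by positivity
  refine ⟨C₁ + C₂, by positivity, fun a b φ φ' ha ha4 hab h r hr => ?_⟩
  have ha0 : 0 < a := by linarith
  have hz : ∀ s ∈ Icc a b, profileLogDeriv n M 1 φ φ' s ≤ A * (s + 2) ^ (-β) := by
    refine h.profileLogDeriv_le hM ha le_rfl
      (y' := fun s => A * (-β * (s + 2) ^ (-β - 1))) ?_ ?_ ?_ ?_
    · have h0 : ∀ s ∈ Icc a b, s + 2 ≠ 0 := fun s hs => by have := hs.1; linarith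
      exact (continuousOn_const.mul ((continuousOn_id.add continuousOn_const).rpow_const
        fun s hs => Or.inl (h0 s hs)))
    · intro s hs
      have hs0 : s + 2 ≠ 0 := by have := hs.1; linarith
      have h1 := (((hasDerivAt_id s).add_const 2).rpow_const (p := -β) (Or.inl hs0)).const_mul A
      convert! h1 using 1
      simp
    · intro s hs
      have hs2 : 2 * M < s := ha.trans hs.1
      have hs0 : 0 < s := by linarith
      have hF := F_pos hM hs2
      have hF1 := F_lt_one hM hs2
      set w := (s + 2) ^ (-β) with hw
      have hw0 : 0 < w := Real.rpow_pos_of_pos (by linarith) _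
      have hw1 : (s + 2) ^ (-β - 1) = w / (s + 2) := by
        rw [hw, Real.rpow_sub_one (by linarith)]
      have h1 : profilePotential n M D V 1 s ≤ B * s ^ (-β) := by
        refine (profilePotential_le hn hM hs2).trans ?_
        have h2 := (hD s hs2).2
        have h3 := (hV s hs2).2
        have h4 := mul_le_mul_of_nonneg_left (rpow_neg_le_mul_rpow_neg hM hs2.le (by linarith : β ≤ γ))
          hμ₂
        have h5 := mul_le_mul_of_nonneg_left (rpow_neg_le_mul_rpow_neg hM hs2.le hβ')
          (sq_nonneg (decayRate n))
        have h6 : s ^ (-2 : ℝ) = (s ^ 2)⁻¹ := by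
          rw [Real.rpow_neg hs0.le]; norm_num
        rw [h6, ← div_eq_mul_inv] at h5
        rw [hB]
        linarith
      have h2 : s ^ (-β) ≤ (1 + 1 / M) ^ β * w := by
        rw [hw, Real.rpow_neg hs0.le, Real.rpow_neg (by linarith), ← div_eq_mul_inv,
          le_div_iff₀ (by positivity), inv_mul_le_iff₀ (by positivity),
          ← Real.mul_rpow (by positivity) (by positivity)]
        refine Real.rpow_le_rpow (by linarith) ?_ (by linarith)
        have : 2 ≤ s * (1 / M) := by
          rw [mul_one_div, le_div_iff₀ hM]; linarith
        linarith
      have h3 : B * s ^ (-β) ≤ A * w := by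
        have := mul_le_mul_of_nonneg_left h2 hB0
        have h7 : 0 ≤ decayRate n / (2 * M) * (4 * M + 2) ^ β * w := by positivity
        rw [hA]; linarith
      have h4 : -(A * w) ≤ F M s * (A * (-β * (w / (s + 2)))) := by
        have h8 : β / (s + 2) ≤ 1 := by rw [div_le_one (by linarith)]; linarith
        have h9 : 0 ≤ β / (s + 2) := by positivity
        have e : F M s * (A * (-β * (w / (s + 2)))) = -(A * w) * (F M s * (β / (s + 2))) := by ring
        have h10 : F M s * (β / (s + 2)) ≤ 1 := mul_le_one₀ hF1.le h9 h8
        have h11 : 0 ≤ A * w := by positivity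
        rw [e]
        nlinarith
      have h5 : 0 ≤ 2 * M / s ^ 2 * (A * w) := by positivity
      have h6 : 0 ≤ F M s * (A * w) ^ 2 := by positivity
      rw [hw1]
      linarith
    · rw [h.profileLogDeriv_left hab]
      have h1 : (4 * M + 2) ^ (-β) ≤ (a + 2) ^ (-β) :=
        Real.rpow_le_rpow_of_nonpos (by linarith) (by linarith) (by linarith)
      have h2 : decayRate n / a ≤ decayRate n / (2 * M) := by gcongr
      have h3 : decayRate n / (2 * M) * (4 * M + 2) ^ β * (a + 2) ^ (-β) ≤ A * (a + 2) ^ (-β) := by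
        have : 0 ≤ B * (1 + 1 / M) ^ β := by positivity
        have h4 : 0 ≤ (a + 2) ^ (-β) := by positivity
        gcongr
        rw [hA]; linarith
      have h4 : decayRate n / (2 * M) * (4 * M + 2) ^ β * (4 * M + 2) ^ (-β)
          = decayRate n / (2 * M) := by
        rw [mul_assoc, ← Real.rpow_add (by positivity), add_neg_cancel, Real.rpow_zero, mul_one]
      have h5 : decayRate n / (2 * M) * (4 * M + 2) ^ β * (4 * M + 2) ^ (-β)
          ≤ decayRate n / (2 * M) * (4 * M + 2) ^ β * (a + 2) ^ (-β) := by gcongr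
      linarith
  have hr2 : 2 * M < r := ha.trans_le hr.1
  have hr0 : 0 < r := by linarith
  have hφ := h.pos r hr
  refine ⟨?_, ?_⟩
  · have hk := h.profile_le hM ha le_rfl
      (Y := fun s => -(A * (s + 2) ^ (1 - β) / (β - 1)))
      (y := fun s => A * (s + 2) ^ (-β)) ?_ ?_ hz hr
    · rw [h.profile_left] at hk
      have h5 : 0 < β - 1 := by linarith
      have h1 : a ^ decayRate n * Real.exp (-(A * (r + 2) ^ (1 - β) / (β - 1))
          - -(A * (a + 2) ^ (1 - β) / (β - 1))) ≤ C₁ := by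
        rw [hC₁]
        have h3 : 0 ≤ A * (r + 2) ^ (1 - β) / (β - 1) := by positivity
        have h4 : A * (a + 2) ^ (1 - β) / (β - 1) ≤ A / (β - 1) := by
          have : (a + 2) ^ (1 - β) ≤ 1 := Real.rpow_le_one_of_one_le_of_nonpos (by linarith) (by linarith)
          gcongr
          nlinarith
        have h6 : a ^ decayRate n ≤ (4 * M) ^ decayRate n :=
          Real.rpow_le_rpow ha0.le ha4 (by linarith)
        gcongr
        linarith
      have h2 := hk.trans h1
      rw [eq_profile (φ := φ) (n := n) (M := M) (l := 1) hr0, one_mul, mul_comm]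
      gcongr
      linarith
    · have h0 : ∀ s ∈ Icc a b, s + 2 ≠ 0 := fun s hs => by have := hs.1; linarith
      exact (((continuousOn_const.mul ((continuousOn_id.add continuousOn_const).rpow_const
        fun s hs => Or.inl (h0 s hs))).div_const _)).neg
    · intro s hs
      have hs0 : s + 2 ≠ 0 := by have := hs.1; linarith
      have h1 := ((((hasDerivAt_id s).add_const 2).rpow_const (p := 1 - β)
        (Or.inl hs0)).const_mul A).div_const (β - 1) |>.neg
      convert! h1 using 1
      rw [show (1 - β - 1) = -β by ring]
      have : β - 1 ≠ 0 := by linarith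
      simp only [id]
      field_simp
      ring
  · have h1 := h.abs_deriv_sub_le hn hM ha hr
      (h.profileLogDeriv_nonneg hn hM (fun r hr => (hD r hr).1) (fun r hr => (hV r hr).1) ha hab
        zero_le_one r hr)
      (B := A) ((hz r hr).trans ?_)
    · refine h1.trans (mul_le_mul_of_nonneg_right ?_ hφ.le)
      rw [← hC₂]
      have : 0 < C₁ := by positivity
      linarith
    · have : (r + 2) ^ (-β) ≤ 1 := Real.rpow_le_one_of_one_le_of_nonpos (by linarith) (by linarith)
      nlinarith

/-- Lower bound for modes, uniform for exponents in `[0, 1]`. -/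
theorem exists_mode_lower_bound (hn : 3 ≤ n) (hM : 0 < M)
    (hD : ∀ r, 2 * M < r → 0 ≤ D r) (hV : ∀ r, 2 * M < r → 0 ≤ V r) :
    ∃ c > (0 : ℝ), ∀ a b l φ φ', 2 * M < a → a ≤ 4 * M → a < b → 0 ≤ l → l ≤ 1 →
      IsMode n M D V a b l φ φ' →
      ∀ r ∈ Icc a b, ∀ S, 0 ≤ S → -S ≤ l * tortoise M r → c * Real.exp (-S) ≤ φ r := by
  have hν := one_le_decayRate hn
  refine ⟨2 ^ (-decayRate n) * Real.exp (-|tortoise M (4 * M)|), by positivity,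
    fun a b l φ φ' ha ha4 hab hl hl1 h r hr S hS hSr => ?_⟩
  have key : ∀ s ∈ Icc a b, s ≤ 4 * M → 2 ^ (-decayRate n) * Real.exp (l * tortoise M s) ≤ φ s := by
    intro s hs hs4
    have hs0 : 0 < s := by linarith [hs.1]
    have h1 := h.le_profile hn hM hD hV ha hab hl hs
    rw [eq_profile (φ := φ) (n := n) (M := M) (l := l) hs0, mul_right_comm]
    have h2 : (4 * M) ^ (-decayRate n) ≤ s ^ (-decayRate n) :=
      Real.rpow_le_rpow_of_nonpos hs0 hs4 (by linarith)
    have h3 : (2 : ℝ) ^ (-decayRate n) = (4 * M) ^ (-decayRate n) * (2 * M) ^ decayRate n := by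
      rw [show 4 * M = 2 * (2 * M) by ring, Real.mul_rpow (by norm_num) (by positivity), mul_assoc,
        ← Real.rpow_add (by positivity), neg_add_cancel, Real.rpow_zero, mul_one]
    rw [h3]
    gcongr
  rcases le_total r (4 * M) with hr4 | hr4
  · refine le_trans ?_ (key r hr hr4)
    rw [mul_assoc, ← Real.exp_add]
    gcongr
    linarith [abs_nonneg (tortoise M (4 * M))]
  · have h4 : 4 * M ∈ Icc a b := ⟨ha4, hr4.trans hr.2⟩
    refine le_trans ?_ ((key _ h4 le_rfl).trans (h.monotoneOn h4 hr hr4))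
    rw [mul_assoc, ← Real.exp_add]
    gcongr
    have h5 : |l * tortoise M (4 * M)| ≤ |tortoise M (4 * M)| := by
      rw [abs_mul, abs_of_nonneg hl]
      exact mul_le_of_le_one_left (abs_nonneg _) hl1
    linarith [neg_abs_le (l * tortoise M (4 * M))]

/-- First barrier for the logarithmic derivative of the profile, effective where `l r` is bounded.
It perturbs `(n - 1) / (2 r)`, the exact solution for `l = 0`. -/
theorem IsMode.profileLogDeriv_le_add (hn : 3 ≤ n) (hM : 0 < M) {β μ₁ : ℝ} (hβ : 1 < β)
    (hμ₁ : 0 ≤ μ₁) (hD : ∀ r, 2 * M < r → 0 ≤ D r ∧ D r ≤ μ₁ * r ^ (-β))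
    (hV : ∀ r, 2 * M < r → V r = 0) (ha : 2 * M < a) (hab : a < b) (hl : 0 ≤ l)
    (h : IsMode n M D V a b l φ φ') :
    ∀ r ∈ Icc a b, profileLogDeriv n M l φ φ' r
      ≤ decayRate n / r + μ₁ * (2 * M) ^ (1 - β) * l := by
  have hν := one_le_decayRate hn
  set A := μ₁ * (2 * M) ^ (1 - β) with hA
  have hA0 : 0 ≤ A := by positivity
  have ha0 : 0 < a := by linarith
  refine h.profileLogDeriv_le hM ha le_rfl (y' := fun s => -decayRate n / s ^ 2) ?_ ?_ ?_ ?_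
  · have h0 : ∀ s ∈ Icc a b, s ≠ 0 := fun s hs => by have := hs.1; linarith
    exact (continuousOn_const.div continuousOn_id h0).add continuousOn_const
  · intro s hs
    have hs0 : s ≠ 0 := by have := hs.1; linarith
    have h1 := ((hasDerivAt_inv hs0).const_mul (decayRate n)).add_const (A * l)
    convert! h1 using 1
    ring
  · intro s hs
    have hs2 : 2 * M < s := ha.trans hs.1
    have hs0 : 0 < s := by linarith
    have hF := F_pos hM hs2
    have hF1 := F_lt_one hM hs2
    have hx : 2 * M = (1 - F M s) * s := by rw [F]; field_simp; ring
    rw [profilePotential, hV s hs2]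
    have e : F M s * (-decayRate n / s ^ 2) + 2 * M / s ^ 2 * (decayRate n / s + A * l)
        + 2 * l * (decayRate n / s + A * l) + F M s * (decayRate n / s + A * l) ^ 2
        = decayRate n * (decayRate n - 1) * F M s / s ^ 2 + decayRate n * (2 * M) / s ^ 3
          + (A * l / s) * ((1 - F M s) + 2 * decayRate n * F M s) + 2 * l * (decayRate n / s + A * l)
          + F M s * (A * l) ^ 2 := by
      rw [hx]
      field_simp
      ring
    rw [e]
    have h1 : 1 ≤ (1 - F M s) + 2 * decayRate n * F M s := by nlinarith
    have h2 : A * l / s ≤ A * l / s * ((1 - F M s) + 2 * decayRate n * F M s) :=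
      le_mul_of_one_le_right (by positivity) h1
    have h3 : 0 ≤ 2 * l * (decayRate n / s + A * l) := by positivity
    have h4 : 0 ≤ F M s * (A * l) ^ 2 := by positivity
    have h5 : l * D s ≤ A * l / s := by
      have h6 := rpow_neg_le_mul_rpow_neg hM hs2.le hβ.le
      rw [Real.rpow_neg_one] at h6
      have h7 := (hD s hs2).2.trans (mul_le_mul_of_nonneg_left h6 hμ₁)
      have h8 := mul_le_mul_of_nonneg_left h7 hl
      rw [hA]
      refine h8.trans (le_of_eq ?_)
      ring
    linarith
  · rw [h.profileLogDeriv_left hab]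
    have : 0 ≤ A * l := by positivity
    linarith

/-- Second barrier for the logarithmic derivative of the profile, effective where `l r` is large.
Its integral from `κ / l` to infinity is bounded uniformly in `l`. -/
theorem IsMode.profileLogDeriv_le_far (hn : 3 ≤ n) (hM : 0 < M) {β μ₁ : ℝ} (hβ' : β ≤ 2)
    (hD : ∀ r, 2 * M < r → 0 ≤ D r ∧ D r ≤ μ₁ * r ^ (-β))
    (hV : ∀ r, 2 * M < r → V r = 0) (ha : 2 * M < a) (hl : 0 < l)
    {c A : ℝ} (hac : a ≤ c) (hc : 4 / l ≤ c) (hA1 : μ₁ ≤ A) (hA2 : decayRate n ^ 2 ≤ A)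
    (h : IsMode n M D V a b l φ φ')
    (hcA : profileLogDeriv n M l φ φ' c ≤ A * (c ^ (-β) + l⁻¹ * c ^ (-2 : ℝ))) :
    ∀ r ∈ Icc c b, profileLogDeriv n M l φ φ' r ≤ A * (r ^ (-β) + l⁻¹ * r ^ (-2 : ℝ)) := by
  have hA0 : 0 ≤ A := (sq_nonneg _).trans hA2
  have h0 : ∀ s ∈ Icc c b, s ≠ 0 := fun s hs => by have := hs.1; linarith
  refine h.profileLogDeriv_le hM ha hac
    (y' := fun s => A * (-β * s ^ (-β - 1) + l⁻¹ * (-2 * s ^ (-2 - 1 : ℝ)))) ?_ ?_ ?_ hcA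
  · exact continuousOn_const.mul ((continuousOn_id.rpow_const fun s hs => Or.inl (h0 s hs)).add
      (continuousOn_const.mul (continuousOn_id.rpow_const fun s hs => Or.inl (h0 s hs))))
  · intro s hs
    have hs0 := h0 s (Ioo_subset_Icc_self hs)
    exact (((Real.hasDerivAt_rpow_const (p := -β) (Or.inl hs0))).add
      ((Real.hasDerivAt_rpow_const (p := -2) (Or.inl hs0)).const_mul l⁻¹)).const_mul A
  · intro s hs
    have hs2 : 2 * M < s := ha.trans_le (hac.trans hs.1.le)
    have hs0 : 0 < s := by linarith
    have hF := F_pos hM hs2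
    have hF1 := F_lt_one hM hs2
    set u := s ^ (-β) with hu
    set v := s ^ (-2 : ℝ) with hv
    have hu0 : 0 < u := Real.rpow_pos_of_pos hs0 _
    have hv0 : 0 < v := Real.rpow_pos_of_pos hs0 _
    have hu1 : s ^ (-β - 1) = u / s := by rw [hu, Real.rpow_sub_one hs0.ne']
    have hv1 : s ^ (-2 - 1 : ℝ) = v / s := by rw [hv, Real.rpow_sub_one hs0.ne']
    have hvs : v = (s ^ 2)⁻¹ := by rw [hv, Real.rpow_neg hs0.le]; norm_num
    rw [hu1, hv1]
    set y := A * (u + l⁻¹ * v) with hy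
    have hy0 : 0 ≤ y := by positivity
    have h1 := profilePotential_le (n := n) (D := D) (V := V) (l := l) hn hM hs2
    rw [hV s hs2, add_zero, div_eq_mul_inv, ← hvs] at h1
    have hsl : 1 / s ≤ l / 4 := by
      rw [div_le_div_iff₀ hs0 (by norm_num)]
      have := hc.trans hs.1.le
      rw [div_le_iff₀ hl] at this
      linarith
    have h2 : -(l / 2 * y) ≤ F M s * (A * (-β * (u / s) + l⁻¹ * (-2 * (v / s)))) := by
      have e : A * (-β * (u / s) + l⁻¹ * (-2 * (v / s)))
          = -(A * (β * u + 2 * (l⁻¹ * v)) * (1 / s)) := by field_simp; ring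
      have h3 : A * (β * u + 2 * (l⁻¹ * v)) ≤ 2 * y := by
        rw [hy]
        have : A * (β * u) ≤ A * (2 * u) := by gcongr
        linarith
      have h4 : A * (β * u + 2 * (l⁻¹ * v)) * (1 / s) ≤ l / 2 * y := by
        calc A * (β * u + 2 * (l⁻¹ * v)) * (1 / s) ≤ 2 * y * (1 / s) := by gcongr
          _ ≤ 2 * y * (l / 4) := by gcongr
          _ = l / 2 * y := by ring
      have h6 : 0 ≤ l / 2 * y := by positivity
      rw [e]
      nlinarith
    have h3 : l * D s + decayRate n ^ 2 * v ≤ l * y := by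
      have h5 := mul_le_mul_of_nonneg_left (hD s hs2).2 hl.le
      have h6 : l * y = A * (l * u) + A * v := by rw [hy]; field_simp
      have h7 : μ₁ * (l * u) ≤ A * (l * u) := by gcongr
      have h8 : decayRate n ^ 2 * v ≤ A * v := by gcongr
      rw [h6]
      linarith
    have h4 : 0 ≤ 2 * M / s ^ 2 * y := by positivity
    have h5 : 0 ≤ F M s * y ^ 2 := by positivity
    nlinarith [mul_nonneg hl.le hy0]

/-- Upper bounds for modes without potential, uniform for small exponents: the profile grows like
`r^{(n-1)/2}` up to `r ~ 1 / l` and stays bounded from there on. -/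
theorem exists_mode_uniform_bound (hn : 3 ≤ n) (hM : 0 < M) {β μ₁ : ℝ} (hβ : 1 < β) (hβ' : β ≤ 2)
    (hμ₁ : 0 ≤ μ₁) (hD : ∀ r, 2 * M < r → 0 ≤ D r ∧ D r ≤ μ₁ * r ^ (-β))
    (hV : ∀ r, 2 * M < r → V r = 0) :
    ∃ C > (0 : ℝ), ∀ a b l φ φ', 2 * M < a → a ≤ 4 * M → a < b → 0 < l → l ≤ 1 →
      IsMode n M D V a b l φ φ' →
      ∀ r ∈ Icc a b, φ r ≤ C * ((1 + l * r) ^ (-decayRate n) * Real.exp (l * tortoise M r)) ∧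
        |φ' r - l / F M r * φ r| ≤ C * φ r := by
  have hν := one_le_decayRate hn
  set B := μ₁ * (2 * M) ^ (1 - β) with hB
  have hB0 : 0 ≤ B := by positivity
  set κ := 4 * max 1 M with hκ
  have hκ4 : 4 ≤ κ := by have := le_max_left 1 M; linarith
  have hκM : 4 * M ≤ κ := by have := le_max_right 1 M; linarith
  set A := μ₁ + decayRate n ^ 2 + (κ * decayRate n + B * κ ^ 2) with hA
  have hA0 : 0 ≤ A := by positivity
  set C₁ := (1 + κ) ^ decayRate n * Real.exp (B * κ + A * (1 / (β - 1) + 1)) with hC₁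
  set C₂ := decayRate n / (2 * M) + (decayRate n / (2 * M) + B) with hC₂
  have hC₂0 : 0 ≤ C₂ := by positivity
  refine ⟨C₁ + C₂, by positivity, fun a b l φ φ' ha ha4 hab hl hl1 h r hr => ?_⟩
  have ha0 : 0 < a := by linarith
  have hz := h.profileLogDeriv_le_add hn hM hβ hμ₁ hD hV ha hab hl.le
  rw [← hB] at hz
  have hr2 : 2 * M < r := ha.trans_le hr.1
  have hr0 : 0 < r := by linarith
  have hφ := h.pos r hr
  have hβ1 : 0 < β - 1 := by linarith
  set c := κ / l with hc
  have hκc : κ ≤ c := by rw [hc, le_div_iff₀ hl]; nlinarith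
  have hlc : l * c = κ := by rw [hc]; field_simp
  have hac : a ≤ c := by linarith
  -- below `κ / l` the first barrier applies
  have near : ∀ s ∈ Icc a b, s ≤ c → profile n M l φ s ≤ s ^ decayRate n * Real.exp (B * κ) := by
    intro s hs hsc
    have hs0 : 0 < s := by linarith [hs.1]
    have hk := h.profile_le hM ha le_rfl
      (Y := fun s => decayRate n * Real.log s + B * l * s)
      (y := fun s => decayRate n / s + B * l) ?_ ?_ hz hs
    · rw [h.profile_left] at hk
      refine hk.trans ?_
      rw [Real.rpow_def_of_pos ha0, Real.rpow_def_of_pos hs0, ← Real.exp_add, ← Real.exp_add]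
      refine Real.exp_le_exp.2 ?_
      have h1 : B * l * s ≤ B * κ := by
        rw [← hlc, mul_assoc]; gcongr
      have h2 : 0 ≤ B * l * a := by positivity
      linarith
    · have h0 : ∀ s ∈ Icc a b, s ≠ 0 := fun s hs => by have := hs.1; linarith
      exact (continuousOn_const.mul (continuousOn_id.log h0)).add
        (continuousOn_const.mul continuousOn_id)
    · intro s hs
      have hs0 : s ≠ 0 := by have := hs.1; linarith
      have h1 := ((Real.hasDerivAt_log hs0).const_mul (decayRate n)).add
        ((hasDerivAt_id s).const_mul (B * l))
      convert! h1 using 1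
      ring
  refine ⟨?_, ?_⟩
  · rw [eq_profile (φ := φ) (n := n) (M := M) (l := l) hr0, mul_right_comm, ← mul_assoc]
    refine mul_le_mul_of_nonneg_right ?_ (Real.exp_pos _).le
    suffices h1 : r ^ (-decayRate n) * profile n M l φ r ≤ C₁ * (1 + l * r) ^ (-decayRate n) from
      h1.trans (mul_le_mul_of_nonneg_right (by linarith) (by positivity))
    rcases le_total r c with hrc | hrc
    · have h1 := near r hr hrc
      have h2 : r ^ (-decayRate n) * profile n M l φ r ≤ Real.exp (B * κ) := by
        calc r ^ (-decayRate n) * profile n M l φ r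
            ≤ r ^ (-decayRate n) * (r ^ decayRate n * Real.exp (B * κ)) := by gcongr
          _ = Real.exp (B * κ) := by
            rw [← mul_assoc, ← Real.rpow_add hr0, neg_add_cancel, Real.rpow_zero, one_mul]
      have h3 : (1 + κ) ^ (-decayRate n) ≤ (1 + l * r) ^ (-decayRate n) := by
        refine Real.rpow_le_rpow_of_nonpos (by positivity) ?_ (by linarith)
        have : l * r ≤ l * c := by gcongr
        linarith
      have h4 : (1 + κ) ^ decayRate n * (1 + κ) ^ (-decayRate n) = 1 := by
        rw [← Real.rpow_add (by positivity), add_neg_cancel, Real.rpow_zero]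
      have h5 : Real.exp (B * κ) ≤ Real.exp (B * κ + A * (1 / (β - 1) + 1)) :=
        Real.exp_le_exp.2 (le_add_of_nonneg_right (by positivity))
      calc r ^ (-decayRate n) * profile n M l φ r ≤ Real.exp (B * κ) := h2
        _ ≤ Real.exp (B * κ + A * (1 / (β - 1) + 1)) := h5
        _ = C₁ * (1 + κ) ^ (-decayRate n) := by
          rw [hC₁]
          linear_combination (-Real.exp (B * κ + A * (1 / (β - 1) + 1))) * h4
        _ ≤ C₁ * (1 + l * r) ^ (-decayRate n) := by gcongr
    · have hcI : c ∈ Icc a b := ⟨hac, hrc.trans hr.2⟩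
      have hc0 : 0 < c := by linarith
      have hz2 := h.profileLogDeriv_le_far hn hM hβ' hD hV ha hl hac
        (by rw [hc]; gcongr) (A := A) (by rw [hA]; nlinarith [sq_nonneg (decayRate n), sq_nonneg κ])
        (by rw [hA]; nlinarith [sq_nonneg κ]) (by
          refine (hz c hcI).trans ?_
          have h1 : l⁻¹ * c ^ (-2 : ℝ) = l / κ ^ 2 := by
            rw [Real.rpow_neg hc0.le, hc]
            norm_num
            field_simp
          have h2 : 0 ≤ c ^ (-β) := by positivity
          rw [h1]
          have h3 : decayRate n / c + B * l = (κ * decayRate n + B * κ ^ 2) * (l / κ ^ 2) := by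
            rw [hc]; field_simp
          rw [h3]
          have h4 : 0 ≤ l / κ ^ 2 := by positivity
          have h5 : κ * decayRate n + B * κ ^ 2 ≤ A := by
            rw [hA]; nlinarith [sq_nonneg (decayRate n)]
          have h6 : (κ * decayRate n + B * κ ^ 2) * (l / κ ^ 2) ≤ A * (l / κ ^ 2) := by gcongr
          have h7 : 0 ≤ A * c ^ (-β) := by positivity
          linarith)
      have hk := h.profile_le hM ha hac
        (Y := fun s => -(A * (s ^ (1 - β) / (β - 1) + l⁻¹ * s⁻¹)))
        (y := fun s => A * (s ^ (-β) + l⁻¹ * s ^ (-2 : ℝ))) ?_ ?_ hz2 ⟨hrc, hr.2⟩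
      · have h1 := near c hcI le_rfl
        have h2 : -(A * (r ^ (1 - β) / (β - 1) + l⁻¹ * r⁻¹))
            - -(A * (c ^ (1 - β) / (β - 1) + l⁻¹ * c⁻¹)) ≤ A * (1 / (β - 1) + 1) := by
          have h3 : 0 ≤ A * (r ^ (1 - β) / (β - 1) + l⁻¹ * r⁻¹) := by positivity
          have h4 : c ^ (1 - β) ≤ 1 :=
            Real.rpow_le_one_of_one_le_of_nonpos (by linarith) (by linarith)
          have h5 : l⁻¹ * c⁻¹ ≤ 1 := by
            rw [← mul_inv, hlc]
            exact inv_le_one_of_one_le₀ (by linarith)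
          have h6 : A * (c ^ (1 - β) / (β - 1) + l⁻¹ * c⁻¹) ≤ A * (1 / (β - 1) + 1) := by gcongr
          linarith
        have h3 : profile n M l φ r
            ≤ c ^ decayRate n * Real.exp (B * κ + A * (1 / (β - 1) + 1)) := by
          refine hk.trans ?_
          rw [Real.exp_add, ← mul_assoc]
          gcongr
        have h4 : r ^ (-decayRate n) * c ^ decayRate n
            ≤ (1 + κ) ^ decayRate n * (1 + l * r) ^ (-decayRate n) := by
          rw [Real.rpow_neg hr0.le, Real.rpow_neg (by positivity), ← div_eq_mul_inv,
            inv_mul_eq_div, ← Real.div_rpow hc0.le hr0.le, ← Real.div_rpow (by positivity) (by positivity)]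
          refine Real.rpow_le_rpow (by positivity) ?_ (by linarith)
          rw [div_le_div_iff₀ hr0 (by positivity), mul_add, mul_one, ← mul_assoc, mul_comm c l, hlc]
          linarith
        calc r ^ (-decayRate n) * profile n M l φ r
            ≤ r ^ (-decayRate n)
              * (c ^ decayRate n * Real.exp (B * κ + A * (1 / (β - 1) + 1))) := by gcongr
          _ = r ^ (-decayRate n) * c ^ decayRate n
              * Real.exp (B * κ + A * (1 / (β - 1) + 1)) := by ring
          _ ≤ (1 + κ) ^ decayRate n * (1 + l * r) ^ (-decayRate n)
              * Real.exp (B * κ + A * (1 / (β - 1) + 1)) := by gcongr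
          _ = C₁ * (1 + l * r) ^ (-decayRate n) := by rw [hC₁]; ring
      · have h0 : ∀ s ∈ Icc c b, s ≠ 0 := fun s hs => by have := hs.1; linarith
        exact (continuousOn_const.mul (((continuousOn_id.rpow_const
          fun s hs => Or.inl (h0 s hs)).div_const _).add
          (continuousOn_const.mul (continuousOn_id.inv₀ h0)))).neg
      · intro s hs
        have hs0 : 0 < s := by have := hs.1; linarith
        have h1 := ((((Real.hasDerivAt_rpow_const (p := 1 - β) (Or.inl hs0.ne')).div_const
          (β - 1)).add ((hasDerivAt_inv hs0.ne').const_mul l⁻¹)).const_mul A).neg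
        convert! h1 using 1
        rw [show (1 - β - 1) = -β by ring, Real.rpow_neg hs0.le 2]
        norm_num
        field_simp
        ring
  · have h1 := h.abs_deriv_sub_le hn hM ha hr
      (h.profileLogDeriv_nonneg hn hM (fun r hr => (hD r hr).1) (fun r hr => (hV r hr).ge) ha hab
        hl.le r hr)
      (B := decayRate n / (2 * M) + B) ((hz r hr).trans ?_)
    · refine h1.trans (mul_le_mul_of_nonneg_right ?_ hφ.le)
      rw [← hC₂]
      have : 0 < C₁ := by positivity
      linarith
    · have h3 : decayRate n / r ≤ decayRate n / (2 * M) := by gcongr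
      have h4 : B * l ≤ B := mul_le_of_le_one_right hB0 hl1
      linarith

end Bounds

/-! ### Radial test functions in the weak formulation -/

theorem norm_smul_inv_norm_smul {n : ℕ} {x : EuclideanSpace ℝ (Fin n)} (hx : x ≠ 0) {q : ℝ}
    (hq : 0 < q) : ‖q • (‖x‖⁻¹ • x)‖ = q := by
  have := norm_pos_iff.2 hx
  rw [norm_smul, norm_smul, norm_inv, norm_norm, inv_mul_cancel₀ this.ne', mul_one,
    Real.norm_of_nonneg hq.le]

/-- The angular part of the operator annihilates radial functions. -/
theorem sphereLaplacian_radial {n : ℕ} (f : ℝ → ℝ) {x : EuclideanSpace ℝ (Fin n)} (hx : x ≠ 0) :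
    sphereLaplacian (fun y => f ‖y‖) x = 0 := by
  have hx' := norm_pos_iff.2 hx
  have hω : ‖x‖⁻¹ • x ≠ 0 := smul_ne_zero (inv_ne_zero hx'.ne') hx
  have h : (fun y : EuclideanSpace ℝ (Fin n) => f ‖(‖x‖ / ‖y‖) • y‖)
      =ᶠ[nhds (‖x‖⁻¹ • x)] fun _ => f ‖x‖ := by
    filter_upwards [isOpen_ne.mem_nhds hω] with y hy
    have hy' := norm_pos_iff.2 hy
    rw [norm_smul, norm_div, norm_norm, norm_norm, div_mul_cancel₀ _ hy'.ne']
  rw [sphereLaplacian, (InnerProductSpace.laplacian_congr_nhds h).eq_of_nhds,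
    InnerProductSpace.laplacian_const, Pi.zero_apply]

/-- The spatial operator on radial functions. -/
theorem spatialOp_radial {n : ℕ} (hn : 3 ≤ n) (M : ℝ) {f f' : ℝ → ℝ} {f'' : ℝ}
    {x : EuclideanSpace ℝ (Fin n)} (hx : x ≠ 0)
    (hf : ∀ᶠ r in nhds ‖x‖, HasDerivAt f (f' r) r) (hf' : HasDerivAt f' f'' ‖x‖) :
    spatialOp M (fun y => f ‖y‖) x
      = F M ‖x‖ * f'' + (2 * decayRate n * F M ‖x‖ / ‖x‖ + 2 * M / ‖x‖ ^ 2) * f' ‖x‖ := by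
  have hx' := norm_pos_iff.2 hx
  have h : (fun r : ℝ => r ^ (n - 1) * F M r * deriv (fun q : ℝ => f ‖q • (‖x‖⁻¹ • x)‖) r)
      =ᶠ[nhds ‖x‖] fun r => r ^ (n - 1) * F M r * f' r := by
    filter_upwards [hf, lt_mem_nhds hx'] with r hr hr0
    have h1 : (fun q : ℝ => f ‖q • (‖x‖⁻¹ • x)‖) =ᶠ[nhds r] f := by
      filter_upwards [lt_mem_nhds hr0] with q hq
      rw [norm_smul_inv_norm_smul hx hq]
    rw [h1.deriv_eq, hr.deriv]
  rw [spatialOp, h.deriv_eq, sphereLaplacian_radial f hx, mul_zero, add_zero]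
  have h2 : HasDerivAt (fun r => r ^ (n - 1) * F M r * f' r) _ ‖x‖ :=
    ((hasDerivAt_pow_pred hn hx'.ne').mul (hasDerivAt_F (M := M) hx'.ne')).mul hf'
  rw [h2.deriv]
  have h3 : ‖x‖ ^ (n - 1) ≠ 0 := pow_ne_zero _ hx'.ne'
  simp only [Pi.mul_apply]
  field_simp
  ring

theorem box_radial {n : ℕ} (hn : 3 ≤ n) (M : ℝ) {Φ : ℝ → ℝ → ℝ} {Φt Φr : ℝ → ℝ} {Φtt Φrr t : ℝ}
    {x : EuclideanSpace ℝ (Fin n)} (hx : x ≠ 0)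
    (ht : ∀ᶠ τ in nhds t, HasDerivAt (fun τ => Φ τ ‖x‖) (Φt τ) τ) (htt : HasDerivAt Φt Φtt t)
    (hr : ∀ᶠ r in nhds ‖x‖, HasDerivAt (Φ t) (Φr r) r) (hrr : HasDerivAt Φr Φrr ‖x‖) :
    box M (fun z : ℝ × EuclideanSpace ℝ (Fin n) => Φ z.1 ‖z.2‖) (t, x)
      = (F M ‖x‖)⁻¹ * Φtt - (F M ‖x‖ * Φrr
        + (2 * decayRate n * F M ‖x‖ / ‖x‖ + 2 * M / ‖x‖ ^ 2) * Φr ‖x‖) := by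
  have h1 : iteratedDeriv 2 (fun τ => Φ τ ‖x‖) t = Φtt := by
    have e : deriv (fun τ => Φ τ ‖x‖) =ᶠ[nhds t] Φt := ht.mono fun τ h => h.deriv
    rw [iteratedDeriv_succ, iteratedDeriv_one, e.deriv_eq, htt.deriv]
  simp only [box]
  rw [h1, spatialOp_radial hn M (f := Φ t) hx hr hrr]

/-- A smooth cutoff in an interval. -/
theorem exists_interval_cutoff {a a' b' b : ℝ} (ha : a < a') (hb : b' < b) :
    ∃ χ : ℝ → ℝ, ContDiff ℝ 2 χ ∧ (∀ r ∈ Icc a' b', χ r = 1) ∧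
      ∀ r, r ∉ Ioo ((a + a') / 2) ((b' + b) / 2) → χ r = 0 := by
  refine ⟨fun r => Real.smoothTransition ((r - (a + a') / 2) / ((a' - a) / 2))
    * Real.smoothTransition (((b' + b) / 2 - r) / ((b - b') / 2)), ?_, ?_, ?_⟩
  · exact (Real.smoothTransition.contDiff.comp ((contDiff_id.sub contDiff_const).div_const _)).mul
      (Real.smoothTransition.contDiff.comp ((contDiff_const.sub contDiff_id).div_const _))
  · intro r hr
    have h1 : 1 ≤ (r - (a + a') / 2) / ((a' - a) / 2) := by
      rw [le_div_iff₀ (by linarith)]; linarith [hr.1]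
    have h2 : 1 ≤ ((b' + b) / 2 - r) / ((b - b') / 2) := by
      rw [le_div_iff₀ (by linarith)]; linarith [hr.2]
    simp only
    rw [Real.smoothTransition.one_of_one_le h1, Real.smoothTransition.one_of_one_le h2, one_mul]
  · intro r hr
    rw [mem_Ioo, not_and_or, not_lt, not_lt] at hr
    simp only
    rcases hr with hr | hr
    · rw [Real.smoothTransition.zero_of_nonpos
        (div_nonpos_of_nonpos_of_nonneg (by linarith) (by linarith)), zero_mul]
    · rw [Real.smoothTransition.zero_of_nonpos (x := ((b' + b) / 2 - r) / ((b - b') / 2))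
        (div_nonpos_of_nonpos_of_nonneg (by linarith) (by linarith)), mul_zero]

/-- The adjoint of the linear wave operator with damping and potential, for radial functions with
the given partial derivatives. -/
noncomputable def radialOp (n : ℕ) (M : ℝ) (D V : ℝ → ℝ) (Φ Φt Φtt Φr Φrr : ℝ → ℝ → ℝ) (t r : ℝ) :
    ℝ :=
  (F M r)⁻¹ * Φtt t r - (F M r * Φrr t r
    + (2 * decayRate n * F M r / r + 2 * M / r ^ 2) * Φr t r) - D r * Φt t r + V r * Φ t r

/-- The weak formulation holds for radial test functions which vanish for late times, without any
support condition in space or for negative times: the support property of the solution allows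
cutting them off. -/
theorem IsWeakSolution.radial_eq {n : ℕ} (hn : 3 ≤ n) {M : ℝ} (hM : 0 < M) {D V : ℝ → ℝ} {p : ℝ}
    (hp : 0 < p) {f g : EuclideanSpace ℝ (Fin n) → ℝ} {T R : ℝ} (hT : 0 < T)
    {u : ℝ × EuclideanSpace ℝ (Fin n) → ℝ} (hu : IsWeakSolution n M D V p f g T u)
    (hs : FiniteSpeed n M R T u)
    (hdata : ∀ x ∈ exterior n M, (f x ≠ 0 ∨ g x ≠ 0) → |tortoise M ‖x‖| ≤ R)
    {a a' b' b θ : ℝ} (ha2 : 2 * M < a) (ha : a < a') (hb : b' < b) (hθ : θ < T)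
    (hrange : ∀ r, 2 * M < r → |tortoise M r| ≤ T + R → r ∈ Ioo a' b')
    {Φ Φt Φtt Φr Φrr : ℝ → ℝ → ℝ}
    (hC : ContDiffOn ℝ 2 (Function.uncurry Φ) (univ ×ˢ Ioo a b))
    (hΦt : ∀ t, ∀ r ∈ Ioo a b, HasDerivAt (fun τ => Φ τ r) (Φt t r) t)
    (hΦtt : ∀ t, ∀ r ∈ Ioo a b, HasDerivAt (fun τ => Φt τ r) (Φtt t r) t)
    (hΦr : ∀ t, ∀ r ∈ Ioo a b, HasDerivAt (Φ t) (Φr t r) r)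
    (hΦrr : ∀ t, ∀ r ∈ Ioo a b, HasDerivAt (Φr t) (Φrr t r) r)
    (h0 : ∀ t, ∀ r ∈ Ioo a b, θ ≤ t → Φ t r = 0) :
    ∫ z in Ioo 0 T ×ˢ exterior n M, u z * radialOp n M D V Φ Φt Φtt Φr Φrr z.1 ‖z.2‖
      = (∫ z in Ioo 0 T ×ˢ exterior n M, |u z| ^ p * Φ z.1 ‖z.2‖)
        + ∫ x in exterior n M, ((F M ‖x‖)⁻¹ * g x * Φ 0 ‖x‖ + D ‖x‖ * f x * Φ 0 ‖x‖
              - (F M ‖x‖)⁻¹ * f x * Φt 0 ‖x‖) := by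
  obtain ⟨χ, hχC, hχ1, hχ0⟩ := exists_interval_cutoff ha hb
  set ψ : ℝ → ℝ := fun t => Real.smoothTransition (t + 2) with hψ
  have hψC : ContDiff ℝ 2 ψ := Real.smoothTransition.contDiff.comp (contDiff_id.add contDiff_const)
  have hψ1 : ∀ t, -1 ≤ t → ψ t = 1 := fun t ht =>
    Real.smoothTransition.one_of_one_le (by linarith)
  have hψ0 : ∀ t, t ≤ -2 → ψ t = 0 := fun t ht =>
    Real.smoothTransition.zero_of_nonpos (by linarith)
  set Ψ : ℝ → ℝ → ℝ := fun t r => ψ t * χ r * Φ t r with hΨ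
  set φ : ℝ × EuclideanSpace ℝ (Fin n) → ℝ := fun z => Ψ z.1 ‖z.2‖ with hφ
  set a₁ := (a + a') / 2 with ha₁
  set b₁ := (b' + b) / 2 with hb₁
  have hΨ0 : ∀ t r, (t ∉ Icc (-2) θ ∨ r ∉ Ioo a₁ b₁) → Ψ t r = 0 := by
    intro t r h
    by_cases hr : r ∈ Ioo a₁ b₁
    · rcases h with h | h
      · have hrI : r ∈ Ioo a b := by
          constructor <;> linarith [hr.1, hr.2]
        rw [mem_Icc, not_and_or, not_le, not_le] at h
        rcases h with h | h
        · simp only [hΨ]; rw [hψ0 t h.le]; ring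
        · simp only [hΨ]; rw [h0 t r hrI h.le]; ring
      · exact absurd hr h
    · simp only [hΨ]; rw [hχ0 r hr]; ring
  have hφC : ContDiff ℝ 2 φ := by
    rw [contDiff_iff_contDiffAt]
    rintro ⟨t, x⟩
    by_cases hx : ‖x‖ ∈ Ioo a b
    · have hx0 : x ≠ 0 := by
        rw [← norm_pos_iff]; linarith [hx.1]
      have hnorm : ContDiffAt ℝ 2 (fun z : ℝ × EuclideanSpace ℝ (Fin n) => ‖z.2‖) (t, x) :=
        (contDiffAt_norm ℝ (x := x) hx0).comp (t, x) contDiffAt_snd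
      refine ((hψC.contDiffAt.comp (t, x) contDiffAt_fst).mul
        (hχC.contDiffAt.comp (t, x) hnorm)).mul ?_
      have h1 : ContDiffAt ℝ 2 (Function.uncurry Φ) (t, ‖x‖) :=
        hC.contDiffAt ((isOpen_univ.prod isOpen_Ioo).mem_nhds ⟨mem_univ _, hx⟩)
      exact ContDiffAt.comp (f := fun z : ℝ × EuclideanSpace ℝ (Fin n) => (z.1, ‖z.2‖)) (t, x) h1
        (contDiffAt_fst.prodMk hnorm)
    · have hcl : IsClosed (Icc a₁ b₁) := isClosed_Icc
      have hx' : ‖x‖ ∉ Icc a₁ b₁ := fun h => hx ⟨by linarith [h.1], by linarith [h.2]⟩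
      have hev : ∀ᶠ z : ℝ × EuclideanSpace ℝ (Fin n) in nhds (t, x), ‖z.2‖ ∉ Icc a₁ b₁ :=
        (continuous_snd.norm.continuousAt (x := (t, x))).eventually (hcl.isOpen_compl.mem_nhds hx')
      refine (contDiffAt_const (c := (0 : ℝ))).congr_of_eventuallyEq ?_
      filter_upwards [hev] with z hz
      exact hΨ0 _ _ (Or.inr fun h => hz (Ioo_subset_Icc_self h))
  set K : Set (ℝ × EuclideanSpace ℝ (Fin n)) :=
    Icc (-2) θ ×ˢ (Metric.closedBall 0 b₁ ∩ {x | a₁ ≤ ‖x‖}) with hK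
  have hKc : IsCompact K := isCompact_Icc.prod
    ((isCompact_closedBall 0 b₁).inter_right (isClosed_le continuous_const continuous_norm))
  have hφK : Function.support φ ⊆ K := by
    rintro ⟨t, x⟩ hz
    rw [Function.mem_support] at hz
    have h1 : ¬ (t ∉ Icc (-2) θ ∨ ‖x‖ ∉ Ioo a₁ b₁) := fun h => hz (hΨ0 _ _ h)
    push Not at h1
    exact ⟨h1.1, by simpa using h1.2.2.le, h1.2.1.le⟩
  have hφs : tsupport φ ⊆ Iio T ×ˢ exterior n M := by
    refine (closure_minimal hφK hKc.isClosed).trans ?_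
    rintro ⟨t, x⟩ ⟨h1, -, h3⟩
    exact ⟨lt_of_le_of_lt h1.2 hθ, by
      simp only [exterior, mem_ofPred_eq] at h3 ⊢; linarith⟩
  have hweak := hu.weak_eq φ hφC (HasCompactSupport.of_support_subset_isCompact hKc hφK) hφs
  -- near the support of `u` the cutoffs equal `1`
  have hΨΦ : ∀ t r, -1 ≤ t → r ∈ Icc a' b' → Ψ t r = Φ t r := by
    intro t r ht hr
    simp only [hΨ]; rw [hψ1 t ht, hχ1 r hr, one_mul, one_mul]
  have hdt : ∀ t r, -1 < t → r ∈ Ioo a' b' → HasDerivAt (fun τ => Ψ τ r) (Φt t r) t := by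
    intro t r ht hr
    refine (hΦt t r ⟨ha.trans hr.1, hr.2.trans hb⟩).congr_of_eventuallyEq ?_
    filter_upwards [lt_mem_nhds ht] with τ hτ
    exact hΨΦ τ r hτ.le (Ioo_subset_Icc_self hr)
  have hdr : ∀ t r, -1 < t → r ∈ Ioo a' b' → HasDerivAt (Ψ t) (Φr t r) r := by
    intro t r ht hr
    refine (hΦr t r ⟨ha.trans hr.1, hr.2.trans hb⟩).congr_of_eventuallyEq ?_
    filter_upwards [isOpen_Ioo.mem_nhds hr] with ρ hρ
    exact hΨΦ t ρ ht.le (Ioo_subset_Icc_self hρ)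
  have hmeas : MeasurableSet (exterior n M) :=
    (isOpen_lt continuous_const continuous_norm).measurableSet
  have hmeasW : MeasurableSet (Ioo 0 T ×ˢ exterior n M) := measurableSet_Ioo.prod hmeas
  have hs' : ∀ᵐ z ∂(volume.restrict (Ioo 0 T ×ˢ exterior n M)),
      u z ≠ 0 → -1 < z.1 ∧ ‖z.2‖ ∈ Ioo a' b' := by
    filter_upwards [hs, ae_restrict_mem hmeasW] with z hz hzW hz0
    have h1 := hz hz0
    have h2 := hzW.1
    refine ⟨by linarith [h2.1], hrange _ hzW.2 (h1.trans (by linarith [h2.2]))⟩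
  have e1 : ∫ z in Ioo 0 T ×ˢ exterior n M,
        u z * (box M φ z - D ‖z.2‖ * deriv (fun t => φ (t, z.2)) z.1 + V ‖z.2‖ * φ z)
      = ∫ z in Ioo 0 T ×ˢ exterior n M, u z * radialOp n M D V Φ Φt Φtt Φr Φrr z.1 ‖z.2‖ := by
    refine integral_congr_ae ?_
    filter_upwards [hs'] with z hz
    by_cases hz0 : u z = 0
    · simp only [hz0, zero_mul]
    obtain ⟨ht, hr⟩ := hz hz0
    obtain ⟨t, x⟩ := z
    simp only at ht hr
    have hx0 : x ≠ 0 := by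
      rw [← norm_pos_iff]; linarith [hr.1]
    have hrI : ‖x‖ ∈ Ioo a b := ⟨ha.trans hr.1, hr.2.trans hb⟩
    have hbox := box_radial hn M (Φ := Ψ) (t := t) (x := x) hx0
      (Filter.Eventually.mono (lt_mem_nhds ht) fun τ hτ => hdt τ ‖x‖ hτ hr)
      (hΦtt t ‖x‖ hrI)
      (Filter.Eventually.mono (isOpen_Ioo.mem_nhds hr) fun r hr => hdr t r ht hr)
      (hΦrr t ‖x‖ hrI)
    have hd : deriv (fun τ => φ (τ, x)) t = Φt t ‖x‖ := (hdt t ‖x‖ ht hr).deriv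
    have hv : φ (t, x) = Φ t ‖x‖ := hΨΦ t ‖x‖ ht.le (Ioo_subset_Icc_self hr)
    simp only [radialOp]
    rw [hbox, hd, hv]
  have e2 : ∫ z in Ioo 0 T ×ˢ exterior n M, |u z| ^ p * φ z
      = ∫ z in Ioo 0 T ×ˢ exterior n M, |u z| ^ p * Φ z.1 ‖z.2‖ := by
    refine integral_congr_ae ?_
    filter_upwards [hs'] with z hz
    by_cases hz0 : u z = 0
    · simp only [hz0, abs_zero, Real.zero_rpow hp.ne', zero_mul]
    obtain ⟨ht, hr⟩ := hz hz0
    have hv : φ z = Φ z.1 ‖z.2‖ := hΨΦ z.1 ‖z.2‖ ht.le (Ioo_subset_Icc_self hr)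
    simp only [hv]
  have e3 : ∫ x in exterior n M, ((F M ‖x‖)⁻¹ * g x * φ (0, x) + D ‖x‖ * f x * φ (0, x)
        - (F M ‖x‖)⁻¹ * f x * deriv (fun t => φ (t, x)) 0)
      = ∫ x in exterior n M, ((F M ‖x‖)⁻¹ * g x * Φ 0 ‖x‖ + D ‖x‖ * f x * Φ 0 ‖x‖
        - (F M ‖x‖)⁻¹ * f x * Φt 0 ‖x‖) := by
    refine setIntegral_congr_fun hmeas fun x hx => ?_
    by_cases hfg : f x ≠ 0 ∨ g x ≠ 0
    · have hr := hrange _ hx ((hdata x hx hfg).trans (by linarith))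
      have hd : deriv (fun τ => φ (τ, x)) 0 = Φt 0 ‖x‖ := (hdt 0 ‖x‖ (by norm_num) hr).deriv
      have hv : φ (0, x) = Φ 0 ‖x‖ := hΨΦ 0 ‖x‖ (by norm_num) (Ioo_subset_Icc_self hr)
      simp only [hd, hv]
    · push Not at hfg
      simp only [hfg.1, hfg.2]
      ring
  rw [e1, e2, e3] at hweak
  exact hweak

/-! ### Time cutoffs and the test functions -/

/-- `η` is a nonincreasing cutoff, equal to `1` on `(-∞, 1/2]` and to `0` on `[1, ∞)`, whose first
two derivatives `η₁`, `η₂` are controlled by `η ^ (1 / p)`, as Hölder's inequality requires. -/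
structure IsTimeCutoff (p C : ℝ) (η η₁ η₂ : ℝ → ℝ) : Prop where
  contDiff : ContDiff ℝ 2 η
  hasDerivAt : ∀ x, HasDerivAt η (η₁ x) x
  hasDerivAt_deriv : ∀ x, HasDerivAt η₁ (η₂ x) x
  antitone : Antitone η
  nonneg : ∀ x, 0 ≤ η x
  le_one : ∀ x, η x ≤ 1
  eq_one : ∀ x, x ≤ 1 / 2 → η x = 1
  eq_zero : ∀ x, 1 ≤ x → η x = 0
  deriv_eq_zero : ∀ x, x < 1 / 2 → η₁ x = 0
  deriv2_eq_zero : ∀ x, x < 1 / 2 → η₂ x = 0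
  abs_deriv_le : ∀ x, |η₁ x| ≤ C * η x ^ (1 / p)
  abs_deriv2_le : ∀ x, |η₂ x| ≤ C * η x ^ (1 / p)

theorem exists_isTimeCutoff {p : ℝ} (hp : 1 < p) :
    ∃ C > (0 : ℝ), ∃ η η₁ η₂ : ℝ → ℝ, IsTimeCutoff p C η η₁ η₂ := by
  -- a high power of a smooth cutoff `s`
  set s : ℝ → ℝ := fun x => Real.smoothTransition (2 - 2 * x) with hs
  have hsC : ContDiff ℝ 3 s :=
    Real.smoothTransition.contDiff.comp (contDiff_const.sub (contDiff_const.mul contDiff_id))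
  have hs0 : ∀ x, 0 ≤ s x := fun x => Real.smoothTransition.nonneg _
  have hs1 : ∀ x, s x ≤ 1 := fun x => Real.smoothTransition.le_one _
  have hone : ∀ x, x ≤ 1 / 2 → s x = 1 := fun x hx =>
    Real.smoothTransition.one_of_one_le (by linarith)
  have hzero : ∀ x, 1 ≤ x → s x = 0 := fun x hx =>
    Real.smoothTransition.zero_of_nonpos (by linarith)
  have hanti : Antitone s := fun x y hxy => Real.smoothTransition.monotone (by linarith)
  have hd1 : ∀ x, HasDerivAt s (deriv s x) x := fun x =>
    (hsC.differentiable (by norm_num) x).hasDerivAt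
  have hsC' : ContDiff ℝ 2 (deriv s) := by
    have : ContDiff ℝ (2 + 1) s := by norm_num; exact hsC
    exact (contDiff_succ_iff_deriv.1 this).2.2
  have hsC'' : ContDiff ℝ 1 (deriv (deriv s)) := by
    have : ContDiff ℝ (1 + 1) (deriv s) := by norm_num; exact hsC'
    exact (contDiff_succ_iff_deriv.1 this).2.2
  have hd2 : ∀ x, HasDerivAt (deriv s) (deriv (deriv s) x) x := fun x =>
    (hsC'.differentiable (by norm_num) x).hasDerivAt
  have hz1 : ∀ x, x < 1 / 2 → deriv s x = 0 := fun x hx => by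
    have : s =ᶠ[nhds x] fun _ => 1 := by
      filter_upwards [gt_mem_nhds hx] with y hy using hone y hy.le
    rw [this.deriv_eq, deriv_const]
  have hz1' : ∀ x, 1 < x → deriv s x = 0 := fun x hx => by
    have : s =ᶠ[nhds x] fun _ => 0 := by
      filter_upwards [lt_mem_nhds hx] with y hy using hzero y hy.le
    rw [this.deriv_eq, deriv_const]
  have hz2 : ∀ x, x < 1 / 2 → deriv (deriv s) x = 0 := fun x hx => by
    have : deriv s =ᶠ[nhds x] fun _ => 0 := by
      filter_upwards [gt_mem_nhds hx] with y hy using hz1 y hy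
    rw [this.deriv_eq, deriv_const]
  have hz2' : ∀ x, 1 < x → deriv (deriv s) x = 0 := fun x hx => by
    have : deriv s =ᶠ[nhds x] fun _ => 0 := by
      filter_upwards [lt_mem_nhds hx] with y hy using hz1' y hy
    rw [this.deriv_eq, deriv_const]
  obtain ⟨B₁, hB₁⟩ := (isCompact_Icc (a := (1 / 2 : ℝ)) (b := 1)).exists_bound_of_continuousOn
    hsC'.continuous.continuousOn
  obtain ⟨B₂, hB₂⟩ := (isCompact_Icc (a := (1 / 2 : ℝ)) (b := 1)).exists_bound_of_continuousOn
    hsC''.continuous.continuousOn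
  set B := max 1 (max B₁ B₂) with hB
  have hB1 : 1 ≤ B := le_max_left _ _
  have hb1 : ∀ x, |deriv s x| ≤ B := fun x => by
    by_cases hx : x ∈ Icc (1 / 2 : ℝ) 1
    · exact (hB₁ x hx).trans ((le_max_left _ _).trans (le_max_right _ _))
    · rw [mem_Icc, not_and_or, not_le, not_le] at hx
      have : deriv s x = 0 := hx.elim (hz1 x) (hz1' x)
      rw [this, abs_zero]; linarith
  have hb2 : ∀ x, |deriv (deriv s) x| ≤ B := fun x => by
    by_cases hx : x ∈ Icc (1 / 2 : ℝ) 1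
    · exact (hB₂ x hx).trans ((le_max_right _ _).trans (le_max_right _ _))
    · rw [mem_Icc, not_and_or, not_le, not_le] at hx
      have : deriv (deriv s) x = 0 := hx.elim (hz2 x) (hz2' x)
      rw [this, abs_zero]; linarith
  obtain ⟨m, hm⟩ := exists_nat_ge (2 / (p - 1))
  have hp1 : 0 < p - 1 := by linarith
  have hm0 : (0 : ℝ) < m := lt_of_lt_of_le (by positivity) hm
  have hmp : ((m : ℝ) + 2) / p ≤ m := by
    rw [div_le_iff₀ hp1] at hm
    rw [div_le_iff₀ (by linarith)]
    linarith
  have hpow : ∀ x, s x ^ m ≤ (s x ^ (m + 2)) ^ (1 / p) := fun x => by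
    rw [← Real.rpow_natCast, ← Real.rpow_natCast, ← Real.rpow_mul (hs0 x)]
    refine Real.rpow_le_rpow_of_exponent_ge' (hs0 x) (hs1 x) (by positivity) ?_
    push_cast
    rw [mul_one_div]
    exact hmp
  set C := ((m : ℝ) + 2) * (((m : ℝ) + 1) * B ^ 2 + B) with hC
  have hC0 : 0 < C := by positivity
  have hη1 : ∀ x, HasDerivAt (fun x => s x ^ (m + 2))
      (((m : ℝ) + 2) * s x ^ (m + 1) * deriv s x) x := fun x => by
    have := (hd1 x).pow (m + 2)
    convert! this using 1
    push_cast
    simp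
  have hη2 : ∀ x, HasDerivAt (fun x => ((m : ℝ) + 2) * s x ^ (m + 1) * deriv s x)
      (((m : ℝ) + 2) * (((m : ℝ) + 1) * s x ^ m * deriv s x ^ 2
        + s x ^ (m + 1) * deriv (deriv s) x)) x := fun x => by
    have := (((hd1 x).pow (m + 1)).const_mul ((m : ℝ) + 2)).mul (hd2 x)
    convert! this using 1
    push_cast
    simp only [Pi.pow_apply]
    ring
  have hsm : ∀ x, s x ^ (m + 1) ≤ s x ^ m := fun x =>
    pow_le_pow_of_le_one (hs0 x) (hs1 x) (Nat.le_succ m)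
  refine ⟨C, hC0, fun x => s x ^ (m + 2), fun x => ((m : ℝ) + 2) * s x ^ (m + 1) * deriv s x,
    fun x => ((m : ℝ) + 2) * (((m : ℝ) + 1) * s x ^ m * deriv s x ^ 2
        + s x ^ (m + 1) * deriv (deriv s) x), ?_⟩
  refine ⟨(hsC.of_le (by norm_num)).pow _, hη1, hη2, ?_, ?_, ?_, ?_, ?_, ?_, ?_, ?_, ?_⟩
  · exact fun x y hxy => pow_le_pow_left₀ (hs0 y) (hanti hxy) _
  · exact fun x => pow_nonneg (hs0 x) _
  · exact fun x => pow_le_one₀ (hs0 x) (hs1 x)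
  · intro x hx; simp [hone x hx]
  · intro x hx; simp [hzero x hx]
  · intro x hx; simp [hz1 x hx]
  · intro x hx; simp [hz1 x hx, hz2 x hx]
  · intro x
    have h0 := pow_nonneg (hs0 x) m
    rw [abs_mul, abs_of_nonneg (by have := pow_nonneg (hs0 x) (m + 1); positivity)]
    calc ((m : ℝ) + 2) * s x ^ (m + 1) * |deriv s x| ≤ ((m : ℝ) + 2) * s x ^ m * B :=
          mul_le_mul (mul_le_mul_of_nonneg_left (hsm x) (by positivity)) (hb1 x) (abs_nonneg _)
            (by positivity)
      _ ≤ C * s x ^ m := by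
          have : ((m : ℝ) + 2) * B ≤ C := by
            rw [hC]; gcongr; nlinarith [sq_nonneg B]
          nlinarith
      _ ≤ C * (s x ^ (m + 2)) ^ (1 / p) := by gcongr; exact hpow x
  · intro x
    have h0 := pow_nonneg (hs0 x) m
    have h01 := pow_nonneg (hs0 x) (m + 1)
    have h1 : |((m : ℝ) + 1) * s x ^ m * deriv s x ^ 2 + s x ^ (m + 1) * deriv (deriv s) x|
        ≤ ((m : ℝ) + 1) * s x ^ m * B ^ 2 + s x ^ m * B := by
      refine (abs_add_le _ _).trans (add_le_add ?_ ?_)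
      · rw [abs_mul, abs_of_nonneg (by positivity), abs_pow]
        gcongr
        exact hb1 x
      · rw [abs_mul, abs_of_nonneg h01]
        exact mul_le_mul (hsm x) (hb2 x) (abs_nonneg _) h0
    rw [abs_mul, abs_of_nonneg (by positivity)]
    calc ((m : ℝ) + 2) * |((m : ℝ) + 1) * s x ^ m * deriv s x ^ 2
          + s x ^ (m + 1) * deriv (deriv s) x|
        ≤ ((m : ℝ) + 2) * (((m : ℝ) + 1) * s x ^ m * B ^ 2 + s x ^ m * B) := by gcongr
      _ = C * s x ^ m := by rw [hC]; ring
      _ ≤ C * (s x ^ (m + 2)) ^ (1 / p) := by gcongr; exact hpow x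

/-- The delay `-2 M log F` of the cutoff: it vanishes at infinity and, up to a bounded error, equals
the negative of the tortoise coordinate at the horizon. A cutoff in `t + delay` instead of `t` is
constant along outgoing rays there, to leading order, which removes the singular factor `1 / F` from
the terms with derivatives of the cutoff. -/
noncomputable def delay (M r : ℝ) : ℝ := -(2 * M * Real.log (F M r))

theorem delay_nonneg {M r : ℝ} (hM : 0 < M) (hr : 2 * M < r) : 0 ≤ delay M r := by
  have := Real.log_nonpos (F_pos hM hr).le (F_lt_one hM hr).le
  rw [delay]
  nlinarith

theorem hasDerivAt_delay {M r : ℝ} (hM : 0 < M) (hr : 2 * M < r) :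
    HasDerivAt (delay M) (-(4 * M ^ 2 / (r ^ 2 * F M r))) r := by
  have hr0 : r ≠ 0 := by linarith
  have hF := (F_pos hM hr).ne'
  have h := (((hasDerivAt_F (M := M) hr0).log hF).const_mul (2 * M)).neg
  unfold delay
  convert! h using 1
  field_simp
  ring

theorem hasDerivAt_delay_deriv {M r : ℝ} (hM : 0 < M) (hr : 2 * M < r) :
    HasDerivAt (fun r => -(4 * M ^ 2 / (r ^ 2 * F M r)))
      (4 * M ^ 2 * (2 * r * F M r + 2 * M) / (r ^ 2 * F M r) ^ 2) r := by
  have hr0 : r ≠ 0 := by linarith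
  have hF := (F_pos hM hr).ne'
  have h1 : r ^ 2 * F M r ≠ 0 := mul_ne_zero (pow_ne_zero 2 hr0) hF
  have h := ((((hasDerivAt_pow 2 r).mul (hasDerivAt_F (M := M) hr0)).inv h1).const_mul
    (4 * M ^ 2)).neg
  convert! h using 1
  simp
  field_simp
  ring

theorem contDiffOn_F {M : ℝ} (hM : 0 < M) : ContDiffOn ℝ 2 (F M) (Ioi (2 * M)) := by
  unfold F
  exact contDiffOn_const.sub (contDiffOn_const.div contDiffOn_id fun r hr => by
    have h2 : 2 * M < r := hr
    show r ≠ 0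
    linarith)

theorem contDiffOn_delay {M : ℝ} (hM : 0 < M) : ContDiffOn ℝ 2 (delay M) (Ioi (2 * M)) := by
  unfold delay
  exact (contDiffOn_const.mul ((contDiffOn_F hM).log fun r hr => (F_pos hM hr).ne')).neg

theorem IsMode.contDiffOn {n : ℕ} {M : ℝ} {D V : ℝ → ℝ} {a b l : ℝ} {φ φ' : ℝ → ℝ} (hM : 0 < M)
    (hDc : ContinuousOn D (Ioi (2 * M))) (hVc : ContinuousOn V (Ioi (2 * M))) (ha : 2 * M < a)
    (h : IsMode n M D V a b l φ φ') : ContDiffOn ℝ 2 φ (Ioo a b) := by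
  have hsub : Ioo a b ⊆ Ioi (2 * M) := fun r hr => ha.trans hr.1
  have h0 : ∀ r ∈ Ioo a b, r ≠ 0 := fun r hr => by have := hr.1; linarith
  have hFc : ContinuousOn (F M) (Ioo a b) := continuousOn_F.mono h0
  have hF0 : ∀ r ∈ Ioo a b, F M r ≠ 0 := fun r hr => (F_pos hM (hsub hr)).ne'
  have hφ'1 : ContDiffOn ℝ 1 φ' (Ioo a b) := by
    rw [show (1 : WithTop ℕ∞) = 0 + 1 by norm_num, contDiffOn_succ_iff_deriv_of_isOpen isOpen_Ioo]
    refine ⟨fun r hr => (h.hasDerivAt_deriv r hr).differentiableAt.differentiableWithinAt,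
      by simp, ?_⟩
    rw [contDiffOn_zero]
    refine ContinuousOn.congr ?_ fun r hr => (h.hasDerivAt_deriv r hr).deriv
    refine ContinuousOn.div (ContinuousOn.sub ?_ ?_) hFc hF0
    · exact (((continuousOn_const.div hFc hF0).add (continuousOn_const.mul (hDc.mono hsub))).add
        (hVc.mono hsub)).mul (h.continuousOn.mono Ioo_subset_Icc_self)
    · exact (((continuousOn_const.mul hFc).div continuousOn_id h0).add
        (continuousOn_const.div (continuousOn_id.pow 2) fun r hr => pow_ne_zero 2 (h0 r hr))).mul
        (h.continuousOn_deriv.mono Ioo_subset_Icc_self)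
  rw [show (2 : WithTop ℕ∞) = 1 + 1 by norm_num, contDiffOn_succ_iff_deriv_of_isOpen isOpen_Ioo]
  exact ⟨fun r hr => (h.hasDerivAt r hr).differentiableAt.differentiableWithinAt, by simp,
    hφ'1.congr fun r hr => (h.hasDerivAt r hr).deriv⟩

/-- The superposition `∑ wᵢ e^{-lᵢ t} φᵢ(r)`. -/
noncomputable def waveSum {ι : Type*} (s : Finset ι) (w l : ι → ℝ) (φ : ι → ℝ → ℝ) (t r : ℝ) : ℝ :=
  ∑ i ∈ s, w i * (Real.exp (-(l i * t)) * φ i r)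

section waveSum

variable {ι : Type*} {s : Finset ι} {w l : ι → ℝ} {φ : ι → ℝ → ℝ}

theorem hasDerivAt_waveSum_time (t r : ℝ) :
    HasDerivAt (fun t => waveSum s w l φ t r) (-waveSum s (fun i => w i * l i) l φ t r) t := by
  unfold waveSum
  rw [← Finset.sum_neg_distrib]
  refine HasDerivAt.fun_sum fun i _ => ?_
  have h := ((((hasDerivAt_id t).const_mul (l i)).neg.exp).mul_const (φ i r)).const_mul (w i)
  convert! h using 1
  simp
  ring

theorem hasDerivAt_waveSum_radius {φ' : ι → ℝ → ℝ} {t r : ℝ}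
    (h : ∀ i ∈ s, HasDerivAt (φ i) (φ' i r) r) :
    HasDerivAt (waveSum s w l φ t) (waveSum s w l φ' t r) r := by
  unfold waveSum
  exact HasDerivAt.fun_sum fun i hi => (((h i hi).const_mul _).const_mul _)

theorem contDiffOn_waveSum {S : Set ℝ} (h : ∀ i ∈ s, ContDiffOn ℝ 2 (φ i) S) :
    ContDiffOn ℝ 2 (Function.uncurry (waveSum s w l φ)) (univ ×ˢ S) := by
  unfold waveSum
  refine ContDiffOn.sum fun i hi => contDiffOn_const.mul (ContDiffOn.mul ?_ ?_)
  · exact (Real.contDiff_exp.comp (contDiff_const.mul contDiff_fst).neg).contDiffOn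
  · exact (h i hi).comp contDiffOn_snd fun z hz => hz.2

theorem waveSum_nonneg {t r : ℝ} (hw : ∀ i ∈ s, 0 ≤ w i) (hφ : ∀ i ∈ s, 0 ≤ φ i r) :
    0 ≤ waveSum s w l φ t r :=
  Finset.sum_nonneg fun i hi => mul_nonneg (hw i hi) (mul_nonneg (Real.exp_pos _).le (hφ i hi))

end waveSum

theorem delay_anti {M r r' : ℝ} (hM : 0 < M) (hr : 2 * M < r) (hrr' : r ≤ r') :
    delay M r' ≤ delay M r := by
  have h1 : F M r ≤ F M r' := by
    unfold F
    have : 0 < r := by linarith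
    gcongr
  have h2 := Real.log_le_log (F_pos hM hr) h1
  unfold delay
  nlinarith

section Operator

variable {n : ℕ} {M : ℝ} {D V : ℝ → ℝ} {a b : ℝ} {ι : Type*} {s : Finset ι} {w l : ι → ℝ}
  {φ φ' : ι → ℝ → ℝ}

/-- The adjoint linear operator applied to a superposition of modes times the delayed cutoff. The
terms without a derivative of the cutoff cancel, and the coefficients of the others are bounded at
the horizon: there `F * delay' = -1` up to `O(F)`, so the cutoff depends on the outgoing coordinate
only, to leading order, and the modes are functions of the same coordinate. -/
theorem radialOp_cutoff_eq (hM : 0 < M) (ha : 2 * M < a)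
    {φ'' : ι → ℝ → ℝ}
    {η η₁ η₂ : ℝ → ℝ} {θ : ℝ} (hθ : 0 < θ) (t : ℝ) {r : ℝ} (hr : r ∈ Ioo a b)
    (hφ'' : ∀ i ∈ s, φ'' i r = ((l i ^ 2 / F M r + l i * D r + V r) * φ i r
      - (2 * decayRate n * F M r / r + 2 * M / r ^ 2) * φ' i r) / F M r) :
    (F M r)⁻¹ * (waveSum s (fun i => w i * l i * l i) l φ t r * η ((t + delay M r) / θ)
        + 2 * (-waveSum s (fun i => w i * l i) l φ t r) * (η₁ ((t + delay M r) / θ) / θ)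
        + waveSum s w l φ t r * (η₂ ((t + delay M r) / θ) / θ / θ))
      - (F M r * (waveSum s w l φ'' t r * η ((t + delay M r) / θ)
          + 2 * waveSum s w l φ' t r
            * (η₁ ((t + delay M r) / θ) * (-(4 * M ^ 2 / (r ^ 2 * F M r)) / θ))
          + waveSum s w l φ t r
            * (η₂ ((t + delay M r) / θ) * (-(4 * M ^ 2 / (r ^ 2 * F M r)) / θ)
                * (-(4 * M ^ 2 / (r ^ 2 * F M r)) / θ)
              + η₁ ((t + delay M r) / θ)
                * (4 * M ^ 2 * (2 * r * F M r + 2 * M) / (r ^ 2 * F M r) ^ 2 / θ)))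
        + (2 * decayRate n * F M r / r + 2 * M / r ^ 2)
          * (waveSum s w l φ' t r * η ((t + delay M r) / θ) + waveSum s w l φ t r
            * (η₁ ((t + delay M r) / θ) * (-(4 * M ^ 2 / (r ^ 2 * F M r)) / θ))))
      - D r * (-waveSum s (fun i => w i * l i) l φ t r * η ((t + delay M r) / θ)
          + waveSum s w l φ t r * (η₁ ((t + delay M r) / θ) / θ))
      + V r * (waveSum s w l φ t r * η ((t + delay M r) / θ))
    = η₁ ((t + delay M r) / θ) / θ
        * (-(2 * (1 + 2 * M / r) * waveSum s (fun i => w i * l i) l φ t r)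
          + 2 * (4 * M ^ 2 / r ^ 2)
            * waveSum s w l (fun i r => φ' i r - l i / F M r * φ i r) t r
          + 8 * (decayRate n - 1) * M ^ 2 / r ^ 3 * waveSum s w l φ t r
          - D r * waveSum s w l φ t r)
      + η₂ ((t + delay M r) / θ) / θ ^ 2
        * ((1 + 2 * M / r) * (1 + 4 * M ^ 2 / r ^ 2) * waveSum s w l φ t r) := by
  have hr2 : 2 * M < r := ha.trans hr.1
  have hr0 : 0 < r := by linarith
  have hF := (F_pos hM hr2).ne'
  have e1 : waveSum s w l φ'' t r = (waveSum s (fun i => w i * l i * l i) l φ t r / F M r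
      + D r * waveSum s (fun i => w i * l i) l φ t r + V r * waveSum s w l φ t r
      - (2 * decayRate n * F M r / r + 2 * M / r ^ 2) * waveSum s w l φ' t r) / F M r := by
    simp only [waveSum, Finset.mul_sum, Finset.sum_div, ← Finset.sum_add_distrib,
      ← Finset.sum_sub_distrib]
    refine Finset.sum_congr rfl fun i hi => ?_
    rw [hφ'' i hi]
    field_simp
  have e2 : waveSum s w l (fun i r => φ' i r - l i / F M r * φ i r) t r
      = waveSum s w l φ' t r - waveSum s (fun i => w i * l i) l φ t r / F M r := by
    simp only [waveSum, Finset.sum_div, ← Finset.sum_sub_distrib]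
    refine Finset.sum_congr rfl fun i _ => ?_
    field_simp
  rw [e1, e2]
  have hx : 2 * M = (1 - F M r) * r := by rw [F]; field_simp; ring
  have hx2 : 4 * M ^ 2 = (1 - F M r) ^ 2 * r ^ 2 := by
    rw [← mul_pow, ← hx]; ring
  have hx3 : 8 * (decayRate n - 1) * M ^ 2
      = 2 * (decayRate n - 1) * ((1 - F M r) ^ 2 * r ^ 2) := by rw [← hx2]; ring
  rw [hx2, hx3, hx]
  generalize F M r = f at *
  field_simp
  ring

theorem abs_radialOp_cutoff_le (hn : 3 ≤ n) (hM : 0 < M) {β μ₁ : ℝ} (hβ' : β ≤ 2)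
    (hD : ∀ r, 2 * M < r → 0 ≤ D r ∧ D r ≤ μ₁ * r ^ (-β)) (ha : 2 * M < a)
    (hmode : ∀ i ∈ s, IsMode n M D V a b (l i) (φ i) (φ' i))
    (hw : ∀ i ∈ s, 0 ≤ w i) (hl : ∀ i ∈ s, 0 ≤ l i) {Cm : ℝ}
    (hCm : ∀ i ∈ s, ∀ r ∈ Icc a b, |φ' i r - l i / F M r * φ i r| ≤ Cm * φ i r)
    {p Cη : ℝ} {η η₁ η₂ : ℝ → ℝ} (hη : IsTimeCutoff p Cη η η₁ η₂) {θ : ℝ} (hθ : 0 < θ) (t x : ℝ)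
    {r : ℝ} (hr : r ∈ Ioo a b) :
    |η₁ x / θ
        * (-(2 * (1 + 2 * M / r) * waveSum s (fun i => w i * l i) l φ t r)
          + 2 * (4 * M ^ 2 / r ^ 2)
            * waveSum s w l (fun i r => φ' i r - l i / F M r * φ i r) t r
          + 8 * (decayRate n - 1) * M ^ 2 / r ^ 3 * waveSum s w l φ t r
          - D r * waveSum s w l φ t r)
      + η₂ x / θ ^ 2
        * ((1 + 2 * M / r) * (1 + 4 * M ^ 2 / r ^ 2) * waveSum s w l φ t r)|
    ≤ Cη * (4 + (8 * M ^ 2 * Cm + 4 * M * (decayRate n - 1)) * (2 * M) ^ (β - 2) + μ₁)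
        * η x ^ (1 / p)
        * ((waveSum s (fun i => w i * l i) l φ t r + r ^ (-β) * waveSum s w l φ t r) / θ
          + waveSum s w l φ t r / θ ^ 2) := by
  have hν := one_le_decayRate hn
  have hr2 : 2 * M < r := ha.trans hr.1
  have hr0 : 0 < r := by linarith
  have hrI := Ioo_subset_Icc_self hr
  set E := waveSum s (fun i => w i * l i) l φ t r with hE
  set P := waveSum s w l φ t r with hP
  set Q := waveSum s w l (fun i r => φ' i r - l i / F M r * φ i r) t r with hQ
  have hE0 : 0 ≤ E := waveSum_nonneg (fun i hi => mul_nonneg (hw i hi) (hl i hi))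
    fun i hi => ((hmode i hi).pos r hrI).le
  have hP0 : 0 ≤ P := waveSum_nonneg hw fun i hi => ((hmode i hi).pos r hrI).le
  have hQP : |Q| ≤ Cm * P := by
    rw [hQ, hP]
    simp only [waveSum]
    rw [Finset.mul_sum]
    refine (Finset.abs_sum_le_sum_abs _ _).trans (Finset.sum_le_sum fun i hi => ?_)
    rw [abs_mul, abs_mul, abs_of_nonneg (hw i hi), abs_of_pos (Real.exp_pos _)]
    calc w i * (Real.exp (-(l i * t)) * |φ' i r - l i / F M r * φ i r|)
        ≤ w i * (Real.exp (-(l i * t)) * (Cm * φ i r)) :=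
          mul_le_mul_of_nonneg_left (mul_le_mul_of_nonneg_left (hCm i hi r hrI)
            (Real.exp_pos _).le) (hw i hi)
      _ = Cm * (w i * (Real.exp (-(l i * t)) * φ i r)) := by ring
  have hCmP : 0 ≤ Cm * P := (abs_nonneg Q).trans hQP
  set k := r ^ (-β) with hk
  have hk0 : 0 < k := Real.rpow_pos_of_pos hr0 _
  set m := (2 * M) ^ (β - 2) with hm
  have hm0 : 0 < m := Real.rpow_pos_of_pos (by positivity) _
  have hk2 : 1 / r ^ 2 ≤ m * k := by
    have := rpow_neg_le_mul_rpow_neg hM hr2.le hβ'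
    have h6 : r ^ (-2 : ℝ) = (r ^ 2)⁻¹ := by
      rw [Real.rpow_neg hr0.le]; norm_num
    rwa [h6, ← one_div] at this
  have hx1 : 2 * M / r ≤ 1 := by rw [div_le_one hr0]; exact hr2.le
  have hx0 : 0 < 2 * M / r := by positivity
  have hx2 : 4 * M ^ 2 / r ^ 2 = (2 * M / r) ^ 2 := by ring
  have hH0 : 0 ≤ η x ^ (1 / p) := Real.rpow_nonneg (hη.nonneg x) _
  set H := η x ^ (1 / p) with hH
  have hμ0 : 0 ≤ μ₁ * k := (hD r hr2).1.trans (hD r hr2).2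
  have hμ : 0 ≤ μ₁ := nonneg_of_mul_nonneg_left hμ0 hk0
  have hν1 : 0 ≤ decayRate n - 1 := by linarith
  have hCη0 : 0 ≤ Cη * H := (abs_nonneg _).trans (hη.abs_deriv_le x)
  set K := 4 + (8 * M ^ 2 * Cm + 4 * M * (decayRate n - 1)) * m + μ₁ with hK
  have b1 : |-(2 * (1 + 2 * M / r) * E) + 2 * (4 * M ^ 2 / r ^ 2) * Q
      + 8 * (decayRate n - 1) * M ^ 2 / r ^ 3 * P - D r * P|
      ≤ 4 * E + ((8 * M ^ 2 * Cm + 4 * M * (decayRate n - 1)) * m + μ₁) * (k * P) := by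
    have t1 : |2 * (1 + 2 * M / r) * E| ≤ 4 * E := by
      rw [abs_of_nonneg (by positivity)]
      nlinarith
    have t2 : |2 * (4 * M ^ 2 / r ^ 2) * Q| ≤ 8 * M ^ 2 * Cm * m * (k * P) := by
      rw [abs_mul, abs_of_nonneg (by positivity)]
      calc 2 * (4 * M ^ 2 / r ^ 2) * |Q| ≤ 2 * (4 * M ^ 2 / r ^ 2) * (Cm * P) := by gcongr
        _ = 8 * M ^ 2 * (1 / r ^ 2) * (Cm * P) := by ring
        _ ≤ 8 * M ^ 2 * (m * k) * (Cm * P) := by gcongr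
        _ = _ := by ring
    have t3 : |8 * (decayRate n - 1) * M ^ 2 / r ^ 3 * P|
        ≤ 4 * M * (decayRate n - 1) * m * (k * P) := by
      rw [abs_of_nonneg (by positivity)]
      calc 8 * (decayRate n - 1) * M ^ 2 / r ^ 3 * P
          = 4 * M * (decayRate n - 1) * (2 * M / r) * (1 / r ^ 2) * P := by field_simp; ring
        _ ≤ 4 * M * (decayRate n - 1) * 1 * (m * k) * P := by gcongr
        _ = _ := by ring
    have t4 : |D r * P| ≤ μ₁ * (k * P) := by
      rw [abs_of_nonneg (mul_nonneg (hD r hr2).1 hP0), ← mul_assoc]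
      exact mul_le_mul_of_nonneg_right (hD r hr2).2 hP0
    rw [abs_le] at t1 t2 t3 t4 ⊢
    constructor <;> linarith [t1.1, t1.2, t2.1, t2.2, t3.1, t3.2, t4.1, t4.2]
  have b2 : |(1 + 2 * M / r) * (1 + 4 * M ^ 2 / r ^ 2) * P| ≤ 4 * P := by
    rw [abs_of_nonneg (by positivity), hx2]
    have h1 : (2 * M / r) ^ 2 ≤ 1 := pow_le_one₀ hx0.le hx1
    have h2 : (1 + 2 * M / r) * (1 + (2 * M / r) ^ 2) ≤ 2 * 2 := by gcongr <;> linarith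
    nlinarith
  have b3 : 4 * E + ((8 * M ^ 2 * Cm + 4 * M * (decayRate n - 1)) * m + μ₁) * (k * P)
      ≤ K * (E + k * P) ∧ 4 * P ≤ K * P := by
    have h4 : 0 ≤ 4 * M * (decayRate n - 1) * m := by positivity
    have h1 : 0 ≤ ((8 * M ^ 2 * Cm + 4 * M * (decayRate n - 1)) * m + μ₁) * P := by
      have h2 : 0 ≤ 8 * M ^ 2 * m * (Cm * P) := by positivity
      have h3 : 0 ≤ 4 * M * (decayRate n - 1) * m * P := by positivity
      have h5 : 0 ≤ μ₁ * P := by positivity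
      linarith
    refine ⟨?_, ?_⟩
    · have h6 : 0 ≤ ((8 * M ^ 2 * Cm + 4 * M * (decayRate n - 1)) * m + μ₁) * E := by
        have hCmE : 0 ≤ Cm * E := by
          rcases hP0.lt_or_eq with h | h
          · exact mul_nonneg (nonneg_of_mul_nonneg_left hCmP h) hE0
          · -- if the superposition vanishes, all weights do
            have h0 : ∀ i ∈ s, w i * (Real.exp (-(l i * t)) * φ i r) = 0 :=
              (Finset.sum_eq_zero_iff_of_nonneg fun i hi => mul_nonneg (hw i hi)
                (mul_nonneg (Real.exp_pos _).le ((hmode i hi).pos r hrI).le)).1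
                (by rw [hP] at h; exact h.symm)
            have : E = 0 := Finset.sum_eq_zero fun i hi => by
              linear_combination l i * h0 i hi
            rw [this, mul_zero]
        have h2 : 0 ≤ 8 * M ^ 2 * m * (Cm * E) := by positivity
        have h3 : 0 ≤ 4 * M * (decayRate n - 1) * m * E := by positivity
        have h5 : 0 ≤ μ₁ * E := by positivity
        linarith
      have h7 : 0 ≤ k * P := by positivity
      rw [hK]
      linarith
    · rw [hK]; linarith
  calc |η₁ x / θ * (-(2 * (1 + 2 * M / r) * E) + 2 * (4 * M ^ 2 / r ^ 2) * Q
          + 8 * (decayRate n - 1) * M ^ 2 / r ^ 3 * P - D r * P)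
        + η₂ x / θ ^ 2 * ((1 + 2 * M / r) * (1 + 4 * M ^ 2 / r ^ 2) * P)|
      ≤ Cη * H / θ * (K * (E + k * P)) + Cη * H / θ ^ 2 * (K * P) := by
        refine (abs_add_le _ _).trans (add_le_add ?_ ?_)
        · rw [abs_mul, abs_div, abs_of_pos hθ]
          refine mul_le_mul ?_ (b1.trans b3.1) (abs_nonneg _) (by positivity)
          exact div_le_div_of_nonneg_right (hη.abs_deriv_le x) hθ.le
        · rw [abs_mul, abs_div, abs_of_pos (by positivity : 0 < θ ^ 2)]
          refine mul_le_mul ?_ (b2.trans b3.2) (abs_nonneg _) (by positivity)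
          exact div_le_div_of_nonneg_right (hη.abs_deriv2_le x) (by positivity)
    _ = Cη * K * H * ((E + k * P) / θ + P / θ ^ 2) := by ring

end Operator

/-- The weak formulation tested with a superposition of modes, cut off at `t + delay = θ`. -/
theorem IsWeakSolution.waveSum_eq {n : ℕ} (hn : 3 ≤ n) {M : ℝ} (hM : 0 < M) {D V : ℝ → ℝ}
    (hDc : ContinuousOn D (Ioi (2 * M))) (hVc : ContinuousOn V (Ioi (2 * M)))
    {β μ₁ : ℝ} (hβ' : β ≤ 2) (hD : ∀ r, 2 * M < r → 0 ≤ D r ∧ D r ≤ μ₁ * r ^ (-β))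
    {p : ℝ} (hp : 1 < p) {f g : EuclideanSpace ℝ (Fin n) → ℝ} {T R R₁ : ℝ} (hR₁ : 0 < R₁)
    {u : ℝ × EuclideanSpace ℝ (Fin n) → ℝ} (hu : IsWeakSolution n M D V p f g T u)
    (hs : FiniteSpeed n M R T u)
    (hdata : ∀ x ∈ exterior n M, (f x ≠ 0 ∨ g x ≠ 0) → |tortoise M ‖x‖| ≤ R)
    (hdata₁ : ∀ x ∈ exterior n M, (f x ≠ 0 ∨ g x ≠ 0) → 2 * M + R₁ ≤ ‖x‖)
    {a a' b' b θ : ℝ} (ha2 : 2 * M < a) (ha : a < a') (hb : b' < b) (hθ0 : 0 < θ) (hθ : θ < T)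
    (hθ₁ : 2 * delay M (2 * M + R₁) < θ)
    (hrange : ∀ r, 2 * M < r → |tortoise M r| ≤ T + R → r ∈ Ioo a' b')
    {ι : Type*} {s : Finset ι} {w l : ι → ℝ} {φ φ' : ι → ℝ → ℝ}
    (hmode : ∀ i ∈ s, IsMode n M D V a b (l i) (φ i) (φ' i))
    (hw : ∀ i ∈ s, 0 ≤ w i) (hl : ∀ i ∈ s, 0 ≤ l i) {Cm : ℝ}
    (hCm : ∀ i ∈ s, ∀ r ∈ Icc a b, |φ' i r - l i / F M r * φ i r| ≤ Cm * φ i r)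
    {Cη : ℝ} {η η₁ η₂ : ℝ → ℝ} (hη : IsTimeCutoff p Cη η η₁ η₂) :
    ∃ L : ℝ → ℝ → ℝ,
      ∫ z in Ioo 0 T ×ˢ exterior n M, u z * L z.1 ‖z.2‖
        = (∫ z in Ioo 0 T ×ˢ exterior n M, |u z| ^ p
            * (waveSum s w l φ z.1 ‖z.2‖ * η ((z.1 + delay M ‖z.2‖) / θ)))
          + ∫ x in exterior n M, ((F M ‖x‖)⁻¹ * g x * waveSum s w l φ 0 ‖x‖
              + D ‖x‖ * f x * waveSum s w l φ 0 ‖x‖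
              + (F M ‖x‖)⁻¹ * f x * waveSum s (fun i => w i * l i) l φ 0 ‖x‖) ∧
      (∀ t, ∀ r ∈ Ioo a b, (t + delay M r) / θ < 1 / 2 → L t r = 0) ∧
      ∀ t, ∀ r ∈ Ioo a b, |L t r|
        ≤ Cη * (4 + (8 * M ^ 2 * Cm + 4 * M * (decayRate n - 1)) * (2 * M) ^ (β - 2) + μ₁)
          * η ((t + delay M r) / θ) ^ (1 / p)
          * ((waveSum s (fun i => w i * l i) l φ t r + r ^ (-β) * waveSum s w l φ t r) / θ
            + waveSum s w l φ t r / θ ^ 2) := by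
  have hsub : Ioo a b ⊆ Ioi (2 * M) := fun r hr => ha2.trans hr.1
  set φ'' : ι → ℝ → ℝ := fun i r => ((l i ^ 2 / F M r + l i * D r + V r) * φ i r
      - (2 * decayRate n * F M r / r + 2 * M / r ^ 2) * φ' i r) / F M r with hφ''
  set W := waveSum s w l φ with hW
  set W₁ := waveSum s (fun i => w i * l i) l φ with hW₁
  set W₂ := waveSum s (fun i => w i * l i * l i) l φ with hW₂
  set N : ℝ → ℝ → ℝ := fun t r => η ((t + delay M r) / θ) with hN
  set N₁ : ℝ → ℝ → ℝ := fun t r => η₁ ((t + delay M r) / θ) with hN₁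
  set N₂ : ℝ → ℝ → ℝ := fun t r => η₂ ((t + delay M r) / θ) with hN₂
  set δ₁ : ℝ → ℝ := fun r => -(4 * M ^ 2 / (r ^ 2 * F M r)) with hδ₁
  set δ₂ : ℝ → ℝ := fun r => 4 * M ^ 2 * (2 * r * F M r + 2 * M) / (r ^ 2 * F M r) ^ 2 with hδ₂
  have hδd : ∀ r ∈ Ioo a b, HasDerivAt (delay M) (δ₁ r) r := fun r hr => hasDerivAt_delay hM (hsub hr)
  have hδd' : ∀ r ∈ Ioo a b, HasDerivAt δ₁ (δ₂ r) r := fun r hr =>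
    hasDerivAt_delay_deriv hM (hsub hr)
  have hNt : ∀ t r, HasDerivAt (fun τ => N τ r) (N₁ t r / θ) t := fun t r => by
    have h := (hη.hasDerivAt ((t + delay M r) / θ)).comp t
      (((hasDerivAt_id t).add_const (delay M r)).div_const θ)
    convert! h using 1
    simp only [hN₁]; ring
  have hN₁t : ∀ t r, HasDerivAt (fun τ => N₁ τ r) (N₂ t r / θ) t := fun t r => by
    have h := (hη.hasDerivAt_deriv ((t + delay M r) / θ)).comp t
      (((hasDerivAt_id t).add_const (delay M r)).div_const θ)
    convert! h using 1
    simp only [hN₂]; ring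
  have hNr : ∀ t, ∀ r ∈ Ioo a b, HasDerivAt (N t) (N₁ t r * (δ₁ r / θ)) r := fun t r hr =>
    (hη.hasDerivAt ((t + delay M r) / θ)).comp r (((hδd r hr).const_add t).div_const θ)
  have hN₁r : ∀ t, ∀ r ∈ Ioo a b, HasDerivAt (N₁ t) (N₂ t r * (δ₁ r / θ)) r := fun t r hr =>
    (hη.hasDerivAt_deriv ((t + delay M r) / θ)).comp r (((hδd r hr).const_add t).div_const θ)
  have hWt : ∀ t r, HasDerivAt (fun τ => W τ r) (-W₁ t r) t := hasDerivAt_waveSum_time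
  have hW₁t : ∀ t r, HasDerivAt (fun τ => W₁ τ r) (-W₂ t r) t := hasDerivAt_waveSum_time
  have hWr : ∀ t, ∀ r ∈ Ioo a b, HasDerivAt (W t) (waveSum s w l φ' t r) r := fun t r hr =>
    hasDerivAt_waveSum_radius fun i hi => (hmode i hi).hasDerivAt r hr
  have hWrr : ∀ t, ∀ r ∈ Ioo a b, HasDerivAt (waveSum s w l φ' t) (waveSum s w l φ'' t r) r :=
    fun t r hr => hasDerivAt_waveSum_radius fun i hi => (hmode i hi).hasDerivAt_deriv r hr
  have key := hu.radial_eq hn hM (by linarith) (hθ0.trans hθ) hs hdata ha2 ha hb hθ hrange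
    (Φ := fun t r => W t r * N t r)
    (Φt := fun t r => -W₁ t r * N t r + W t r * (N₁ t r / θ))
    (Φtt := fun t r => W₂ t r * N t r + 2 * (-W₁ t r) * (N₁ t r / θ) + W t r * (N₂ t r / θ / θ))
    (Φr := fun t r => waveSum s w l φ' t r * N t r + W t r * (N₁ t r * (δ₁ r / θ)))
    (Φrr := fun t r => waveSum s w l φ'' t r * N t r
      + 2 * waveSum s w l φ' t r * (N₁ t r * (δ₁ r / θ))
      + W t r * (N₂ t r * (δ₁ r / θ) * (δ₁ r / θ) + N₁ t r * (δ₂ r / θ))) ?_ ?_ ?_ ?_ ?_ ?_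
  · refine ⟨radialOp n M D V (fun t r => W t r * N t r)
      (fun t r => -W₁ t r * N t r + W t r * (N₁ t r / θ))
      (fun t r => W₂ t r * N t r + 2 * (-W₁ t r) * (N₁ t r / θ) + W t r * (N₂ t r / θ / θ))
      (fun t r => waveSum s w l φ' t r * N t r + W t r * (N₁ t r * (δ₁ r / θ)))
      (fun t r => waveSum s w l φ'' t r * N t r
        + 2 * waveSum s w l φ' t r * (N₁ t r * (δ₁ r / θ))
        + W t r * (N₂ t r * (δ₁ r / θ) * (δ₁ r / θ) + N₁ t r * (δ₂ r / θ))), ?_, ?_, ?_⟩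
    · rw [key]
      congr 1
      have hmeas : MeasurableSet (exterior n M) :=
        (isOpen_lt continuous_const continuous_norm).measurableSet
      refine setIntegral_congr_fun hmeas fun x hx => ?_
      by_cases hfg : f x ≠ 0 ∨ g x ≠ 0
      · have hx1 := hdata₁ x hx hfg
        have h1 : (0 + delay M ‖x‖) / θ < 1 / 2 := by
          rw [div_lt_iff₀ hθ0]
          have := delay_anti hM (by linarith : 2 * M < 2 * M + R₁) hx1
          linarith
        have e1 : N 0 ‖x‖ = 1 := hη.eq_one _ h1.le
        have e2 : N₁ 0 ‖x‖ = 0 := hη.deriv_eq_zero _ h1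
        simp only [e1, e2]
        ring
      · push Not at hfg
        simp only [hfg.1, hfg.2]
        ring
    · intro t r hr h
      have h1 := radialOp_cutoff_eq (n := n) (D := D) (V := V) (w := w) hM ha2 (s := s) (φ' := φ')
        (φ'' := φ'')
        (η := η) (η₁ := η₁) (η₂ := η₂) hθ0 t hr (fun i _ => rfl)
      refine h1.trans ?_
      rw [hη.deriv_eq_zero _ h, hη.deriv2_eq_zero _ h]
      ring
    · intro t r hr
      have h1 := radialOp_cutoff_eq (n := n) (D := D) (V := V) (w := w) hM ha2 (s := s) (φ' := φ')
        (φ'' := φ'')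
        (η := η) (η₁ := η₁) (η₂ := η₂) hθ0 t hr (fun i _ => rfl)
      have h2 := abs_radialOp_cutoff_le hn hM hβ' hD ha2 hmode hw hl hCm hη hθ0 t
        ((t + delay M r) / θ) hr
      rw [← h1] at h2
      exact h2
  · refine (contDiffOn_waveSum fun i hi => (hmode i hi).contDiffOn hM hDc hVc ha2).mul ?_
    refine hη.contDiff.comp_contDiffOn ((contDiffOn_fst.add ?_).div_const θ)
    exact ((contDiffOn_delay hM).mono hsub).comp contDiffOn_snd fun z hz => hz.2
  · intro t r _
    exact (hWt t r).mul (hNt t r)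
  · intro t r _
    have h := ((hW₁t t r).neg.mul (hNt t r)).add ((hWt t r).mul ((hN₁t t r).div_const θ))
    convert! h using 1
    simp only [Pi.neg_apply]
    ring
  · intro t r hr
    exact (hWr t r hr).mul (hNr t r hr)
  · intro t r hr
    have h := ((hWrr t r hr).mul (hNr t r hr)).add ((hWr t r hr).mul ((hN₁r t r hr).mul
      ((hδd' r hr).div_const θ)))
    convert! h using 1
    simp only [Pi.mul_apply]
    ring
  · intro t r hr ht
    have h1 : 1 ≤ (t + delay M r) / θ := by
      rw [le_div_iff₀ hθ0]
      linarith [delay_nonneg hM (hsub hr)]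
    simp only [hN, hη.eq_zero _ h1, mul_zero]

/-! ### The test identity and Hölder's inequality -/

theorem measurableSet_exterior {n : ℕ} {M : ℝ} : MeasurableSet (exterior n M) :=
  (isOpen_lt continuous_const continuous_norm).measurableSet

theorem measurable_tortoise {M : ℝ} : Measurable (tortoise M) := by
  unfold tortoise
  exact measurable_id.add ((Real.measurable_log.comp (measurable_id.sub_const _)).const_mul _)

theorem measurable_delay {M : ℝ} : Measurable (delay M) := by
  unfold delay F
  exact ((Real.measurable_log.comp (measurable_const.sub
    (measurable_const.div measurable_id))).const_mul _).neg

/-- The part of the propagation region `{|s| ≤ t + R}` on which the derivatives of the cutoff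
`η ((t + delay) / θ)` need not vanish. -/
def transition (n : ℕ) (M R T θ : ℝ) : Set (ℝ × EuclideanSpace ℝ (Fin n)) :=
  {z | z ∈ Ioo 0 T ×ˢ exterior n M ∧ |tortoise M ‖z.2‖| ≤ z.1 + R ∧
    θ / 2 ≤ z.1 + delay M ‖z.2‖ ∧ z.1 + delay M ‖z.2‖ ≤ θ}

theorem measurableSet_transition {n : ℕ} {M R T θ : ℝ} :
    MeasurableSet (transition n M R T θ) := by
  have h1 : Measurable fun z : ℝ × EuclideanSpace ℝ (Fin n) => |tortoise M ‖z.2‖| :=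
    (measurable_tortoise.comp measurable_snd.norm).abs
  have h2 : Measurable fun z : ℝ × EuclideanSpace ℝ (Fin n) => z.1 + delay M ‖z.2‖ :=
    measurable_fst.add (measurable_delay.comp measurable_snd.norm)
  exact (measurableSet_Ioo.prod measurableSet_exterior).inter
    ((measurableSet_le h1 (measurable_fst.add_const R)).inter
      ((measurableSet_le measurable_const h2).inter (measurableSet_le h2 measurable_const)))

theorem IsWeakSolution.integrableOn_rpow_mul {n : ℕ} {M : ℝ} {D V : ℝ → ℝ}
    {p : ℝ} (hp : 1 < p) {f g : EuclideanSpace ℝ (Fin n) → ℝ} {T R : ℝ}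
    {u : ℝ × EuclideanSpace ℝ (Fin n) → ℝ} (hu : IsWeakSolution n M D V p f g T u)
    (hs : FiniteSpeed n M R T u) {a a' b' b θ : ℝ} (ha2 : 2 * M < a) (ha : a < a') (hb : b' < b)
    (hθ : θ < T) (hrange : ∀ r, 2 * M < r → |tortoise M r| ≤ T + R → r ∈ Ioo a' b')
    {Φ : ℝ → ℝ → ℝ} (hΦ : ContinuousOn (Function.uncurry Φ) (univ ×ˢ Ioo a b))
    (h0 : ∀ t, ∀ r ∈ Ioo a b, θ ≤ t → Φ t r = 0) :
    IntegrableOn (fun z => |u z| ^ p * Φ z.1 ‖z.2‖) (Ioo 0 T ×ˢ exterior n M) := by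
  set N : Set (EuclideanSpace ℝ (Fin n)) := {x | a' ≤ ‖x‖ ∧ ‖x‖ ≤ b'} with hN
  have hNc : IsCompact N := by
    refine Metric.isCompact_of_isClosed_isBounded ?_ ?_
    · exact (isClosed_le continuous_const continuous_norm).inter
        (isClosed_le continuous_norm continuous_const)
    · exact (Metric.isBounded_closedBall (x := (0 : EuclideanSpace ℝ (Fin n))) (r := b')).subset
        fun x hx => by simpa using hx.2
  have hK : IsCompact (Icc 0 θ ×ˢ N) := isCompact_Icc.prod hNc
  have hKs : Icc 0 θ ×ˢ N ⊆ Ico 0 T ×ˢ exterior n M := by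
    rintro ⟨t, x⟩ ⟨ht, hx⟩
    exact ⟨⟨ht.1, ht.2.trans_lt hθ⟩, (ha2.trans ha).trans_le hx.1⟩
  have hΦ' : ContinuousOn (fun z : ℝ × EuclideanSpace ℝ (Fin n) => Φ z.1 ‖z.2‖)
      (Icc 0 θ ×ˢ N) :=
    hΦ.comp (f := fun z : ℝ × EuclideanSpace ℝ (Fin n) => (z.1, ‖z.2‖)) (by fun_prop)
      fun z hz => ⟨mem_univ _, ha.trans_le hz.2.1, hz.2.2.trans_lt hb⟩
  have h1 := (hu.locallyIntegrable_rpow.integrableOn_compact_subset hKs hK).mul_continuousOn hΦ' hK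
  refine h1.of_ae_sdiff_eq_zero (measurableSet_Ioo.prod measurableSet_exterior).nullMeasurableSet ?_
  have hs' := (ae_restrict_iff' (measurableSet_Ioo.prod measurableSet_exterior)).1 hs
  filter_upwards [hs'] with z hz hzm
  obtain ⟨hzW, hzK⟩ := hzm
  by_cases huz : u z = 0
  · simp [huz, Real.zero_rpow (by linarith : p ≠ 0)]
  have hr := hrange ‖z.2‖ hzW.2 ((hz hzW huz).trans (by linarith [hzW.1.2]))
  rw [h0 z.1 ‖z.2‖ ⟨ha.trans hr.1, hr.2.trans hb⟩, mul_zero]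
  by_contra hlt
  exact hzK ⟨⟨hzW.1.1.le, by linarith⟩, hr.1.le, hr.2.le⟩

/-- The test identity, with the right side estimated by Hölder's inequality: only the transition
region of the cutoff contributes, and there the derivatives of the cutoff are at most a multiple of
`η ^ (1 / p)`, so that the same part of `|u| ^ p` as on the left occurs. -/
theorem IsWeakSolution.lintegral_le {n : ℕ} (hn : 3 ≤ n) {M : ℝ} (hM : 0 < M) {D V : ℝ → ℝ}
    (hDc : ContinuousOn D (Ioi (2 * M))) (hVc : ContinuousOn V (Ioi (2 * M)))
    {β μ₁ : ℝ} (hβ' : β ≤ 2) (hD : ∀ r, 2 * M < r → 0 ≤ D r ∧ D r ≤ μ₁ * r ^ (-β))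
    {p p' : ℝ} (hpp' : p.HolderConjugate p') {f g : EuclideanSpace ℝ (Fin n) → ℝ} {T R R₁ : ℝ}
    (hR₁ : 0 < R₁)
    {u : ℝ × EuclideanSpace ℝ (Fin n) → ℝ} (hu : IsWeakSolution n M D V p f g T u)
    (hs : FiniteSpeed n M R T u)
    (hf : ∀ x ∈ exterior n M, 0 ≤ f x) (hg : ∀ x ∈ exterior n M, 0 ≤ g x)
    (hdata : ∀ x ∈ exterior n M, (f x ≠ 0 ∨ g x ≠ 0) → |tortoise M ‖x‖| ≤ R)
    (hdata₁ : ∀ x ∈ exterior n M, (f x ≠ 0 ∨ g x ≠ 0) → 2 * M + R₁ ≤ ‖x‖)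
    {a a' b' b θ : ℝ} (ha2 : 2 * M < a) (ha : a < a') (hb : b' < b) (hθ0 : 0 < θ) (hθ : θ < T)
    (hθ₁ : 2 * delay M (2 * M + R₁) < θ)
    (hrange : ∀ r, 2 * M < r → |tortoise M r| ≤ T + R → r ∈ Ioo a' b')
    {ι : Type*} {s : Finset ι} {w l : ι → ℝ} {φ φ' : ι → ℝ → ℝ}
    (hmode : ∀ i ∈ s, IsMode n M D V a b (l i) (φ i) (φ' i))
    (hw : ∀ i ∈ s, 0 ≤ w i) (hl : ∀ i ∈ s, 0 ≤ l i) {Cm : ℝ}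
    (hCm : ∀ i ∈ s, ∀ r ∈ Icc a b, |φ' i r - l i / F M r * φ i r| ≤ Cm * φ i r)
    {Cη : ℝ} {η η₁ η₂ : ℝ → ℝ} (hη : IsTimeCutoff p Cη η η₁ η₂)
    {G : ℝ → ℝ → ℝ} (hGm : Measurable (Function.uncurry G))
    (hG : ∀ t ∈ Ioo 0 T, ∀ r ∈ Ioo a b, |tortoise M r| ≤ t + R → θ / 2 ≤ t + delay M r →
      t + delay M r ≤ θ →
      Cη * (4 + (8 * M ^ 2 * Cm + 4 * M * (decayRate n - 1)) * (2 * M) ^ (β - 2) + μ₁)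
        * ((waveSum s (fun i => w i * l i) l φ t r + r ^ (-β) * waveSum s w l φ t r) / θ
          + waveSum s w l φ t r / θ ^ 2) ≤ G t r) :
    (∫⁻ z in Ioo 0 T ×ˢ exterior n M, ENNReal.ofReal (|u z| ^ p
        * (waveSum s w l φ z.1 ‖z.2‖ * η ((z.1 + delay M ‖z.2‖) / θ))) ≠ ∞) ∧
    (∀ x ∈ exterior n M, 0 ≤ (F M ‖x‖)⁻¹ * g x * waveSum s w l φ 0 ‖x‖
            + D ‖x‖ * f x * waveSum s w l φ 0 ‖x‖
            + (F M ‖x‖)⁻¹ * f x * waveSum s (fun i => w i * l i) l φ 0 ‖x‖) ∧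
    ENNReal.ofReal (∫ x in exterior n M, ((F M ‖x‖)⁻¹ * g x * waveSum s w l φ 0 ‖x‖
            + D ‖x‖ * f x * waveSum s w l φ 0 ‖x‖
            + (F M ‖x‖)⁻¹ * f x * waveSum s (fun i => w i * l i) l φ 0 ‖x‖))
      + (∫⁻ z in Ioo 0 T ×ˢ exterior n M, ENNReal.ofReal (|u z| ^ p
          * (waveSum s w l φ z.1 ‖z.2‖ * η ((z.1 + delay M ‖z.2‖) / θ))))
      ≤ (∫⁻ z in transition n M R T θ,
            ENNReal.ofReal (|u z| ^ p * η ((z.1 + delay M ‖z.2‖) / θ))) ^ (1 / p)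
        * (∫⁻ z in transition n M R T θ, ENNReal.ofReal (G z.1 ‖z.2‖) ^ p') ^ (1 / p') := by
  have hp : 1 < p := hpp'.lt
  have hWm : MeasurableSet (Ioo 0 T ×ˢ exterior n M) := measurableSet_Ioo.prod measurableSet_exterior
  have hsub : Ioo a b ⊆ Ioi (2 * M) := fun r hr => ha2.trans hr.1
  obtain ⟨L, hL, hL0, hLb⟩ := hu.waveSum_eq hn hM hDc hVc hβ' hD hp hR₁ hs hdata hdata₁ ha2 ha hb hθ0
    hθ hθ₁ hrange hmode hw hl hCm hη
  have hrange' : ∀ z ∈ Ioo 0 T ×ˢ exterior n M, |tortoise M ‖z.2‖| ≤ z.1 + R → ‖z.2‖ ∈ Ioo a b :=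
    fun z hz h => by
      have hr := hrange ‖z.2‖ hz.2 (h.trans (by linarith [hz.1.2]))
      exact ⟨ha.trans hr.1, hr.2.trans hb⟩
  have hpos : ∀ w' : ι → ℝ, (∀ i ∈ s, 0 ≤ w' i) → ∀ t, ∀ r ∈ Ioo a b,
      0 ≤ waveSum s w' l φ t r := fun w' hw' t r hr => waveSum_nonneg hw' fun i hi =>
    ((hmode i hi).pos r (Ioo_subset_Icc_self hr)).le
  have hdatapos : ∀ x ∈ exterior n M, 0 ≤ (F M ‖x‖)⁻¹ * g x * waveSum s w l φ 0 ‖x‖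
            + D ‖x‖ * f x * waveSum s w l φ 0 ‖x‖
            + (F M ‖x‖)⁻¹ * f x * waveSum s (fun i => w i * l i) l φ 0 ‖x‖ := by
    intro x hx
    by_cases hfg : f x ≠ 0 ∨ g x ≠ 0
    · have hr := hrange ‖x‖ hx ((hdata x hx hfg).trans (by linarith))
      have hr' : ‖x‖ ∈ Ioo a b := ⟨ha.trans hr.1, hr.2.trans hb⟩
      have h1 := hpos w hw 0 _ hr'
      have h2 := hpos (fun i => w i * l i) (fun i hi => mul_nonneg (hw i hi) (hl i hi)) 0 _ hr'
      have h3 := hf x hx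
      have h4 := hg x hx
      have h5 := (hD ‖x‖ hx).1
      have h6 := F_pos hM hx
      positivity
    · push Not at hfg
      simp [hfg.1, hfg.2]
  have hint : IntegrableOn (fun z => |u z| ^ p * (waveSum s w l φ z.1 ‖z.2‖
      * η ((z.1 + delay M ‖z.2‖) / θ))) (Ioo 0 T ×ˢ exterior n M) := by
    refine hu.integrableOn_rpow_mul hp hs ha2 ha hb hθ hrange
      (Φ := fun t r => waveSum s w l φ t r * η ((t + delay M r) / θ)) ?_ ?_
    · refine (contDiffOn_waveSum fun i hi => (hmode i hi).contDiffOn hM hDc hVc ha2).continuousOn.mul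
        ?_
      refine (hη.contDiff.comp_contDiffOn ((contDiffOn_fst.add ?_).div_const θ)).continuousOn
      exact ((contDiffOn_delay hM).mono hsub).comp contDiffOn_snd fun z hz => hz.2
    · intro t r hr ht
      have h1 : 1 ≤ (t + delay M r) / θ := by
        rw [le_div_iff₀ hθ0]
        linarith [delay_nonneg hM (hsub hr)]
      rw [hη.eq_zero _ h1, mul_zero]
  have hs' : ∀ᵐ z ∂(volume.restrict (Ioo 0 T ×ˢ exterior n M)), z ∈ Ioo 0 T ×ˢ exterior n M ∧
      (u z ≠ 0 → |tortoise M ‖z.2‖| ≤ z.1 + R) := (ae_restrict_mem hWm).and hs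
  have hnn : 0 ≤ᵐ[volume.restrict (Ioo 0 T ×ˢ exterior n M)] fun z => |u z| ^ p
      * (waveSum s w l φ z.1 ‖z.2‖ * η ((z.1 + delay M ‖z.2‖) / θ)) := by
    filter_upwards [hs'] with z hz
    by_cases huz : u z = 0
    · simp [huz, Real.zero_rpow (by linarith : p ≠ 0)]
    · exact mul_nonneg (Real.rpow_nonneg (abs_nonneg _) _)
        (mul_nonneg (hpos w hw _ _ (hrange' z hz.1 (hz.2 huz))) (hη.nonneg _))
  refine ⟨?_, hdatapos, ?_⟩
  · rw [← ofReal_integral_eq_lintegral_ofReal hint hnn]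
    exact ENNReal.ofReal_ne_top
  have hu_meas : AEStronglyMeasurable u (volume.restrict (Ioo 0 T ×ˢ exterior n M)) :=
    (hu.locallyIntegrable.mono_set (Set.prod_mono Ioo_subset_Ico_self subset_rfl)
      ).aestronglyMeasurable
  have htr : transition n M R T θ ⊆ Ioo 0 T ×ˢ exterior n M := fun z hz => hz.1
  rw [← ofReal_integral_eq_lintegral_ofReal hint hnn, ← ENNReal.ofReal_add
    (setIntegral_nonneg measurableSet_exterior hdatapos) (integral_nonneg_of_ae hnn), add_comm, ← hL]
  have hηm : Measurable fun z : ℝ × EuclideanSpace ℝ (Fin n) => η ((z.1 + delay M ‖z.2‖) / θ) :=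
    hη.contDiff.continuous.measurable.comp
      ((measurable_fst.add (measurable_delay.comp measurable_snd.norm)).div_const θ)
  have hpow : ∀ z, ENNReal.ofReal (|u z| * η ((z.1 + delay M ‖z.2‖) / θ) ^ (1 / p)) ^ p
      = ENNReal.ofReal (|u z| ^ p * η ((z.1 + delay M ‖z.2‖) / θ)) := fun z => by
    have h0 := hη.nonneg ((z.1 + delay M ‖z.2‖) / θ)
    rw [ENNReal.ofReal_rpow_of_nonneg (by positivity) (by linarith),
      Real.mul_rpow (abs_nonneg _) (by positivity), ← Real.rpow_mul h0, one_div,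
      inv_mul_cancel₀ (by linarith), Real.rpow_one]
  calc ENNReal.ofReal (∫ z in Ioo 0 T ×ˢ exterior n M, u z * L z.1 ‖z.2‖)
      ≤ ‖∫ z in Ioo 0 T ×ˢ exterior n M, u z * L z.1 ‖z.2‖‖ₑ := by
        rw [← ofReal_norm]
        exact ENNReal.ofReal_le_ofReal (Real.le_norm_self _)
    _ ≤ ∫⁻ z in Ioo 0 T ×ˢ exterior n M, ‖u z * L z.1 ‖z.2‖‖ₑ := enorm_integral_le_lintegral_enorm _
    _ ≤ ∫⁻ z in Ioo 0 T ×ˢ exterior n M, (transition n M R T θ).indicator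
          (((fun z : ℝ × EuclideanSpace ℝ (Fin n) => ENNReal.ofReal (|u z| * η ((z.1 + delay M ‖z.2‖) / θ) ^ (1 / p)))
            * fun z : ℝ × EuclideanSpace ℝ (Fin n) => ENNReal.ofReal (G z.1 ‖z.2‖))) z := by
        refine lintegral_mono_ae ?_
        filter_upwards [hs'] with z hz
        by_cases huz : u z = 0
        · simp [huz]
        have hzr := hrange' z hz.1 (hz.2 huz)
        by_cases h1 : z.1 + delay M ‖z.2‖ < θ / 2
        · rw [hL0 _ _ hzr (by rw [div_lt_iff₀ hθ0]; linarith)]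
          simp
        by_cases h2 : θ < z.1 + delay M ‖z.2‖
        · have h3 := hLb z.1 _ hzr
          rw [hη.eq_zero _ ((one_le_div hθ0).2 h2.le), Real.zero_rpow (by positivity), mul_zero,
            zero_mul] at h3
          rw [abs_nonpos_iff.1 h3]
          simp
        push Not at h1 h2
        have hmem : z ∈ transition n M R T θ := ⟨hz.1, hz.2 huz, h1, h2⟩
        rw [indicator_of_mem hmem, Pi.mul_apply, ← ENNReal.ofReal_mul (mul_nonneg (abs_nonneg _)
          (Real.rpow_nonneg (hη.nonneg _) _)), ← ofReal_norm, Real.norm_eq_abs, abs_mul,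
          mul_assoc]
        refine ENNReal.ofReal_le_ofReal (mul_le_mul_of_nonneg_left ?_ (abs_nonneg _))
        refine (hLb z.1 _ hzr).trans ?_
        refine le_trans (le_of_eq ?_) (mul_le_mul_of_nonneg_left
          (hG z.1 hz.1.1 _ hzr (hz.2 huz) h1 h2) (Real.rpow_nonneg (hη.nonneg _) (1 / p)))
        ring
    _ = ∫⁻ z in transition n M R T θ,
          ((fun z : ℝ × EuclideanSpace ℝ (Fin n) => ENNReal.ofReal (|u z| * η ((z.1 + delay M ‖z.2‖) / θ) ^ (1 / p)))
            * fun z : ℝ × EuclideanSpace ℝ (Fin n) => ENNReal.ofReal (G z.1 ‖z.2‖)) z := by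
        rw [setLIntegral_indicator measurableSet_transition, inter_eq_left.2 htr]
    _ ≤ _ := by
        refine (ENNReal.lintegral_mul_le_Lp_mul_Lq _ hpp' (f := fun z => ENNReal.ofReal
          (|u z| * η ((z.1 + delay M ‖z.2‖) / θ) ^ (1 / p)))
          (g := fun z : ℝ × EuclideanSpace ℝ (Fin n) => ENNReal.ofReal (G z.1 ‖z.2‖)) ?_ ?_).trans (le_of_eq ?_)
        · refine AEMeasurable.ennreal_ofReal (AEMeasurable.mul ?_ ?_)
          · exact (continuous_abs.measurable.comp_aemeasurable
              (hu_meas.mono_measure (Measure.restrict_mono htr le_rfl)).aemeasurable)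
          · exact (hηm.pow_const _).aemeasurable
        · exact (hGm.comp (measurable_fst.prodMk measurable_snd.norm)).ennreal_ofReal.aemeasurable
        · congr 2
          exact lintegral_congr fun z => hpow z

/-! ### Integrals over the transition region -/

theorem lintegral_fun_norm_addHaar {E : Type*} [NormedAddCommGroup E] [NormedSpace ℝ E]
    [MeasurableSpace E] [BorelSpace E] [FiniteDimensional ℝ E] [Nontrivial E] (μ : Measure E)
    [μ.IsAddHaarMeasure] {f : ℝ → ℝ≥0∞} (hf : Measurable f) :
    ∫⁻ x, f ‖x‖ ∂μ = μ.toSphere univ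
      * ∫⁻ r in Ioi (0 : ℝ), ENNReal.ofReal (r ^ (Module.finrank ℝ E - 1)) * f r := by
  have h1 : Measurable fun z : Ioi (0 : ℝ) => f z := hf.comp measurable_subtype_coe
  calc ∫⁻ x, f ‖x‖ ∂μ = ∫⁻ x in ({0}ᶜ : Set E), f ‖x‖ ∂μ := by
        rw [restrict_compl_singleton]
    _ = ∫⁻ x : ({0}ᶜ : Set E), f ‖x.1‖ ∂(μ.comap (↑)) :=
        (lintegral_subtype_comap (measurableSet_singleton _).compl fun x => f ‖x‖).symm
    _ = ∫⁻ x, f x.2 ∂μ.toSphere.prod (.volumeIoiPow (Module.finrank ℝ E - 1)) := by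
        have h := μ.measurePreserving_homeomorphUnitSphereProd.lintegral_comp
          (f := fun z => f z.2) (h1.comp measurable_snd)
        simpa using h
    _ = μ.toSphere univ * ∫⁻ x : Ioi (0 : ℝ), f x ∂.volumeIoiPow (Module.finrank ℝ E - 1) := by
        have h := lintegral_prod (μ := μ.toSphere)
          (ν := .volumeIoiPow (Module.finrank ℝ E - 1)) _ (h1.comp measurable_snd).aemeasurable
        simpa [mul_comm] using h
    _ = _ := by
        rw [Measure.volumeIoiPow, lintegral_withDensity_eq_lintegral_mul _ (by fun_prop) h1]
        congr 1
        exact lintegral_subtype_comap measurableSet_Ioi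
          fun r => ENNReal.ofReal (r ^ (Module.finrank ℝ E - 1)) * f r

theorem tortoise_add_delay {M r : ℝ} (hM : 0 < M) (hr : 2 * M < r) :
    tortoise M r + delay M r = r + 2 * M * Real.log r := by
  have hr0 : 0 < r := by linarith
  have : F M r = (r - 2 * M) / r := by rw [F]; field_simp
  rw [tortoise, delay, this, Real.log_div (by linarith) hr0.ne']
  ring

theorem tortoise_le {M r : ℝ} (hM : 0 < M) (hr : 2 * M < r) : tortoise M r ≤ (1 + 2 * M) * r := by
  have := Real.log_le_sub_one_of_pos (by linarith : 0 < r - 2 * M)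
  rw [tortoise]
  nlinarith

theorem le_tortoise {M r : ℝ} (hM : 0 < M) (hr : 2 * M + 1 ≤ r) : r ≤ tortoise M r := by
  have := Real.log_nonneg (by linarith : 1 ≤ r - 2 * M)
  rw [tortoise]
  nlinarith

theorem monotoneOn_tortoise {M : ℝ} (hM : 0 < M) : MonotoneOn (tortoise M) (Ioi (2 * M)) :=
  fun r hr r' _ h => by
    have h1 : 2 * M < r := hr
    have := Real.log_le_log (by linarith : 0 < r - 2 * M) (by linarith : r - 2 * M ≤ r' - 2 * M)
    unfold tortoise
    nlinarith

theorem le_of_tortoise_le {M r τ : ℝ} (hM : 0 < M) (hτ : 0 ≤ τ) (h : tortoise M r ≤ τ) :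
    r ≤ τ + 2 * M + 1 := by
  by_contra hc
  push Not at hc
  linarith [le_tortoise hM (by linarith : 2 * M + 1 ≤ r)]

theorem delay_le {M r τ : ℝ} (hM : 0 < M) (hr : 2 * M < r) (hτ : 0 ≤ τ) (h : -τ ≤ tortoise M r) :
    delay M r ≤ τ + (2 * M + 1 + 4 * M ^ 2) := by
  have h1 := Real.log_le_sub_one_of_pos (by linarith : 0 < 2 * M + 1)
  rcases le_total r (2 * M + 1) with h2 | h2
  · have h3 := tortoise_add_delay hM hr
    have h4 := Real.log_le_log (by linarith) h2
    nlinarith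
  · have h3 := delay_anti hM (by linarith : 2 * M < 2 * M + 1) h2
    have h4 := tortoise_add_delay hM (by linarith : 2 * M < 2 * M + 1)
    have h5 := le_tortoise hM (le_refl (2 * M + 1))
    nlinarith

/-- A time scale after which the propagation region is comparable to the cone `{r ≤ t}`. -/
noncomputable def timeScale (M R : ℝ) : ℝ := 8 * (2 * M + 1 + 4 * M ^ 2 + R)

theorem transition_bounds {M R θ t r : ℝ} (hM : 0 < M) (hR : 0 < R) (hθ : timeScale M R ≤ θ)
    (ht : 0 < t) (hr : 2 * M < r) (hs : |tortoise M r| ≤ t + R) (h1 : θ / 2 ≤ t + delay M r)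
    (h2 : t + delay M r ≤ θ) : θ / 8 ≤ t ∧ t ≤ θ ∧ r ≤ 2 * θ := by
  have hs' := abs_le.1 hs
  have h3 := delay_le hM hr (by linarith) hs'.1
  have h4 := delay_nonneg hM hr
  have h5 := le_of_tortoise_le hM (by linarith) hs'.2
  unfold timeScale at hθ
  have := sq_nonneg M
  exact ⟨by linarith, by linarith, by linarith⟩

theorem mem_transition_bounds {n : ℕ} {M R T θ : ℝ} (hM : 0 < M) (hR : 0 < R)
    (hθ : timeScale M R ≤ θ) {z : ℝ × EuclideanSpace ℝ (Fin n)} (hz : z ∈ transition n M R T θ) :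
    θ / 8 ≤ z.1 ∧ z.1 ≤ θ ∧ 2 * M < ‖z.2‖ ∧ ‖z.2‖ ≤ 2 * θ ∧ tortoise M ‖z.2‖ ≤ z.1 + R := by
  obtain ⟨⟨ht, hx⟩, hs, h1, h2⟩ := hz
  obtain ⟨h3, h4, h5⟩ := transition_bounds hM hR hθ ht.1 hx hs h1 h2
  exact ⟨h3, h4, hx, h5, (abs_le.1 hs).2⟩

theorem exists_lintegral_transition_le {n : ℕ} (hn : 3 ≤ n) {M R : ℝ} (hM : 0 < M) (hR : 0 < R) :
    ∃ C > (0 : ℝ), ∀ T θ : ℝ, timeScale M R ≤ θ → ∀ H : ℝ → ℝ → ℝ≥0∞,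
      Measurable (Function.uncurry H) → ∀ B : ℝ, 0 ≤ B →
      (∀ t ∈ Icc (θ / 8) θ, ∫⁻ r in {r | 2 * M < r ∧ r ≤ 2 * θ ∧ tortoise M r ≤ t + R},
        ENNReal.ofReal (r ^ (n - 1)) * H t r ≤ ENNReal.ofReal B) →
      ∫⁻ z in transition n M R T θ, H z.1 ‖z.2‖ ≤ ENNReal.ofReal (C * (θ * B)) := by
  have : Nontrivial (EuclideanSpace ℝ (Fin n)) :=
    Module.nontrivial_of_finrank_pos (R := ℝ) (by simp; omega)
  set c := (volume : Measure (EuclideanSpace ℝ (Fin n))).toSphere univ with hc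
  have hc_top : c ≠ ∞ := measure_ne_top _ _
  refine ⟨c.toReal + 1, by positivity, fun T θ hθ H hH B hB h => ?_⟩
  have hθ0 : 0 < θ := lt_of_lt_of_le (by unfold timeScale; positivity) hθ
  set A : Set (ℝ × ℝ) := {y | y.1 ∈ Icc (θ / 8) θ ∧
    (2 * M < y.2 ∧ y.2 ≤ 2 * θ ∧ tortoise M y.2 ≤ y.1 + R)} with hA
  have hAm : MeasurableSet A := by
    refine (measurableSet_Icc.preimage measurable_fst).inter
      ((measurableSet_lt measurable_const measurable_snd).inter
      ((measurableSet_le measurable_snd measurable_const).inter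
        (measurableSet_le (measurable_tortoise.comp measurable_snd) (measurable_fst.add_const R))))
  set K : ℝ × ℝ → ℝ≥0∞ := A.indicator (Function.uncurry H) with hK
  have hKm : Measurable K := hH.indicator hAm
  have hKm2 : Measurable fun z : ℝ × EuclideanSpace ℝ (Fin n) => K (z.1, ‖z.2‖) :=
    hKm.comp (measurable_fst.prodMk measurable_snd.norm)
  calc ∫⁻ z in transition n M R T θ, H z.1 ‖z.2‖
      ≤ ∫⁻ z in transition n M R T θ, K (z.1, ‖z.2‖) := by
        refine lintegral_mono_ae ((ae_restrict_mem measurableSet_transition).mono fun z hz => ?_)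
        obtain ⟨h1, h2, h3, h4, h5⟩ := mem_transition_bounds hM hR hθ hz
        have hm : (z.1, ‖z.2‖) ∈ A := ⟨⟨h1, h2⟩, h3, h4, h5⟩
        simp only [hK, indicator_of_mem hm, Function.uncurry_apply_pair]
        exact le_rfl
    _ ≤ ∫⁻ z : ℝ × EuclideanSpace ℝ (Fin n), K (z.1, ‖z.2‖) := setLIntegral_le_lintegral _ _
    _ = ∫⁻ t : ℝ, ∫⁻ x : EuclideanSpace ℝ (Fin n), K (t, ‖x‖) := by
        rw [Measure.volume_eq_prod, lintegral_prod _ hKm2.aemeasurable]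
    _ ≤ ∫⁻ t : ℝ, (Icc (θ / 8) θ).indicator (fun _ => c * ENNReal.ofReal B) t := by
        refine lintegral_mono fun t => ?_
        rw [lintegral_fun_norm_addHaar volume (f := fun r => K (t, r))
          (hKm.comp (measurable_const.prodMk measurable_id)), finrank_euclideanSpace_fin]
        by_cases ht : t ∈ Icc (θ / 8) θ
        · rw [indicator_of_mem ht]
          refine mul_le_mul_right ?_ _
          refine le_trans ?_ (h t ht)
          have hSm : MeasurableSet {r : ℝ | 2 * M < r ∧ r ≤ 2 * θ ∧ tortoise M r ≤ t + R} :=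
            (measurableSet_Ioi).inter (measurableSet_Iic.inter
              (measurableSet_le measurable_tortoise measurable_const))
          rw [← lintegral_indicator hSm]
          refine (setLIntegral_le_lintegral _ _).trans (lintegral_mono fun r => ?_)
          by_cases hr : 2 * M < r ∧ r ≤ 2 * θ ∧ tortoise M r ≤ t + R
          · have hm : (t, r) ∈ A := ⟨ht, hr⟩
            rw [indicator_of_mem (show r ∈ {r : ℝ | 2 * M < r ∧ r ≤ 2 * θ ∧ tortoise M r ≤ t + R}
              from hr)]
            simp only [hK, indicator_of_mem hm, Function.uncurry_apply_pair]
            exact le_rfl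
          · have hm : (t, r) ∉ A := fun h => hr h.2
            simp [hK, indicator_of_notMem hm]
        · have hm : ∀ r, (t, r) ∉ A := fun r h => ht h.1
          simp [hK, indicator_of_notMem (hm _)]
    _ = c * ENNReal.ofReal B * ENNReal.ofReal (θ - θ / 8) := by
        rw [lintegral_indicator_const measurableSet_Icc, Real.volume_Icc]
    _ ≤ _ := by
        nth_rewrite 1 [← ENNReal.ofReal_toReal hc_top]
        rw [← ENNReal.ofReal_mul ENNReal.toReal_nonneg,
          ← ENNReal.ofReal_mul (by positivity)]
        refine ENNReal.ofReal_le_ofReal ?_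
        have h0 : 0 ≤ c.toReal := ENNReal.toReal_nonneg
        have h1 : c.toReal * B * (θ - θ / 8) ≤ c.toReal * B * θ := by gcongr; linarith
        have h2 : 0 ≤ θ * B := by positivity
        linear_combination h1 + h2

/-- An integral is at most the oscillation of an antiderivative. -/
theorem lintegral_le_of_deriv {S : Set ℝ} (hS : MeasurableSet S) {f g g' : ℝ → ℝ} {B : ℝ}
    (hg : ∀ x ∈ S, HasDerivAt g (g' x) x) (hmono : MonotoneOn g S)
    (h0 : ∀ x ∈ S, 0 ≤ g x) (hB : ∀ x ∈ S, g x ≤ B) (hf : ∀ x ∈ S, f x ≤ g' x) :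
    ∫⁻ x in S, ENNReal.ofReal (f x) ≤ ENNReal.ofReal B := by
  calc ∫⁻ x in S, ENNReal.ofReal (f x) ≤ ∫⁻ x in S, ENNReal.ofReal (g' x) :=
        setLIntegral_mono' hS fun x hx => ENNReal.ofReal_le_ofReal (hf x hx)
    _ = volume (g '' S) := lintegral_deriv_eq_volume_image_of_monotoneOn hS
        (fun x hx => (hg x hx).hasDerivWithinAt) hmono
    _ ≤ volume (Icc 0 B) := measure_mono (image_subset_iff.2 fun x hx => ⟨h0 x hx, hB x hx⟩)
    _ = _ := by rw [Real.volume_Icc, sub_zero]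

theorem lintegral_rpow_tail_le {M δ : ℝ} (hM : 0 < M) (hδ : 0 < δ) :
    ∫⁻ r in Ioi (2 * M), ENNReal.ofReal (r ^ (-1 - δ)) ≤ ENNReal.ofReal ((2 * M) ^ (-δ) / δ) := by
  have h0 : ∀ r ∈ Ioi (2 * M), 0 < r := fun r hr => by have : 2 * M < r := hr; linarith
  have hle : ∀ r ∈ Ioi (2 * M), ∀ r', r ≤ r' → r' ^ (-δ) ≤ r ^ (-δ) := fun r hr r' h =>
    Real.rpow_le_rpow_of_nonpos (h0 r hr) h (by linarith)
  refine lintegral_le_of_deriv measurableSet_Ioi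
    (g := fun r => ((2 * M) ^ (-δ) - r ^ (-δ)) / δ) (g' := fun r => r ^ (-1 - δ)) ?_ ?_ ?_ ?_ ?_
  · intro r hr
    have h := ((Real.hasDerivAt_rpow_const (p := -δ) (Or.inl (h0 r hr).ne')).const_sub
      ((2 * M) ^ (-δ))).div_const δ
    convert! h using 1
    rw [show -1 - δ = -δ - 1 by ring]
    field_simp
  · intro r hr r' hr' h
    have := hle r hr r' h
    show _ / δ ≤ _ / δ
    gcongr
  · intro r hr
    have h1 : r ^ (-δ) ≤ (2 * M) ^ (-δ) :=
      Real.rpow_le_rpow_of_nonpos (by positivity) (le_of_lt hr) (by linarith)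
    exact div_nonneg (by linarith) hδ.le
  · intro r hr
    have := Real.rpow_nonneg (h0 r hr).le (-δ)
    show _ / δ ≤ _ / δ
    gcongr
    linarith
  · intro r _
    exact le_rfl

theorem lintegral_exp_tortoise_le {M κ τ : ℝ} (hM : 0 < M) (hκ : 0 < κ) :
    ∫⁻ r in {r | 2 * M < r ∧ tortoise M r ≤ τ}, ENNReal.ofReal (Real.exp (-(κ * (τ - tortoise M r))))
      ≤ ENNReal.ofReal (1 / κ) := by
  have hmono := monotoneOn_tortoise hM
  refine lintegral_le_of_deriv
    (measurableSet_Ioi.inter (measurableSet_le measurable_tortoise measurable_const))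
    (g := fun r => Real.exp (-(κ * (τ - tortoise M r))) / κ)
    (g' := fun r => Real.exp (-(κ * (τ - tortoise M r))) * (F M r)⁻¹) ?_ ?_ ?_ ?_ ?_
  · intro r hr
    have h := (((((hasDerivAt_tortoise hM hr.1).const_sub τ).const_mul κ).neg).exp).div_const κ
    convert! h using 1
    simp only [Pi.neg_apply]
    field_simp
  · intro r hr r' hr' h
    have := hmono hr.1 hr'.1 h
    show _ / κ ≤ _ / κ
    gcongr
  · intro r _
    positivity
  · intro r hr
    have hr2 : tortoise M r ≤ τ := hr.2
    show _ / κ ≤ _ / κ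
    have : 0 ≤ κ * (τ - tortoise M r) := mul_nonneg hκ.le (by linarith)
    gcongr
    exact Real.exp_le_one_iff.2 (by linarith)
  · intro r hr
    have h1 := F_pos hM hr.1
    exact le_mul_of_one_le_right (Real.exp_pos _).le
      ((one_le_inv₀ h1).2 (F_lt_one hM hr.1).le)

theorem lintegral_inv_tortoise_le {M τ : ℝ} (hM : 0 < M) (hτ : 0 ≤ τ) :
    ∫⁻ r in {r | 2 * M < r ∧ tortoise M r ≤ τ}, ENNReal.ofReal ((1 + (τ - tortoise M r))⁻¹)
      ≤ ENNReal.ofReal (1 + Real.log (1 + τ)) := by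
  have hmono := monotoneOn_tortoise hM
  have hSm : MeasurableSet {r | 2 * M < r ∧ tortoise M r ≤ τ} :=
    measurableSet_Ioi.inter (measurableSet_le measurable_tortoise measurable_const)
  have hsub : {r | 2 * M < r ∧ tortoise M r ≤ τ} ⊆
      Ioc (2 * M) (2 * M + 1) ∪ {r | 2 * M + 1 < r ∧ tortoise M r ≤ τ} := fun r hr => by
    rcases le_or_gt r (2 * M + 1) with h | h
    · exact Or.inl ⟨hr.1, h⟩
    · exact Or.inr ⟨h, hr.2⟩
  have hl : 0 ≤ Real.log (1 + τ) := Real.log_nonneg (by linarith)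
  rw [ENNReal.ofReal_add zero_le_one hl]
  calc ∫⁻ r in {r | 2 * M < r ∧ tortoise M r ≤ τ}, ENNReal.ofReal ((1 + (τ - tortoise M r))⁻¹)
      = ∫⁻ r in {r | 2 * M < r ∧ tortoise M r ≤ τ}, {r | tortoise M r ≤ τ}.indicator
          (fun r => ENNReal.ofReal ((1 + (τ - tortoise M r))⁻¹)) r :=
        setLIntegral_congr_fun hSm fun r hr => by
          rw [indicator_of_mem (show r ∈ {r | tortoise M r ≤ τ} from hr.2)]
    _ ≤ ∫⁻ r in Ioc (2 * M) (2 * M + 1) ∪ {r | 2 * M + 1 < r ∧ tortoise M r ≤ τ},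
          {r | tortoise M r ≤ τ}.indicator
          (fun r => ENNReal.ofReal ((1 + (τ - tortoise M r))⁻¹)) r := lintegral_mono_set hsub
    _ ≤ _ := (lintegral_union_le _ _ _).trans (add_le_add ?_ ?_)
  · calc _ ≤ ∫⁻ _ in Ioc (2 * M) (2 * M + 1), ENNReal.ofReal 1 := by
          refine lintegral_mono fun r => ?_
          by_cases h : tortoise M r ≤ τ
          · rw [indicator_of_mem (show r ∈ {r | tortoise M r ≤ τ} from h)]
            exact ENNReal.ofReal_le_ofReal (inv_le_one_of_one_le₀ (by linarith))
          · simp [h]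
      _ = ENNReal.ofReal 1 := by simp [Real.volume_Ioc]
  · have hSm' : MeasurableSet {r | 2 * M + 1 < r ∧ tortoise M r ≤ τ} :=
      measurableSet_Ioi.inter (measurableSet_le measurable_tortoise measurable_const)
    rw [setLIntegral_congr_fun hSm' (g := fun r => ENNReal.ofReal ((1 + (τ - tortoise M r))⁻¹))
      fun r hr => indicator_of_mem (show r ∈ {r | tortoise M r ≤ τ} from hr.2) _]
    refine lintegral_le_of_deriv hSm'
      (g := fun r => Real.log (1 + τ) - Real.log (1 + (τ - tortoise M r)))
      (g' := fun r => (1 + (τ - tortoise M r))⁻¹ * (F M r)⁻¹) ?_ ?_ ?_ ?_ ?_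
    · intro r hr
      have h1 : (0 : ℝ) < 1 + (τ - tortoise M r) := by linarith [show tortoise M r ≤ τ from hr.2]
      have h := ((((hasDerivAt_tortoise hM (by linarith [show 2 * M + 1 < r from hr.1] : 2 * M < r)).const_sub τ).const_add
        1).log h1.ne').const_sub (Real.log (1 + τ))
      convert! h using 1
      field_simp
    · intro r hr r' hr' h
      have h1 := hmono (show 2 * M < r by linarith [show 2 * M + 1 < r from hr.1]) (show 2 * M < r' by linarith [show 2 * M + 1 < r' from hr'.1]) h
      have h2 := Real.log_le_log (by linarith [show tortoise M r' ≤ τ from hr'.2] : 0 < 1 + (τ - tortoise M r'))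
        (by linarith : 1 + (τ - tortoise M r') ≤ 1 + (τ - tortoise M r))
      show _ - _ ≤ _ - _
      linarith
    · intro r hr
      have h1 := le_tortoise hM hr.1.le
      have h3 : 2 * M + 1 < r := hr.1
      have h2 := Real.log_le_log (by linarith [show tortoise M r ≤ τ from hr.2] : 0 < 1 + (τ - tortoise M r))
        (by linarith : 1 + (τ - tortoise M r) ≤ 1 + τ)
      show 0 ≤ _ - _
      linarith
    · intro r hr
      have := Real.log_nonneg (by linarith [show tortoise M r ≤ τ from hr.2] : 1 ≤ 1 + (τ - tortoise M r))
      show _ - _ ≤ _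
      linarith
    · intro r hr
      have h4 : 2 * M < r := by linarith [show 2 * M + 1 < r from hr.1]
      have h1 := F_pos hM h4
      have h5 : (0 : ℝ) < 1 + (τ - tortoise M r) := by linarith [show tortoise M r ≤ τ from hr.2]
      exact le_mul_of_one_le_right (by positivity)
        ((one_le_inv₀ h1).2 (F_lt_one hM h4).le)

theorem four_le_timeScale {M R : ℝ} (hM : 0 < M) (hR : 0 < R) : 4 ≤ timeScale M R := by
  unfold timeScale
  have := sq_nonneg M
  linarith

theorem rpow_le_rpow_add_rpow {a b x : ℝ} (ha : 0 < a) (hax : a ≤ x) (hxb : x ≤ b) (e : ℝ) :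
    x ^ e ≤ a ^ e + b ^ e := by
  have h1 := Real.rpow_nonneg ha.le e
  have h2 := Real.rpow_nonneg (ha.le.trans (hax.trans hxb)) e
  rcases le_total 0 e with h | h
  · linarith [Real.rpow_le_rpow (ha.le.trans hax) hxb h]
  · linarith [Real.rpow_le_rpow_of_nonpos ha hax h]

theorem one_add_le_exp_mul_div {δ x : ℝ} (hδ : 0 < δ) (hδ1 : δ ≤ 1) :
    1 + x ≤ Real.exp (δ * x) / δ := by
  rw [le_div_iff₀ hδ]
  nlinarith [Real.add_one_le_exp (δ * x)]

/-- Inside the cone `{s ≤ τ}` the radius is comparable to `τ` up to an arbitrarily small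
exponential loss in `τ - s`. -/
theorem exists_rpow_le_mul_exp {M : ℝ} (hM : 0 < M) (e : ℝ) {κ : ℝ} (hκ : 0 < κ) :
    ∃ C > (0 : ℝ), ∀ r τ, 2 * M < r → 1 ≤ τ → tortoise M r ≤ τ →
      r ^ e ≤ C * (τ ^ e * Real.exp (κ * (τ - tortoise M r))) := by
  rcases le_or_gt 0 e with he | he
  · refine ⟨(2 * M + 2) ^ e, by positivity, fun r τ hr hτ h => ?_⟩
    have h1 := le_of_tortoise_le hM (by linarith) h
    have h2 : r ≤ (2 * M + 2) * τ := by nlinarith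
    have h3 : 1 ≤ Real.exp (κ * (τ - tortoise M r)) :=
      Real.one_le_exp (mul_nonneg hκ.le (by linarith))
    calc r ^ e ≤ ((2 * M + 2) * τ) ^ e := Real.rpow_le_rpow (by linarith) h2 he
      _ = (2 * M + 2) ^ e * (τ ^ e * 1) := by
        rw [Real.mul_rpow (by positivity) (by linarith), mul_one]
      _ ≤ _ := by gcongr
  · set A := 1 / (2 * M) + 1 + 2 * M with hA
    have hA0 : 0 < A := by positivity
    set δ := min 1 (κ / (-e)) with hδ
    have hδ0 : 0 < δ := lt_min one_pos (div_pos hκ (by linarith))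
    have hδκ : δ * -e ≤ κ := (le_div_iff₀ (by linarith)).1 (min_le_right _ _)
    refine ⟨(δ / A) ^ e, by positivity, fun r τ hr hτ h => ?_⟩
    have hr0 : 0 < r := by linarith
    set x := τ - tortoise M r with hx
    have hx0 : 0 ≤ x := by linarith
    have h1 : τ ≤ A * r * (1 + x) := by
      have h2 := tortoise_le hM hr
      have h3 : x ≤ x * (r / (2 * M)) := le_mul_of_one_le_right hx0
        ((one_le_div (by positivity)).2 hr.le)
      have h4 : 0 ≤ (1 + 2 * M) * r * x := by positivity
      have h5 : 0 ≤ r / (2 * M) := by positivity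
      calc τ = x + tortoise M r := by ring
        _ ≤ x * (r / (2 * M)) + (1 + 2 * M) * r := add_le_add h3 h2
        _ ≤ x * (r / (2 * M)) + (1 + 2 * M) * r + ((1 + 2 * M) * r * x + r / (2 * M)) := by linarith
        _ = _ := by rw [hA]; ring
    have h2 := one_add_le_exp_mul_div hδ0 (min_le_left _ _) (x := x)
    have h3 : δ / A * (τ * Real.exp (-(δ * x))) ≤ r := by
      rw [Real.exp_neg, ← div_eq_mul_inv, div_mul_div_comm, div_le_iff₀ (by positivity)]
      calc δ * τ ≤ δ * (A * r * (Real.exp (δ * x) / δ)) :=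
            mul_le_mul_of_nonneg_left (h1.trans (by gcongr)) hδ0.le
        _ = _ := by field_simp
    calc r ^ e ≤ (δ / A * (τ * Real.exp (-(δ * x)))) ^ e :=
          Real.rpow_le_rpow_of_nonpos (by positivity) h3 he.le
      _ = (δ / A) ^ e * (τ ^ e * Real.exp (δ * -e * x)) := by
          rw [Real.mul_rpow (by positivity) (by positivity), Real.mul_rpow (by positivity)
            (Real.exp_pos _).le, ← Real.exp_mul]
          ring_nf
      _ ≤ _ := by gcongr

theorem measurableSet_cone {M θ τ : ℝ} :
    MeasurableSet {r | 2 * M < r ∧ r ≤ 2 * θ ∧ tortoise M r ≤ τ} :=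
  measurableSet_Ioi.inter (measurableSet_Iic.inter
    (measurableSet_le measurable_tortoise measurable_const))

/-- The dual integral of the test function built from the mode with exponent `0`, for which the
damping and the dispersive terms are of size `r ^ (-β) / θ` and `1 / θ ^ 2`. -/
theorem exists_lintegral_static_le {n : ℕ} (hn : 3 ≤ n) {M R : ℝ} (hM : 0 < M) (hR : 0 < R)
    {β p' K : ℝ} (hβ : 1 < β) (hp' : 1 < p') (hK : 0 < K) :
    ∃ C > (0 : ℝ), ∀ T θ : ℝ, timeScale M R ≤ θ →
      ∫⁻ z in transition n M R T θ,
        ENNReal.ofReal (K * (‖z.2‖ ^ (-β) / θ + 1 / θ ^ 2)) ^ p'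
      ≤ ENNReal.ofReal (C * (θ ^ (n + 1 - 2 * p') + θ ^ (1 - p'))) := by
  obtain ⟨c, hc, hlint⟩ := exists_lintegral_transition_le hn hM hR
  set δ := (β - 1) * p' with hδ
  have hδ0 : 0 < δ := mul_pos (by linarith) (by linarith)
  set c₁ := (2 * M) ^ (-δ) / δ with hc₁
  have hc₁0 : 0 < c₁ := by positivity
  set c₂ := ((2 : ℝ) * K) ^ p' with hc₂
  have hc₂0 : 0 < c₂ := by positivity
  refine ⟨c * (c₂ * (c₁ * ((2 * M) ^ ((n : ℝ) - p') + 2 ^ ((n : ℝ) - p')) + 2 ^ n)),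
    by positivity, fun T θ hθ => ?_⟩
  have hθ4 := (four_le_timeScale hM hR).trans hθ
  have hθ0 : 0 < θ := by linarith
  set b₁ := c₂ * (θ ^ (-p') * ((2 * M) ^ ((n : ℝ) - p') + (2 * θ) ^ ((n : ℝ) - p'))) with hb₁
  set b₂ := c₂ * (θ ^ (-(2 * p')) * (2 * θ) ^ (n - 1)) with hb₂
  have hb₁0 : 0 ≤ b₁ := by positivity
  have hb₂0 : 0 ≤ b₂ := by positivity
  refine (hlint T θ hθ (fun _ r => ENNReal.ofReal (K * (r ^ (-β) / θ + 1 / θ ^ 2)) ^ p')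
    (by unfold Function.uncurry; fun_prop) (b₁ * c₁ + b₂ * (2 * θ)) (by positivity) ?_).trans
    (ENNReal.ofReal_le_ofReal ?_)
  · intro t _
    calc ∫⁻ r in {r | 2 * M < r ∧ r ≤ 2 * θ ∧ tortoise M r ≤ t + R},
          ENNReal.ofReal (r ^ (n - 1)) * ENNReal.ofReal (K * (r ^ (-β) / θ + 1 / θ ^ 2)) ^ p'
        ≤ ∫⁻ r in {r | 2 * M < r ∧ r ≤ 2 * θ ∧ tortoise M r ≤ t + R},
          (ENNReal.ofReal b₁ * ENNReal.ofReal (r ^ (-1 - δ)) + ENNReal.ofReal b₂) := by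
          refine setLIntegral_mono' measurableSet_cone fun r hr => ?_
          obtain ⟨hr1, hr2, -⟩ := hr
          have hr0 : 0 < r := by linarith
          rw [ENNReal.ofReal_rpow_of_nonneg (by positivity) (by linarith),
            ← ENNReal.ofReal_mul (by positivity), ← ENNReal.ofReal_mul hb₁0,
            ← ENNReal.ofReal_add (by positivity) hb₂0]
          refine ENNReal.ofReal_le_ofReal ?_
          -- `(x + y) ^ p' ≤ 2 ^ p' * (x ^ p' + y ^ p')`
          have h1 : (K * (r ^ (-β) / θ + 1 / θ ^ 2)) ^ p'
              ≤ c₂ * ((r ^ (-β) / θ) ^ p' + (1 / θ ^ 2) ^ p') := by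
            set x := r ^ (-β) / θ with hx
            set y := 1 / θ ^ 2 with hy
            have hx0 : 0 < x := by positivity
            have hy0 : 0 < y := by positivity
            rw [hc₂]
            rcases le_total x y with h | h
            · calc (K * (x + y)) ^ p' ≤ (2 * K * y) ^ p' := by
                    refine Real.rpow_le_rpow (by positivity) ?_ (by linarith)
                    nlinarith
                _ = (2 * K) ^ p' * y ^ p' := Real.mul_rpow (by positivity) hy0.le
                _ ≤ _ := by gcongr; linarith [Real.rpow_pos_of_pos hx0 p']
            · calc (K * (x + y)) ^ p' ≤ (2 * K * x) ^ p' := by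
                    refine Real.rpow_le_rpow (by positivity) ?_ (by linarith)
                    nlinarith
                _ = (2 * K) ^ p' * x ^ p' := Real.mul_rpow (by positivity) hx0.le
                _ ≤ _ := by gcongr; linarith [Real.rpow_pos_of_pos hy0 p']
          have h2 : (r ^ (-β) / θ) ^ p' = r ^ (-(β * p')) * θ ^ (-p') := by
            rw [Real.div_rpow (by positivity) hθ0.le, ← Real.rpow_mul hr0.le, Real.rpow_neg hθ0.le,
              div_eq_mul_inv, neg_mul]
          have h3 : (1 / θ ^ 2) ^ p' = θ ^ (-(2 * p')) := by
            rw [one_div, Real.inv_rpow (by positivity), Real.rpow_neg hθ0.le, Real.rpow_mul hθ0.le]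
            norm_num
          have h4 : r ^ (n - 1) * r ^ (-(β * p')) = r ^ ((n : ℝ) - p') * r ^ (-1 - δ) := by
            rw [← Real.rpow_natCast, ← Real.rpow_add hr0, ← Real.rpow_add hr0,
              Nat.cast_sub (by omega)]
            congr 1
            rw [hδ]
            push_cast
            ring
          have h5 := rpow_le_rpow_add_rpow (by positivity) hr1.le hr2 ((n : ℝ) - p')
          calc r ^ (n - 1) * (K * (r ^ (-β) / θ + 1 / θ ^ 2)) ^ p'
              ≤ r ^ (n - 1) * (c₂ * ((r ^ (-β) / θ) ^ p' + (1 / θ ^ 2) ^ p')) := by gcongr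
            _ = c₂ * (θ ^ (-p') * r ^ ((n : ℝ) - p')) * r ^ (-1 - δ)
                + c₂ * (θ ^ (-(2 * p')) * r ^ (n - 1)) := by
                rw [h2, h3]; linear_combination c₂ * θ ^ (-p') * h4
            _ ≤ _ := by rw [hb₁, hb₂]; gcongr
      _ ≤ ENNReal.ofReal b₁ * ENNReal.ofReal c₁ + ENNReal.ofReal b₂ * ENNReal.ofReal (2 * θ) := by
          rw [lintegral_add_right _ measurable_const, lintegral_const_mul _ (by fun_prop),
            setLIntegral_const]
          gcongr
          · exact (lintegral_mono_set fun r hr => hr.1).trans (lintegral_rpow_tail_le hM hδ0)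
          · refine (measure_mono (t := Ioc 0 (2 * θ)) fun r hr => ⟨?_, hr.2.1⟩).trans
              (by rw [Real.volume_Ioc, sub_zero])
            have : 2 * M < r := hr.1
            show 0 < r
            linarith
      _ = _ := by
          rw [← ENNReal.ofReal_mul hb₁0, ← ENNReal.ofReal_mul hb₂0,
            ← ENNReal.ofReal_add (by positivity) (by positivity)]
  · have e1 : θ * (θ ^ (-p') * (2 * θ) ^ ((n : ℝ) - p'))
        = 2 ^ ((n : ℝ) - p') * θ ^ (n + 1 - 2 * p') := by
      rw [Real.mul_rpow two_pos.le hθ0.le]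
      nth_rewrite 1 [← Real.rpow_one θ]
      rw [mul_left_comm (θ ^ (-p')), mul_left_comm (θ ^ (1 : ℝ)), ← Real.rpow_add hθ0,
        ← Real.rpow_add hθ0]
      ring_nf
    have e2 : θ * θ ^ (-p') = θ ^ (1 - p') := by
      nth_rewrite 1 [← Real.rpow_one θ]
      rw [← Real.rpow_add hθ0]
      ring_nf
    have e3 : θ * (θ ^ (-(2 * p')) * (2 * θ) ^ (n - 1) * (2 * θ))
        = 2 ^ n * θ ^ (n + 1 - 2 * p') := by
      have h : (2 * θ) ^ (n - 1) * (2 * θ) = 2 ^ n * θ ^ (n : ℝ) := by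
        rw [← pow_succ, Nat.sub_add_cancel (by omega), mul_pow, Real.rpow_natCast]
      rw [mul_assoc (θ ^ (-(2 * p'))), h]
      nth_rewrite 1 [← Real.rpow_one θ]
      rw [mul_left_comm (θ ^ (-(2 * p'))), mul_left_comm (θ ^ (1 : ℝ)), ← Real.rpow_add hθ0,
        ← Real.rpow_add hθ0]
      ring_nf
    set x := θ ^ (n + 1 - 2 * p') with hx
    set y := θ ^ (1 - p') with hy
    have hx0 : 0 < x := by positivity
    have hy0 : 0 < y := by positivity
    set A := (2 * M) ^ ((n : ℝ) - p') with hA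
    set A' := (2 : ℝ) ^ ((n : ℝ) - p') with hA'
    have hA0 : 0 < A := by positivity
    have hA'0 : 0 < A' := by positivity
    have e4 : θ * (b₁ * c₁ + b₂ * (2 * θ)) = c₂ * (c₁ * (A * y + A' * x) + 2 ^ n * x) := by
      rw [hb₁, hb₂]
      linear_combination c₂ * c₁ * A * e2 + c₂ * c₁ * e1 + c₂ * e3
    rw [e4, mul_assoc, mul_assoc]
    have : A * y + A' * x ≤ (A + A') * (x + y) := by nlinarith [mul_pos hA0 hx0, mul_pos hA'0 hy0]
    have h2 : (2 : ℝ) ^ n * x ≤ 2 ^ n * (x + y) := by gcongr; linarith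
    gcongr
    calc c₁ * (A * y + A' * x) + 2 ^ n * x ≤ c₁ * ((A + A') * (x + y)) + 2 ^ n * (x + y) := by
          gcongr
      _ = _ := by ring

/-- The dual integral of the test function built from the mode with exponent `1`. The exponential
confines it to a layer of bounded width along the boundary of the cone, so that only one of the two
variables contributes a power of `θ`. -/
theorem exists_lintegral_exp_le {n : ℕ} (hn : 3 ≤ n) {M R : ℝ} (hM : 0 < M) (hR : 0 < R)
    {ν p' K : ℝ} (hp' : 1 < p') (hK : 0 < K) :
    ∃ C > (0 : ℝ), ∀ T θ : ℝ, timeScale M R ≤ θ →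
      ∫⁻ z in transition n M R T θ,
        ENNReal.ofReal (K * (‖z.2‖ ^ (-ν) * Real.exp (tortoise M ‖z.2‖ - z.1) / θ)) ^ p'
      ≤ ENNReal.ofReal (C * θ ^ (n - p' - ν * p')) := by
  obtain ⟨c, hc, hlint⟩ := exists_lintegral_transition_le hn hM hR
  set e := (n : ℝ) - 1 - ν * p' with he
  obtain ⟨c₁, hc₁, hr₁⟩ := exists_rpow_le_mul_exp hM e (by linarith : 0 < p' / 2)
  set c₂ := K ^ p' * c₁ * Real.exp (p' * R) with hc₂
  have hc₂0 : 0 < c₂ := by positivity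
  refine ⟨c * (c₂ * ((1 / 8) ^ e + 2 ^ e) * (2 / p')), by positivity, fun T θ hθ => ?_⟩
  have hθ4 := (four_le_timeScale hM hR).trans hθ
  have hθ0 : 0 < θ := by linarith
  have hmeas := measurable_tortoise (M := M)
  set b := c₂ * ((θ / 8) ^ e + (2 * θ) ^ e) * θ ^ (-p') with hb
  have hb0 : 0 < b := by positivity
  refine (hlint T θ hθ (fun t r => ENNReal.ofReal
    (K * (r ^ (-ν) * Real.exp (tortoise M r - t) / θ)) ^ p')
    (by unfold Function.uncurry; fun_prop) (b * (2 / p')) (by positivity) ?_).trans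
    (ENNReal.ofReal_le_ofReal (le_of_eq ?_))
  · intro t ht
    have hRθ : R ≤ θ := by
      unfold timeScale at hθ
      have := sq_nonneg M
      linarith
    calc ∫⁻ r in {r | 2 * M < r ∧ r ≤ 2 * θ ∧ tortoise M r ≤ t + R}, ENNReal.ofReal (r ^ (n - 1))
          * ENNReal.ofReal (K * (r ^ (-ν) * Real.exp (tortoise M r - t) / θ)) ^ p'
        ≤ ∫⁻ r in {r | 2 * M < r ∧ r ≤ 2 * θ ∧ tortoise M r ≤ t + R},
          ENNReal.ofReal b
            * ENNReal.ofReal (Real.exp (-(p' / 2 * (t + R - tortoise M r)))) := by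
          refine setLIntegral_mono' measurableSet_cone fun r hr => ?_
          obtain ⟨hr1, hr2, hr3⟩ := hr
          have hr0 : 0 < r := by linarith
          rw [ENNReal.ofReal_rpow_of_nonneg (by positivity) (by linarith),
            ← ENNReal.ofReal_mul (by positivity), ← ENNReal.ofReal_mul hb0.le]
          refine ENNReal.ofReal_le_ofReal ?_
          have hge : 1 ≤ t + R := by
            unfold timeScale at hθ
            have := sq_nonneg M
            have := ht.1
            linarith
          have h1 := hr₁ r (t + R) hr1 hge hr3
          have h2 := rpow_le_rpow_add_rpow (by positivity : 0 < θ / 8)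
            (by linarith [ht.1] : θ / 8 ≤ t + R) (by linarith [ht.2] : t + R ≤ 2 * θ) e
          have h3 : (K * (r ^ (-ν) * Real.exp (tortoise M r - t) / θ)) ^ p'
              = K ^ p' * (r ^ (-(ν * p')) * Real.exp (p' * (tortoise M r - t)) * θ ^ (-p')) := by
            rw [Real.mul_rpow hK.le (by positivity), Real.div_rpow (by positivity) hθ0.le,
              Real.mul_rpow (by positivity) (by positivity), ← Real.rpow_mul hr0.le,
              ← Real.exp_mul, Real.rpow_neg hθ0.le, div_eq_mul_inv, neg_mul,
              mul_comm p']
          have h4 : r ^ (n - 1) * r ^ (-(ν * p')) = r ^ e := by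
            rw [← Real.rpow_natCast, ← Real.rpow_add hr0, Nat.cast_sub (by omega)]
            congr 1
            rw [he]
            push_cast
            ring
          have h5 : Real.exp (p' / 2 * (t + R - tortoise M r)) * Real.exp (p' * (tortoise M r - t))
              = Real.exp (p' * R) * Real.exp (-(p' / 2 * (t + R - tortoise M r))) := by
            rw [← Real.exp_add, ← Real.exp_add]
            ring_nf
          rw [h3]
          calc r ^ (n - 1) * (K ^ p' * (r ^ (-(ν * p')) * Real.exp (p' * (tortoise M r - t))
                * θ ^ (-p')))
              = K ^ p' * r ^ e * Real.exp (p' * (tortoise M r - t)) * θ ^ (-p') := by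
                rw [← h4]; ring
            _ ≤ K ^ p' * (c₁ * (((θ / 8) ^ e + (2 * θ) ^ e)
                  * Real.exp (p' / 2 * (t + R - tortoise M r))))
                * Real.exp (p' * (tortoise M r - t)) * θ ^ (-p') := by
                have h6 := h1.trans (mul_le_mul_of_nonneg_left
                  (mul_le_mul_of_nonneg_right h2 (Real.exp_pos _).le) hc₁.le)
                gcongr
            _ = _ := by rw [hb, hc₂]; linear_combination K ^ p' * c₁
                          * ((θ / 8) ^ e + (2 * θ) ^ e) * θ ^ (-p') * h5
      _ ≤ ENNReal.ofReal b * ENNReal.ofReal (1 / (p' / 2)) := by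
          rw [lintegral_const_mul _ (by fun_prop)]
          gcongr
          exact (lintegral_mono_set (t := {r | 2 * M < r ∧ tortoise M r ≤ t + R})
            fun r hr => ⟨hr.1, hr.2.2⟩).trans (lintegral_exp_tortoise_le hM (by linarith))
      _ = _ := by
          rw [← ENNReal.ofReal_mul hb0.le]
          congr 1
          field_simp
  · have e1 : θ * (θ ^ e * θ ^ (-p')) = θ ^ (n - p' - ν * p') := by
      nth_rewrite 1 [← Real.rpow_one θ]
      rw [← Real.rpow_add hθ0, ← Real.rpow_add hθ0]
      rw [he]
      ring_nf
    rw [hb, ← e1, div_eq_mul_one_div θ 8, Real.mul_rpow hθ0.le (by norm_num),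
      Real.mul_rpow two_pos.le hθ0.le]
    ring

/-- The dual integral of the dyadic superposition. The power `-1 / p'` is the one for which the
`p'`-th power decays like the inverse distance to the boundary of the cone; integrating it across
the cone produces the logarithm. -/
theorem exists_lintegral_log_le {n : ℕ} (hn : 3 ≤ n) {M R : ℝ} (hM : 0 < M) (hR : 0 < R)
    {ν p' K : ℝ} (hp' : 1 < p') (hK : 0 < K) :
    ∃ C > (0 : ℝ), ∀ T θ : ℝ, timeScale M R ≤ θ →
      ∫⁻ z in transition n M R T θ,
        ENNReal.ofReal
          (K * (θ ^ (-ν - 1) * (1 + (z.1 + R - tortoise M ‖z.2‖)) ^ (-(1 / p')))) ^ p'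
      ≤ ENNReal.ofReal (C * (θ ^ (n - (ν + 1) * p') * Real.log θ)) := by
  obtain ⟨c, hc, hlint⟩ := exists_lintegral_transition_le hn hM hR
  set c₂ := K ^ p' with hc₂
  have hc₂0 : 0 < c₂ := by positivity
  refine ⟨c * (c₂ * 2 ^ (n - 1) * 4), by positivity, fun T θ hθ => ?_⟩
  have hθ4 := (four_le_timeScale hM hR).trans hθ
  have hθ0 : 0 < θ := by linarith
  have hlog : 1 ≤ Real.log θ := by
    rw [Real.le_log_iff_exp_le hθ0]
    linarith [Real.exp_one_lt_d9]
  have hmeas := measurable_tortoise (M := M)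
  set b := c₂ * (θ ^ (-((ν + 1) * p')) * (2 * θ) ^ (n - 1)) with hb
  have hb0 : 0 < b := by positivity
  refine (hlint T θ hθ (fun t r => ENNReal.ofReal
    (K * (θ ^ (-ν - 1) * (1 + (t + R - tortoise M r)) ^ (-(1 / p')))) ^ p')
    (by unfold Function.uncurry; fun_prop) (b * (4 * Real.log θ)) (by positivity) ?_).trans
    (ENNReal.ofReal_le_ofReal (le_of_eq ?_))
  · intro t ht
    have hRθ : R ≤ θ := by
      unfold timeScale at hθ
      have := sq_nonneg M
      linarith
    calc ∫⁻ r in {r | 2 * M < r ∧ r ≤ 2 * θ ∧ tortoise M r ≤ t + R}, ENNReal.ofReal (r ^ (n - 1))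
          * ENNReal.ofReal
            (K * (θ ^ (-ν - 1) * (1 + (t + R - tortoise M r)) ^ (-(1 / p')))) ^ p'
        ≤ ∫⁻ r in {r | 2 * M < r ∧ r ≤ 2 * θ ∧ tortoise M r ≤ t + R},
          ENNReal.ofReal b * ENNReal.ofReal ((1 + (t + R - tortoise M r))⁻¹) := by
          refine setLIntegral_mono' measurableSet_cone fun r hr => ?_
          obtain ⟨hr1, hr2, hr3⟩ := hr
          have hr0 : 0 < r := by linarith
          have hX : 0 < 1 + (t + R - tortoise M r) := by linarith
          rw [ENNReal.ofReal_rpow_of_nonneg (by positivity) (by linarith),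
            ← ENNReal.ofReal_mul (by positivity), ← ENNReal.ofReal_mul hb0.le]
          refine ENNReal.ofReal_le_ofReal ?_
          have h3 : (K * (θ ^ (-ν - 1) * (1 + (t + R - tortoise M r)) ^ (-(1 / p')))) ^ p'
              = c₂ * (θ ^ (-((ν + 1) * p')) * (1 + (t + R - tortoise M r))⁻¹) := by
            rw [Real.mul_rpow hK.le (by positivity), Real.mul_rpow (by positivity) (by positivity),
              ← Real.rpow_mul hθ0.le, ← Real.rpow_mul hX.le, ← Real.rpow_neg_one]
            congr 3
            · ring
            · field_simp
          rw [h3, hb]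
          calc r ^ (n - 1) * (c₂ * (θ ^ (-((ν + 1) * p')) * (1 + (t + R - tortoise M r))⁻¹))
              ≤ (2 * θ) ^ (n - 1)
                * (c₂ * (θ ^ (-((ν + 1) * p')) * (1 + (t + R - tortoise M r))⁻¹)) := by gcongr
            _ = _ := by ring
      _ ≤ ENNReal.ofReal b * ENNReal.ofReal (4 * Real.log θ) := by
          rw [lintegral_const_mul _ (by fun_prop)]
          gcongr
          refine ((lintegral_mono_set (t := {r | 2 * M < r ∧ tortoise M r ≤ t + R}) fun r hr => ⟨hr.1, hr.2.2⟩).trans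
            (lintegral_inv_tortoise_le hM (by linarith [ht.1]))).trans
            (ENNReal.ofReal_le_ofReal ?_)
          have h1 : Real.log (1 + (t + R)) ≤ Real.log (θ * θ) :=
            Real.log_le_log (by linarith [ht.1]) (by nlinarith [ht.2])
          rw [Real.log_mul hθ0.ne' hθ0.ne'] at h1
          linarith
      _ = _ := by rw [← ENNReal.ofReal_mul hb0.le]
  · have e1 : θ * (θ ^ (-((ν + 1) * p')) * θ ^ (n - 1)) = θ ^ (n - (ν + 1) * p') := by
      nth_rewrite 1 [← Real.rpow_one θ]
      rw [← Real.rpow_natCast, ← Real.rpow_add hθ0, ← Real.rpow_add hθ0, Nat.cast_sub (by omega)]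
      push_cast
      ring_nf
    rw [hb, mul_pow, ← e1]
    ring

/-! ### The static mode and the mode with rate one -/

/-- The standing assumptions on the coefficients and the data. The decay rates `β`, `γ` are
normalised to be close to the critical ones; larger rates give stronger assumptions. -/
structure IsSetting (n : ℕ) (M : ℝ) (D V : ℝ → ℝ) (β γ μ₁ μ₂ : ℝ)
    (u₀ u₁ : EuclideanSpace ℝ (Fin n) → ℝ) (R₁ R : ℝ) : Prop where
  dim : 3 ≤ n
  mass : 0 < M
  contD : ContinuousOn D (Ioi (2 * M))
  contV : ContinuousOn V (Ioi (2 * M))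
  one_lt_β : 1 < β
  β_le : β ≤ 2
  two_lt_γ : 2 < γ
  γ_le : γ ≤ 5 / 2
  μ₁_nonneg : 0 ≤ μ₁
  μ₂_nonneg : 0 ≤ μ₂
  boundD : ∀ r, 2 * M < r → 0 ≤ D r ∧ D r ≤ μ₁ * r ^ (-β)
  boundV : ∀ r, 2 * M < r → 0 ≤ V r ∧ V r ≤ μ₂ * r ^ (-γ)
  int₀ : IntegrableOn u₀ (exterior n M)
  int₁ : IntegrableOn u₁ (exterior n M)
  nonneg₀ : ∀ x ∈ exterior n M, 0 ≤ u₀ x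
  nonneg₁ : ∀ x ∈ exterior n M, 0 ≤ u₁ x
  integral_pos : 0 < ∫ x in exterior n M, (u₀ x + u₁ x)
  R₁_pos : 0 < R₁
  R_pos : 0 < R
  supp₁ : ∀ x ∈ exterior n M, (u₀ x ≠ 0 ∨ u₁ x ≠ 0) → 2 * M + R₁ ≤ ‖x‖
  supp : ∀ x ∈ exterior n M, (u₀ x ≠ 0 ∨ u₁ x ≠ 0) → |tortoise M ‖x‖| ≤ R

theorem exists_radial_range {M : ℝ} (hM : 0 < M) {τ : ℝ} (hτ : 0 ≤ τ) :
    ∃ a a' b' b : ℝ, 2 * M < a ∧ a ≤ 4 * M ∧ a < a' ∧ b' < b ∧ a < b ∧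
      ∀ r, 2 * M < r → |tortoise M r| ≤ τ → r ∈ Ioo a' b' := by
  set e := Real.exp (-(τ + 2 * M + 1) / (2 * M)) with he
  have he0 : 0 < e := Real.exp_pos _
  have he1 : e < 1 := by
    rw [he, Real.exp_lt_one_iff]
    exact div_neg_of_neg_of_pos (by linarith) (by linarith)
  refine ⟨2 * M + min (e / 4) M, 2 * M + e / 2, τ + 2 * M + 2, τ + 2 * M + 3, ?_, ?_, ?_, ?_, ?_,
    fun r hr h => ⟨?_, ?_⟩⟩
  · have : 0 < min (e / 4) M := lt_min (by positivity) hM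
    linarith
  · linarith [min_le_right (e / 4) M]
  · linarith [min_le_left (e / 4) M]
  · linarith
  · linarith [min_le_left (e / 4) M]
  · by_contra hc
    push Not at hc
    have h1 := (abs_le.1 h).1
    have h2 : Real.log (r - 2 * M) ≤ Real.log e :=
      Real.log_le_log (by linarith) (by linarith)
    have h3 : Real.log (r - 2 * M) < Real.log e :=
      Real.log_lt_log (by linarith) (by linarith)
    rw [he, Real.log_exp, lt_div_iff₀ (by positivity)] at h3
    unfold tortoise at h1
    linarith
  · linarith [le_of_tortoise_le hM hτ (abs_le.1 h).2]

theorem waveSum_singleton (w l : ℝ) (φ : ℝ → ℝ) (t r : ℝ) :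
    waveSum {()} (fun _ => w) (fun _ => l) (fun _ => φ) t r = w * (Real.exp (-(l * t)) * φ r) := by
  simp [waveSum]

/-- `X ≤ X ^ (1/p) * Y ^ (1/p')` forces `X ≤ Y` when `X` is finite. -/
theorem le_of_le_rpow_mul_rpow {p p' : ℝ} (hpp' : p.HolderConjugate p') {X Y : ℝ≥0∞}
    (hX : X ≠ ∞) (h : X ≤ X ^ (1 / p) * Y ^ (1 / p')) : X ≤ Y := by
  have hp := hpp'.pos
  have hp' := hpp'.symm.pos
  rcases eq_or_ne X 0 with h0 | h0
  · simp [h0]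
  have h1 : X = X ^ (1 / p) * X ^ (1 / p') := by
    rw [← ENNReal.rpow_add _ _ h0 hX]
    have := hpp'.inv_add_inv_eq_one
    rw [one_div, one_div, this, ENNReal.rpow_one]
  have h2 : X ^ (1 / p) * X ^ (1 / p') ≤ X ^ (1 / p) * Y ^ (1 / p') := h1 ▸ h
  rw [ENNReal.mul_le_mul_iff_right (by simp [h0, hX]) (by simp [h0, hX])] at h2
  exact (ENNReal.rpow_le_rpow_iff (by positivity)).1 h2

section Setting

variable {n : ℕ} {M : ℝ} {D V : ℝ → ℝ} {β γ μ₁ μ₂ : ℝ} {u₀ u₁ : EuclideanSpace ℝ (Fin n) → ℝ}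
  {R₁ R p p' Cη : ℝ} {η η₁ η₂ : ℝ → ℝ}

/-- Upper bound: testing with the static mode. -/
theorem IsSetting.exists_upper_bound (h : IsSetting n M D V β γ μ₁ μ₂ u₀ u₁ R₁ R)
    (hpp' : p.HolderConjugate p') (hη : IsTimeCutoff p Cη η η₁ η₂) (hCη : 0 < Cη) :
    ∃ C > (0 : ℝ), ∀ ε : ℝ, 0 < ε → ∀ T u, IsWeakSolution n M D V p (ε • u₀) (ε • u₁) T u →
      FiniteSpeed n M R T u → ∀ θ, timeScale M R ≤ θ → 2 * delay M (2 * M + R₁) < θ → θ < T →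
      ∫⁻ z in Ioo 0 T ×ˢ exterior n M,
        ENNReal.ofReal (|u z| ^ p * η ((z.1 + delay M ‖z.2‖) / θ))
      ≤ ENNReal.ofReal (C * (θ ^ (n + 1 - 2 * p') + θ ^ (1 - p'))) := by
  have hM := h.mass
  have hn := h.dim
  have hν := one_le_decayRate hn
  obtain ⟨C₀, hC₀, hmode₀⟩ := exists_mode_zero_bound hn hM h.two_lt_γ h.γ_le h.μ₂_nonneg
    (fun r hr => (h.boundD r hr).1) h.boundV
  set K₀ := Cη * (4 + (8 * M ^ 2 * C₀ + 4 * M * (decayRate n - 1)) * (2 * M) ^ (β - 2) + μ₁)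
    with hK₀
  have hμ := h.μ₁_nonneg
  have hK₀0 : 0 < K₀ := by
    have : 0 ≤ decayRate n - 1 := by linarith
    positivity
  obtain ⟨C, hC, hbound⟩ := exists_lintegral_static_le hn hM h.R_pos h.one_lt_β hpp'.symm.lt
    (by positivity : 0 < K₀ * C₀)
  refine ⟨C, hC, fun ε hε T u hu hs θ hθ hθ₁ hθT => ?_⟩
  have hθ0 : 0 < θ := by linarith [four_le_timeScale hM h.R_pos]
  have hRp := h.R_pos
  obtain ⟨a, a', b', b, ha2, ha4, ha, hb, hab, hrange⟩ := exists_radial_range hM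
    (by linarith : 0 ≤ T + R)
  obtain ⟨φ, φ', hφ⟩ := exists_isMode hn hM h.contD h.contV (fun r hr => (h.boundD r hr).1)
    (fun r hr => (h.boundV r hr).1) ha2 hab le_rfl
  have hφb := hmode₀ a b φ φ' ha2 hab hφ
  have hdata : ∀ x ∈ exterior n M, ((ε • u₀) x ≠ 0 ∨ (ε • u₁) x ≠ 0) → u₀ x ≠ 0 ∨ u₁ x ≠ 0 := by
    intro x _ hx
    simpa [hε.ne'] using hx
  obtain ⟨hfin, -, hle⟩ := hu.lintegral_le hn hM h.contD h.contV h.β_le h.boundD hpp' h.R₁_pos hs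
    (fun x hx => smul_nonneg hε.le (h.nonneg₀ x hx))
    (fun x hx => smul_nonneg hε.le (h.nonneg₁ x hx))
    (fun x hx hfg => h.supp x hx (hdata x hx hfg)) (fun x hx hfg => h.supp₁ x hx (hdata x hx hfg))
    ha2 ha hb hθ0 hθT hθ₁ hrange (s := {()}) (w := fun _ => 1) (l := fun _ => 0)
    (φ := fun _ => φ) (φ' := fun _ => φ') (fun _ _ => hφ) (fun _ _ => zero_le_one) (fun _ _ => le_rfl)
    (Cm := C₀) (fun _ _ r hr => by simpa using (hφb r hr).2.2) hη
    (G := fun t r => K₀ * C₀ * (r ^ (-β) / θ + 1 / θ ^ 2))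
    (by unfold Function.uncurry; fun_prop) (fun t _ r hr _ _ _ => by
      have hr0 : 0 < r := by linarith [hr.1]
      have h1 := (hφb r (Ioo_subset_Icc_self hr)).2.1
      simp only [waveSum_singleton]
      rw [← hK₀, mul_assoc K₀]
      refine mul_le_mul_of_nonneg_left ?_ hK₀0.le
      simp only [mul_zero, zero_mul, neg_zero, Real.exp_zero, one_mul, zero_add]
      calc r ^ (-β) * φ r / θ + φ r / θ ^ 2 ≤ r ^ (-β) * C₀ / θ + C₀ / θ ^ 2 := by gcongr
        _ = _ := by ring)
  simp only [waveSum_singleton, mul_zero, zero_mul, neg_zero, Real.exp_zero, one_mul] at hfin hle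
  set X := ∫⁻ z in Ioo 0 T ×ˢ exterior n M, ENNReal.ofReal (|u z| ^ p
          * (φ ‖z.2‖ * η ((z.1 + delay M ‖z.2‖) / θ))) with hX
  have hWm : MeasurableSet (Ioo 0 T ×ˢ exterior n M) := measurableSet_Ioo.prod measurableSet_exterior
  have hXle : ∫⁻ z in Ioo 0 T ×ˢ exterior n M,
        ENNReal.ofReal (|u z| ^ p * η ((z.1 + delay M ‖z.2‖) / θ)) ≤ X := by
    refine lintegral_mono_ae ?_
    filter_upwards [ae_restrict_mem hWm, hs] with z hz hsz
    refine ENNReal.ofReal_le_ofReal ?_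
    by_cases huz : u z = 0
    · simp [huz, Real.zero_rpow hpp'.ne_zero]
    have hr := hrange ‖z.2‖ hz.2 ((hsz huz).trans (by linarith [hz.1.2]))
    have h1 := (hφb ‖z.2‖ ⟨(ha.trans hr.1).le, (hr.2.trans hb).le⟩).1
    have h2 := hη.nonneg ((z.1 + delay M ‖z.2‖) / θ)
    gcongr
    exact le_mul_of_one_le_left h2 h1
  have htr : transition n M R T θ ⊆ Ioo 0 T ×ˢ exterior n M := fun z hz => hz.1
  refine hXle.trans ((le_of_le_rpow_mul_rpow hpp' hfin ?_).trans (hbound T θ hθ))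
  refine (le_add_self.trans hle).trans ?_
  gcongr
  · exact one_div_nonneg.2 hpp'.nonneg
  · exact (lintegral_mono_set htr).trans hXle

theorem IsSetting.data_integral_ge (h : IsSetting n M D V β γ μ₁ μ₂ u₀ u₁ R₁ R) {ε : ℝ} (hε : 0 < ε)
    {a a' b' b : ℝ} (ha2 : 2 * M < a) (ha : a < a') (hb : b' < b)
    (hrange : ∀ r, 2 * M < r → |tortoise M r| ≤ R → r ∈ Ioo a' b') {φ : ℝ → ℝ}
    (hφ : ContinuousOn φ (Icc a b)) {c : ℝ} (hc : 0 ≤ c)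
    (hφc : ∀ r ∈ Icc a b, |tortoise M r| ≤ R → c ≤ φ r) :
    c * ε * ∫ x in exterior n M, (u₀ x + u₁ x)
      ≤ ∫ x in exterior n M, ((F M ‖x‖)⁻¹ * (ε • u₁) x * φ ‖x‖ + D ‖x‖ * (ε • u₀) x * φ ‖x‖
          + (F M ‖x‖)⁻¹ * (ε • u₀) x * φ ‖x‖) := by
  have hM := h.mass
  set N : Set (EuclideanSpace ℝ (Fin n)) := {x | a' ≤ ‖x‖ ∧ ‖x‖ ≤ b'} with hN
  have hNc : IsCompact N := by
    refine Metric.isCompact_of_isClosed_isBounded ?_ ?_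
    · exact (isClosed_le continuous_const continuous_norm).inter
        (isClosed_le continuous_norm continuous_const)
    · exact (Metric.isBounded_closedBall (x := (0 : EuclideanSpace ℝ (Fin n))) (r := b')).subset
        fun x hx => by simpa using hx.2
  have hNs : N ⊆ exterior n M := fun x hx => (ha2.trans ha).trans_le hx.1
  have hmap : MapsTo (fun x : EuclideanSpace ℝ (Fin n) => ‖x‖) N (Icc a b) := fun x hx =>
    ⟨ha.le.trans hx.1, hx.2.trans hb.le⟩
  have hIcc : ∀ r ∈ Icc a b, 2 * M < r := fun r hr => ha2.trans_le hr.1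
  have hmem : ∀ x ∈ exterior n M, (u₀ x ≠ 0 ∨ u₁ x ≠ 0) → x ∈ N := fun x hx hfg => by
    have := hrange ‖x‖ hx (h.supp x hx hfg)
    exact ⟨this.1.le, this.2.le⟩
  have hFc : ContinuousOn (fun r => (F M r)⁻¹) (Icc a b) :=
    (continuousOn_F.mono fun r hr => show r ≠ 0 by linarith [hIcc r hr]).inv₀
      fun r hr => (F_pos hM (hIcc r hr)).ne'
  have hint : ∀ (k : ℝ → ℝ) (f : EuclideanSpace ℝ (Fin n) → ℝ), ContinuousOn k (Icc a b) →
      IntegrableOn f (exterior n M) → (∀ x, x ∈ exterior n M → f x ≠ 0 → x ∈ N) →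
      IntegrableOn (fun x => f x * k ‖x‖) (exterior n M) := by
    intro k f hk hf hfN
    have h1 := (hf.mono_set hNs).mul_continuousOn
      (hk.comp continuous_norm.continuousOn hmap) hNc
    refine h1.of_ae_sdiff_eq_zero measurableSet_exterior.nullMeasurableSet
      (Filter.Eventually.of_forall fun x hx => ?_)
    have : f x = 0 := by
      by_contra hne
      exact hx.2 (hfN x hx.1 hne)
    simp [this]
  have i1 := hint (fun r => (F M r)⁻¹ * φ r) u₁ (hFc.mul hφ) h.int₁
    fun x hx hne => hmem x hx (Or.inr hne)
  have i2 := hint (fun r => D r * φ r) u₀ ((h.contD.mono hIcc).mul hφ) h.int₀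
    fun x hx hne => hmem x hx (Or.inl hne)
  have i3 := hint (fun r => (F M r)⁻¹ * φ r) u₀ (hFc.mul hφ) h.int₀
    fun x hx hne => hmem x hx (Or.inl hne)
  rw [← integral_const_mul]
  refine setIntegral_mono_on ((h.int₀.add h.int₁).const_mul _) ?_ measurableSet_exterior
    fun x hx => ?_
  · have := ((i1.add i2).add i3).const_mul ε
    refine this.congr (Filter.Eventually.of_forall fun x => ?_)
    simp only [Pi.add_apply, Pi.smul_apply, smul_eq_mul]
    ring
  · by_cases hfg : u₀ x ≠ 0 ∨ u₁ x ≠ 0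
    · have hr := hmap (hmem x hx hfg)
      have h1 := hφc ‖x‖ hr (h.supp x hx hfg)
      have h2 := F_pos hM hx
      have h3 := (one_le_inv₀ h2).2 (F_lt_one hM hx).le
      have h4 := h.nonneg₀ x hx
      have h5 := h.nonneg₁ x hx
      have h6 := (h.boundD ‖x‖ hx).1
      have h7 : 0 ≤ D ‖x‖ * (ε • u₀) x * φ ‖x‖ :=
        mul_nonneg (mul_nonneg h6 (mul_nonneg hε.le h4)) (hc.trans h1)
      have h8 : c ≤ (F M ‖x‖)⁻¹ * φ ‖x‖ := h1.trans (le_mul_of_one_le_left (hc.trans h1) h3)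
      have h9 : c * (ε * (u₀ x + u₁ x)) ≤ (F M ‖x‖)⁻¹ * φ ‖x‖ * (ε * (u₀ x + u₁ x)) := by gcongr
      simp only [Pi.smul_apply, smul_eq_mul] at h7 ⊢
      linarith
    · push Not at hfg
      simp [hfg.1, hfg.2]

/-- Lower bound: testing with the mode of rate one, which sees the data. -/
theorem IsSetting.exists_lower_bound (h : IsSetting n M D V β γ μ₁ μ₂ u₀ u₁ R₁ R)
    (hpp' : p.HolderConjugate p') (hη : IsTimeCutoff p Cη η η₁ η₂) (hCη : 0 < Cη) :
    ∃ c > (0 : ℝ), ∀ ε : ℝ, 0 < ε → ∀ T u, IsWeakSolution n M D V p (ε • u₀) (ε • u₁) T u →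
      FiniteSpeed n M R T u → ∀ θ, timeScale M R ≤ θ → 2 * delay M (2 * M + R₁) < θ → θ < T →
      ENNReal.ofReal (c * (ε ^ p * θ ^ (n - decayRate n * p))) ≤
      ∫⁻ z in transition n M R T θ,
        ENNReal.ofReal (|u z| ^ p * η ((z.1 + delay M ‖z.2‖) / θ)) := by
  have hM := h.mass
  have hn := h.dim
  have hRp := h.R_pos
  have hν := one_le_decayRate hn
  have hp := hpp'.lt
  obtain ⟨C₀, hC₀, hmode₀⟩ := exists_mode_one_bound hn hM h.one_lt_β h.β_le h.two_lt_γ h.μ₁_nonneg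
    h.μ₂_nonneg h.boundD h.boundV
  obtain ⟨c₀, hc₀, hlow⟩ := exists_mode_lower_bound (D := D) (V := V) hn hM
    (fun r hr => (h.boundD r hr).1) (fun r hr => (h.boundV r hr).1)
  set K₀ := Cη * (4 + (8 * M ^ 2 * C₀ + 4 * M * (decayRate n - 1)) * (2 * M) ^ (β - 2) + μ₁)
    with hK₀
  have hμ := h.μ₁_nonneg
  have hK₀0 : 0 < K₀ := by
    have : 0 ≤ decayRate n - 1 := by linarith
    positivity
  obtain ⟨C, hC, hbound⟩ := exists_lintegral_exp_le hn hM h.R_pos (ν := decayRate n) hpp'.symm.lt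
    (by positivity : 0 < K₀ * (2 + (2 * M) ^ (-β)) * C₀)
  set I₀ := ∫ x in exterior n M, (u₀ x + u₁ x) with hI₀
  have hI₀0 : 0 < I₀ := h.integral_pos
  set c₁ := c₀ * Real.exp (-R) with hc₁
  have hc₁0 : 0 < c₁ := by positivity
  refine ⟨(c₁ * I₀) ^ p * C ^ (-(p / p')), by positivity, fun ε hε T u hu hs θ hθ hθ₁ hθT => ?_⟩
  have hθ4 : 4 ≤ θ := (four_le_timeScale hM h.R_pos).trans hθ
  have hθ0 : 0 < θ := by linarith
  obtain ⟨a, a', b', b, ha2, ha4, ha, hb, hab, hrange⟩ := exists_radial_range hM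
    (by linarith : 0 ≤ T + R)
  obtain ⟨φ, φ', hφ⟩ := exists_isMode hn hM h.contD h.contV (fun r hr => (h.boundD r hr).1)
    (fun r hr => (h.boundV r hr).1) ha2 hab zero_le_one
  have hφb := hmode₀ a b φ φ' ha2 ha4 hab hφ
  have hdata : ∀ x ∈ exterior n M, ((ε • u₀) x ≠ 0 ∨ (ε • u₁) x ≠ 0) → u₀ x ≠ 0 ∨ u₁ x ≠ 0 := by
    intro x _ hx
    simpa [hε.ne'] using hx
  obtain ⟨-, -, hle⟩ := hu.lintegral_le hn hM h.contD h.contV h.β_le h.boundD hpp' h.R₁_pos hs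
    (fun x hx => smul_nonneg hε.le (h.nonneg₀ x hx))
    (fun x hx => smul_nonneg hε.le (h.nonneg₁ x hx))
    (fun x hx hfg => h.supp x hx (hdata x hx hfg)) (fun x hx hfg => h.supp₁ x hx (hdata x hx hfg))
    ha2 ha hb hθ0 hθT hθ₁ hrange (s := {()}) (w := fun _ => 1) (l := fun _ => 1)
    (φ := fun _ => φ) (φ' := fun _ => φ') (fun _ _ => hφ) (fun _ _ => zero_le_one)
    (fun _ _ => zero_le_one) (Cm := C₀) (fun _ _ r hr => (hφb r hr).2) hη
    (G := fun t r => K₀ * (2 + (2 * M) ^ (-β)) * C₀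
      * (r ^ (-decayRate n) * Real.exp (tortoise M r - t) / θ))
    (by
      have := measurable_tortoise (M := M)
      unfold Function.uncurry
      fun_prop) (fun t _ r hr _ _ _ => by
      have hr2 : 2 * M < r := by linarith [hr.1]
      have hr0 : 0 < r := by linarith
      have h1 := (hφb r (Ioo_subset_Icc_self hr)).1
      have h0 := hφ.pos r (Ioo_subset_Icc_self hr)
      simp only [waveSum_singleton]
      rw [← hK₀, mul_assoc K₀, mul_assoc K₀]
      refine mul_le_mul_of_nonneg_left ?_ hK₀0.le
      simp only [one_mul]
      set W := Real.exp (-t) * φ r with hW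
      have hW0 : 0 < W := by positivity
      have hWle : W ≤ C₀ * (r ^ (-decayRate n) * Real.exp (tortoise M r - t)) := by
        rw [sub_eq_add_neg, Real.exp_add, hW]
        calc Real.exp (-t) * φ r
            ≤ Real.exp (-t) * (C₀ * (r ^ (-decayRate n) * Real.exp (tortoise M r))) := by gcongr
          _ = _ := by ring
      have h2 : r ^ (-β) ≤ (2 * M) ^ (-β) :=
        Real.rpow_le_rpow_of_nonpos (by positivity) hr2.le (by linarith [h.one_lt_β])
      have h3 : W / θ ^ 2 ≤ W / θ := by
        refine div_le_div_of_nonneg_left hW0.le hθ0 ?_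
        nlinarith
      calc (W + r ^ (-β) * W) / θ + W / θ ^ 2
          ≤ (W + (2 * M) ^ (-β) * W) / θ + W / θ := by gcongr
        _ = (2 + (2 * M) ^ (-β)) * W / θ := by ring
        _ ≤ (2 + (2 * M) ^ (-β)) * (C₀ * (r ^ (-decayRate n) * Real.exp (tortoise M r - t))) / θ := by
          gcongr
        _ = _ := by ring)
  simp only [waveSum_singleton, mul_zero, neg_zero, Real.exp_zero, one_mul] at hle
  have hd := h.data_integral_ge hε ha2 ha hb (fun r hr hr' => hrange r hr (by linarith)) hφ.continuousOn
    hc₁0.le fun r hr hr' => hlow a b 1 φ φ' ha2 ha4 hab zero_le_one le_rfl hφ r hr R h.R_pos.le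
      (by linarith [(abs_le.1 hr').1])
  rw [← hI₀] at hd
  set Y := ∫⁻ z in transition n M R T θ,
        ENNReal.ofReal (|u z| ^ p * η ((z.1 + delay M ‖z.2‖) / θ)) with hY
  have h1 : ENNReal.ofReal (c₁ * ε * I₀) ≤ Y ^ (1 / p)
      * ENNReal.ofReal (C * θ ^ (n - p' - decayRate n * p')) ^ (1 / p') := by
    refine (ENNReal.ofReal_le_ofReal hd).trans ((le_self_add.trans hle).trans ?_)
    gcongr
    · exact one_div_nonneg.2 hpp'.symm.nonneg
    · exact hbound T θ hθ
  have hp0 : 0 < p := by linarith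
  have hp'0 : 0 < p' := hpp'.symm.pos
  have h2 := ENNReal.rpow_le_rpow h1 hp0.le
  rw [ENNReal.mul_rpow_of_nonneg _ _ hp0.le, ← ENNReal.rpow_mul, ← ENNReal.rpow_mul,
    one_div_mul_cancel hp0.ne', ENNReal.rpow_one, ENNReal.ofReal_rpow_of_nonneg (by positivity) hp0.le,
    ENNReal.ofReal_rpow_of_nonneg (by positivity) (by positivity)] at h2
  have hpos : 0 < (C * θ ^ (n - p' - decayRate n * p')) ^ (1 / p' * p) := by positivity
  have h3 : ENNReal.ofReal ((c₁ * ε * I₀) ^ p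
      / (C * θ ^ (n - p' - decayRate n * p')) ^ (1 / p' * p)) ≤ Y := by
    rw [ENNReal.ofReal_div_of_pos hpos]
    exact ENNReal.div_le_of_le_mul h2
  refine le_trans (le_of_eq ?_) h3
  congr 1
  have hsub : p / p' = p - 1 := by
    have := hpp'.inv_add_inv_eq_one
    field_simp at this ⊢
    linarith
  have e1 : (n - p' - decayRate n * p') * (1 / p' * p) = -(n - decayRate n * p) := by
    have h5 : (n - p' - decayRate n * p') * (1 / p' * p)
        = n * (p / p') - p - decayRate n * p := by field_simp
    rw [h5, hsub, decayRate]
    ring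
  rw [Real.mul_rpow hC.le (by positivity), ← Real.rpow_mul hθ0.le, e1,
    show 1 / p' * p = p / p' by ring, Real.rpow_neg hθ0.le, Real.rpow_neg hC.le, show c₁ * ε * I₀ = c₁ * I₀ * ε by ring,
    Real.mul_rpow (by positivity) hε.le]
  field_simp

end Setting

/-! ### The subcritical case -/

theorem lifespan_le {n : ℕ} {M : ℝ} {D V : ℝ → ℝ} {p : ℝ} {f g : EuclideanSpace ℝ (Fin n) → ℝ}
    {R B : ℝ} (h : ∀ T u, IsWeakSolution n M D V p f g T u → FiniteSpeed n M R T u → T ≤ B) :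
    lifespan n M D V p f g R ≤ ENNReal.ofReal B :=
  iSup₂_le fun T hT => by
    obtain ⟨u, hu, hs⟩ := hT
    exact ENNReal.ofReal_le_ofReal (h T u hu hs)

theorem straussGamma_pos {n : ℕ} (hn : 3 ≤ n) {p : ℝ} (hp : 0 < p) (hpS : p < straussExponent n) :
    0 < straussGamma p n := by
  obtain ⟨hq, h0⟩ := (eq_straussExponent_iff n (by omega) _).2 rfl
  have hn' : (3 : ℝ) ≤ n := by exact_mod_cast hn
  set q := straussExponent n
  have h1 : straussGamma p n * q = (q - p) * (2 + ((n : ℝ) - 1) * p * q) := by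
    have : straussGamma p n * q = straussGamma p n * q - straussGamma q n * p := by rw [h0]; ring
    rw [this]
    unfold straussGamma
    ring
  have h2 : 0 < (q - p) * (2 + ((n : ℝ) - 1) * p * q) := by
    have h3 : 0 < q - p := by linarith
    have h4 : 0 < (n : ℝ) - 1 := by linarith
    positivity
  exact pos_of_mul_pos_left (h1 ▸ h2) hq.le

section Setting

variable {n : ℕ} {M : ℝ} {D V : ℝ → ℝ} {β γ μ₁ μ₂ : ℝ} {u₀ u₁ : EuclideanSpace ℝ (Fin n) → ℝ}
  {R₁ R p p' : ℝ}

/-- The two bounds for `|u| ^ p` contradict each other for large `θ` as soon as the power `e` is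
positive, which quantifies the lifespan. -/
theorem IsSetting.exists_lifespan_le (h : IsSetting n M D V β γ μ₁ μ₂ u₀ u₁ R₁ R)
    (hpp' : p.HolderConjugate p') {e : ℝ} (he : 0 < e) (he₁ : e ≤ 2 * p' - 1 - decayRate n * p)
    (he₂ : e ≤ n + p' - 1 - decayRate n * p) :
    ∃ C > (0 : ℝ), ∀ ε : ℝ, 0 < ε →
      lifespan n M D V p (ε • u₀) (ε • u₁) R ≤ ENNReal.ofReal (C * (ε ^ (-(p / e)) + 1)) := by
  obtain ⟨Cη, hCη, η, η₁, η₂, hη⟩ := exists_isTimeCutoff hpp'.lt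
  obtain ⟨C, hC, hup⟩ := h.exists_upper_bound hpp' hη hCη
  obtain ⟨c, hc, hlow⟩ := h.exists_lower_bound hpp' hη hCη
  set θ₀ := max (timeScale M R) (2 * delay M (2 * M + R₁) + 1) with hθ₀
  have hθ₀4 : 4 ≤ θ₀ := (four_le_timeScale h.mass h.R_pos).trans (le_max_left _ _)
  set K := (2 * C / c) ^ (1 / e) with hK
  have hK0 : 0 < K := by positivity
  refine ⟨2 * (K + θ₀), by positivity, fun ε hε => lifespan_le fun T u hu hs => ?_⟩
  have hε0 : 0 < ε ^ (-(p / e)) := by positivity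
  rcases lt_or_ge (T / 2) θ₀ with hT | hT
  · nlinarith [mul_pos hK0 hε0]
  set θ := T / 2 with hθ
  have hθ0 : 0 < θ := by linarith
  have hθs : timeScale M R ≤ θ := (le_max_left _ _).trans hT
  have hθd : 2 * delay M (2 * M + R₁) < θ := by
    have := (le_max_right (timeScale M R) (2 * delay M (2 * M + R₁) + 1)).trans hT
    linarith
  have h1 := (hlow ε hε T u hu hs θ hθs hθd (by linarith)).trans
    ((lintegral_mono_set fun z hz => hz.1).trans (hup ε hε T u hu hs θ hθs hθd (by linarith)))
  have h2 := (ENNReal.ofReal_le_ofReal_iff (by positivity)).1 h1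
  -- comparison of the exponents
  have h3 : θ ^ ((n : ℝ) + 1 - 2 * p') + θ ^ (1 - p')
      ≤ 2 * (θ ^ (-e) * θ ^ (n - decayRate n * p)) := by
    rw [← Real.rpow_add hθ0]
    have a1 : θ ^ ((n : ℝ) + 1 - 2 * p') ≤ θ ^ (-e + (n - decayRate n * p)) :=
      Real.rpow_le_rpow_of_exponent_le (by linarith) (by linarith)
    have a2 : θ ^ (1 - p') ≤ θ ^ (-e + (n - decayRate n * p)) :=
      Real.rpow_le_rpow_of_exponent_le (by linarith) (by linarith)
    linarith
  have hx0 : 0 < θ ^ (n - decayRate n * p) := by positivity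
  have h4 : c * ε ^ p ≤ 2 * C * θ ^ (-e) := by
    have : c * ε ^ p * θ ^ (n - decayRate n * p)
        ≤ 2 * C * θ ^ (-e) * θ ^ (n - decayRate n * p) := by
      calc c * ε ^ p * θ ^ (n - decayRate n * p) = c * (ε ^ p * θ ^ (n - decayRate n * p)) := by ring
        _ ≤ _ := h2
        _ ≤ C * (2 * (θ ^ (-e) * θ ^ (n - decayRate n * p))) := by gcongr
        _ = _ := by ring
    exact le_of_mul_le_mul_right this hx0
  have h5 : θ ^ e ≤ 2 * C / c * ε ^ (-p) := by
    rw [Real.rpow_neg hθ0.le] at h4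
    rw [Real.rpow_neg hε.le]
    have : 0 < θ ^ e := by positivity
    have : 0 < ε ^ p := by positivity
    field_simp at h4 ⊢
    linarith
  have h6 := Real.rpow_le_rpow (by positivity) h5 (by positivity : 0 ≤ 1 / e)
  rw [← Real.rpow_mul hθ0.le, mul_one_div_cancel he.ne', Real.rpow_one,
    Real.mul_rpow (by positivity) (by positivity), ← Real.rpow_mul hε.le, ← hK,
    show -p * (1 / e) = -(p / e) by ring] at h6
  have h7 : T = 2 * θ := by rw [hθ]; ring
  nlinarith

theorem IsSetting.exists_lifespan_le_rpow (h : IsSetting n M D V β γ μ₁ μ₂ u₀ u₁ R₁ R)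
    (hpp' : p.HolderConjugate p') {e : ℝ} (he : 0 < e) (he₁ : e ≤ 2 * p' - 1 - decayRate n * p)
    (he₂ : e ≤ n + p' - 1 - decayRate n * p) :
    (∀ ε : ℝ, 0 < ε → lifespan n M D V p (ε • u₀) (ε • u₁) R < ⊤) ∧
    ∃ C > (0 : ℝ), ∀ ε : ℝ, 0 < ε → ε ≤ 1 →
      lifespan n M D V p (ε • u₀) (ε • u₁) R ≤ ENNReal.ofReal (C * ε ^ (-(p / e))) := by
  obtain ⟨C, hC, hle⟩ := h.exists_lifespan_le hpp' he he₁ he₂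
  refine ⟨fun ε hε => (hle ε hε).trans_lt ENNReal.ofReal_lt_top, 2 * C, by positivity,
    fun ε hε hε1 => (hle ε hε).trans (ENNReal.ofReal_le_ofReal ?_)⟩
  have : 1 ≤ ε ^ (-(p / e)) := Real.one_le_rpow_of_pos_of_le_one_of_nonpos hε hε1
    (neg_nonpos.2 (div_nonneg hpp'.nonneg he.le))
  nlinarith

/-- For `p ≤ n / (n - 1)` an exponent `e` is used that is smaller than both differences in
`exists_lifespan_le`; above it the first of them is the smaller one and gives the Strauss
polynomial. -/
theorem IsSetting.subcritical (h : IsSetting n M D V β γ μ₁ μ₂ u₀ u₁ R₁ R) (hp : 1 < p)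
    (hpS : p < straussExponent n) :
    (∀ ε : ℝ, 0 < ε → lifespan n M D V p (ε • u₀) (ε • u₁) R < ⊤) ∧
      ∃ C > (0 : ℝ), ∃ ε₀ > (0 : ℝ), ∀ ε : ℝ, 0 < ε → ε ≤ ε₀ →
        (p ≤ (n : ℝ) / ((n : ℝ) - 1) → lifespan n M D V p (ε • u₀) (ε • u₁) R ≤
            ENNReal.ofReal (C * ε ^ (-(2 * (p - 1) / ((n : ℝ) + 1 - ((n : ℝ) - 1) * p))))) ∧
        ((n : ℝ) / ((n : ℝ) - 1) < p → lifespan n M D V p (ε • u₀) (ε • u₁) R ≤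
            ENNReal.ofReal (C * ε ^ (-(2 * p * (p - 1) / straussGamma p n)))) := by
  have hn : (3 : ℝ) ≤ n := by exact_mod_cast h.dim
  have hpp' : p.HolderConjugate (p / (p - 1)) := Real.HolderConjugate.conjExponent hp
  have hp1 : 0 < p - 1 := by linarith
  have hn1 : 0 < (n : ℝ) - 1 := by linarith
  rcases le_or_gt p ((n : ℝ) / ((n : ℝ) - 1)) with hle | hgt
  · have h1 : p * ((n : ℝ) - 1) ≤ n := (le_div_iff₀ hn1).1 hle
    have h2 : 0 < (n : ℝ) + 1 - ((n : ℝ) - 1) * p := by linarith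
    set e := p * ((n : ℝ) + 1 - ((n : ℝ) - 1) * p) / (2 * (p - 1)) with he
    have he' : e = p / (p - 1) - ((n : ℝ) - 1) * p / 2 := by rw [he]; field_simp; ring
    have hpe : p / e = 2 * (p - 1) / ((n : ℝ) + 1 - ((n : ℝ) - 1) * p) := by
      rw [he]; field_simp
    have hp'1 : 1 ≤ p / (p - 1) := hpp'.symm.lt.le
    obtain ⟨hfin, C, hC, hb⟩ := h.exists_lifespan_le_rpow hpp' (e := e) (by positivity)
      (by rw [he', decayRate]; linarith) (by rw [he', decayRate]; linarith)
    refine ⟨hfin, C, hC, 1, one_pos, fun ε hε hε1 => ⟨fun _ => ?_, fun hc => absurd hc hle.not_gt⟩⟩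
    rw [← hpe]
    exact hb ε hε hε1
  · have hγ := straussGamma_pos h.dim (by linarith : 0 < p) hpS
    set e := straussGamma p n / (2 * (p - 1)) with he
    have he' : e = 2 * (p / (p - 1)) - 1 - decayRate n * p := by
      rw [he, straussGamma, decayRate]; field_simp; ring
    have hpe : p / e = 2 * p * (p - 1) / straussGamma p n := by
      rw [he]; field_simp
    have h1 : (n : ℝ) < p * ((n : ℝ) - 1) := (div_lt_iff₀ hn1).1 hgt
    have hp'n : p / (p - 1) ≤ n := by
      rw [div_le_iff₀ hp1]
      linarith
    obtain ⟨hfin, C, hC, hb⟩ := h.exists_lifespan_le_rpow hpp' (e := e) (by positivity)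
      he'.le (by rw [he']; linarith)
    refine ⟨hfin, C, hC, 1, one_pos, fun ε hε hε1 => ⟨fun hc => absurd hgt hc.not_gt, fun _ => ?_⟩⟩
    rw [← hpe]
    exact hb ε hε hε1

end Setting

/-! ### Dyadic superpositions of modes -/

/-- A dyadic sum of a function decaying at `0` and at `∞` is bounded, because such a function is
dominated by the increments of a bounded one. -/
theorem exists_dyadic_sum_le {a b : ℝ} (ha : 0 < a) (hab : a < b) :
    ∃ C > (0 : ℝ), ∀ X, 0 < X → ∀ J : ℕ,
      ∑ j ∈ Finset.range J, ((1 / 2 : ℝ) ^ j * X) ^ a * (1 + (1 / 2 : ℝ) ^ j * X) ^ (-b) ≤ C := by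
  set c := min a (b - a) with hc
  have hc0 : 0 < c := lt_min ha (by linarith)
  have h2c : 1 < (2 : ℝ) ^ c := Real.one_lt_rpow one_lt_two hc0
  set g : ℝ → ℝ := fun x => x ^ c / (1 + x ^ c) with hg
  set K := 2 * (1 + (2 : ℝ) ^ c) / ((2 : ℝ) ^ c - 1) with hK
  have hK0 : 0 < K := by
    have : 0 < (2 : ℝ) ^ c - 1 := by linarith
    positivity
  have key : ∀ x, 0 < x → x ^ a * (1 + x) ^ (-b) ≤ K * (g (2 * x) - g x) := by
    intro x hx
    set y := x ^ c with hy
    have hy0 : 0 < y := by positivity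
    set d := (2 : ℝ) ^ c with hd
    have e1 : g (2 * x) - g x = y * (d - 1) / ((1 + y) * (1 + d * y)) := by
      simp only [hg]
      rw [Real.mul_rpow two_pos.le hx.le, ← hy, ← hd]
      have : 0 < 1 + d * y := by positivity
      field_simp
      ring
    have e2 : K * (g (2 * x) - g x) = 2 * (1 + d) * y / ((1 + y) * (1 + d * y)) := by
      rw [e1, hK]
      have h1 : d - 1 ≠ 0 := by linarith
      field_simp
    rw [e2, le_div_iff₀ (by positivity)]
    rcases le_total x 1 with h | h
    · have h1 : x ^ a ≤ y := Real.rpow_le_rpow_of_exponent_ge hx h (min_le_left _ _)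
      have h2 : (1 + x) ^ (-b) ≤ 1 :=
        Real.rpow_le_one_of_one_le_of_nonpos (by linarith) (by linarith)
      have h3 : y ≤ 1 := Real.rpow_le_one hx.le h hc0.le
      have h4 : (1 + y) * (1 + d * y) ≤ 2 * (1 + d) := by
        gcongr
        · linarith
        · nlinarith
      calc x ^ a * (1 + x) ^ (-b) * ((1 + y) * (1 + d * y)) ≤ y * 1 * (2 * (1 + d)) := by gcongr
        _ = _ := by ring
    · have h1 : x ^ a * (1 + x) ^ (-b) ≤ y⁻¹ := by
        have h2 : (1 + x) ^ (-b) ≤ x ^ (-b) :=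
          Real.rpow_le_rpow_of_nonpos hx (by linarith) (by linarith)
        calc x ^ a * (1 + x) ^ (-b) ≤ x ^ a * x ^ (-b) := by gcongr
          _ = x ^ (a - b) := by rw [← Real.rpow_add hx]; ring_nf
          _ ≤ x ^ (-c) := Real.rpow_le_rpow_of_exponent_le h (by linarith [min_le_right a (b - a)])
          _ = y⁻¹ := Real.rpow_neg hx.le c
      have h3 : 1 ≤ y := Real.one_le_rpow h hc0.le
      have h4 : (1 + y) * (1 + d * y) ≤ 2 * y * ((1 + d) * y) := by
        gcongr
        · linarith
        · nlinarith
      calc x ^ a * (1 + x) ^ (-b) * ((1 + y) * (1 + d * y)) ≤ y⁻¹ * (2 * y * ((1 + d) * y)) := by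
            gcongr
        _ = _ := by field_simp
  refine ⟨K, hK0, fun X hX J => ?_⟩
  calc ∑ j ∈ Finset.range J, ((1 / 2 : ℝ) ^ j * X) ^ a * (1 + (1 / 2 : ℝ) ^ j * X) ^ (-b)
      ≤ ∑ j ∈ Finset.range J, K * (g (2 * ((1 / 2 : ℝ) ^ j * X))
          - g (2 * ((1 / 2 : ℝ) ^ (j + 1) * X))) := by
        refine Finset.sum_le_sum fun j _ => ?_
        have := key ((1 / 2 : ℝ) ^ j * X) (by positivity)
        rwa [show 2 * ((1 / 2 : ℝ) ^ (j + 1) * X) = (1 / 2 : ℝ) ^ j * X by rw [pow_succ]; ring]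
    _ = K * (g (2 * X) - g (2 * ((1 / 2 : ℝ) ^ J * X))) := by
        rw [← Finset.mul_sum, Finset.sum_range_sub' fun j => g (2 * ((1 / 2 : ℝ) ^ j * X))]
        simp
    _ ≤ K * 1 := by
        have h1 : g (2 * X) ≤ 1 := by
          have : 0 < (2 * X) ^ c := by positivity
          simp only [hg]
          rw [div_le_one (by positivity)]
          linarith
        have h2 : 0 ≤ g (2 * ((1 / 2 : ℝ) ^ J * X)) := by
          simp only [hg]
          positivity
        gcongr
        linarith
    _ = K := mul_one K

theorem exists_one_add_rpow_le (m : ℝ) {κ : ℝ} (hκ : 0 < κ) :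
    ∃ C > (0 : ℝ), ∀ x, 0 ≤ x → (1 + x) ^ m ≤ C * Real.exp (κ * x) := by
  rcases le_or_gt m 0 with hm | hm
  · exact ⟨1, one_pos, fun x hx => by
      rw [one_mul]
      exact (Real.rpow_le_one_of_one_le_of_nonpos (by linarith) hm).trans
        (Real.one_le_exp (by positivity))⟩
  · set δ := min 1 (κ / m) with hδ
    have hδ0 : 0 < δ := lt_min one_pos (by positivity)
    have hδm : δ * m ≤ κ := (le_div_iff₀ hm).1 (min_le_right _ _)
    refine ⟨(1 / δ) ^ m, by positivity, fun x hx => ?_⟩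
    calc (1 + x) ^ m ≤ (Real.exp (δ * x) / δ) ^ m :=
          Real.rpow_le_rpow (by linarith) (one_add_le_exp_mul_div hδ0 (min_le_left _ _)) hm.le
      _ = (1 / δ) ^ m * Real.exp (δ * m * x) := by
          rw [div_eq_mul_one_div, Real.mul_rpow (Real.exp_pos _).le (by positivity),
            ← Real.exp_mul, mul_comm]
          ring_nf
      _ ≤ _ := by gcongr

theorem exists_mode_decay {M R ν : ℝ} (hM : 0 < M) (hR : 0 < R) (hν : 0 ≤ ν) {C₀ : ℝ}
    (hC₀ : 0 < C₀) :
    ∃ C > (0 : ℝ), ∀ l t r θ x : ℝ, 0 < l → l ≤ 1 → timeScale M R ≤ θ → θ / 8 ≤ t → 2 * M < r →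
      tortoise M r ≤ t + R →
      x ≤ C₀ * ((1 + l * r) ^ (-ν) * Real.exp (l * tortoise M r)) →
      Real.exp (-(l * t)) * x
        ≤ C * ((1 + l * θ) ^ (-ν) * Real.exp (-(l * (t + R - tortoise M r)) / 2)) := by
  obtain ⟨C₁, hC₁, h₁⟩ := exists_one_add_rpow_le ν (by norm_num : (0 : ℝ) < 1 / 2)
  refine ⟨C₀ * Real.exp R * ((8 * (1 + 2 * M)) ^ ν * C₁), by positivity,
    fun l t r θ x hl hl1 hθ ht hr hX hx => ?_⟩
  have hr0 : 0 < r := by linarith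
  have hθ0 : 0 < θ := by linarith [four_le_timeScale hM hR]
  set X := t + R - tortoise M r with hXd
  have hX0 : 0 ≤ X := by linarith
  have h2 : 1 + l * θ ≤ 8 * (1 + 2 * M) * ((1 + l * r) * (1 + l * X)) := by
    have h3 := tortoise_le hM hr
    have h4 : θ ≤ 8 * (X + (1 + 2 * M) * r) := by linarith
    have h5 : l * θ ≤ l * (8 * (X + (1 + 2 * M) * r)) := by gcongr
    have h6 : 0 ≤ l * r := by positivity
    have h7 : 0 ≤ l * X := by positivity
    have h8 : 0 ≤ M * (l * X) := by positivity
    have h9 : 0 ≤ (1 + 2 * M) * (l * r * (l * X)) := by positivity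
    nlinarith
  have h3 : (1 + l * r) ^ (-ν) ≤ (8 * (1 + 2 * M)) ^ ν * (1 + l * X) ^ ν * (1 + l * θ) ^ (-ν) := by
    have h4 := Real.rpow_le_rpow (by positivity) h2 hν
    rw [Real.mul_rpow (x := 8 * (1 + 2 * M)) (by positivity) (by positivity),
      Real.mul_rpow (x := 1 + l * r) (by positivity) (by positivity)] at h4
    rw [Real.rpow_neg (by positivity), Real.rpow_neg (by positivity)]
    have p1 : 0 < (1 + l * r) ^ ν := by positivity
    have p2 : 0 < (1 + l * θ) ^ ν := by positivity
    rw [← div_eq_mul_inv, le_div_iff₀ p2, inv_mul_le_iff₀ p1]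
    linarith
  have h4 : Real.exp (-(l * t)) * Real.exp (l * tortoise M r) ≤ Real.exp R * Real.exp (-(l * X)) := by
    rw [← Real.exp_add, ← Real.exp_add]
    refine Real.exp_le_exp.2 ?_
    have : l * R ≤ R := by nlinarith
    rw [hXd]
    linarith
  have h5 := h₁ (l * X) (by positivity)
  calc Real.exp (-(l * t)) * x
      ≤ Real.exp (-(l * t)) * (C₀ * ((1 + l * r) ^ (-ν) * Real.exp (l * tortoise M r))) := by gcongr
    _ = C₀ * (1 + l * r) ^ (-ν) * (Real.exp (-(l * t)) * Real.exp (l * tortoise M r)) := by ring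
    _ ≤ C₀ * ((8 * (1 + 2 * M)) ^ ν * (C₁ * Real.exp (1 / 2 * (l * X))) * (1 + l * θ) ^ (-ν))
          * (Real.exp R * Real.exp (-(l * X))) := by
        have h6 := h3.trans (mul_le_mul_of_nonneg_right (mul_le_mul_of_nonneg_left h5
          (by positivity)) (by positivity))
        gcongr
    _ = C₀ * Real.exp R * ((8 * (1 + 2 * M)) ^ ν * C₁) * ((1 + l * θ) ^ (-ν)
          * (Real.exp (1 / 2 * (l * X)) * Real.exp (-(l * X)))) := by ring
    _ = _ := by
        rw [← Real.exp_add]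
        ring_nf

/-- The superposition with weights `λ ^ q` over the dyadic rates `λ = 2 ^ (-j)` decays like
`θ ^ (-q)` in the transition region, uniformly in the number of terms. An additional factor `λ`
improves this to `θ ^ (-ν)` at the boundary of the cone and to `θ ^ (-q - 1)` well inside it. -/
theorem exists_superposition_le {M R ν q : ℝ} (hM : 0 < M) (hR : 0 < R) (hq : 0 < q) (hqν : q < ν)
    (hνq : ν < q + 1) {C₀ : ℝ} (hC₀ : 0 < C₀) :
    ∃ C > (0 : ℝ), ∀ (J : ℕ) (φ : ℕ → ℝ → ℝ) (t r θ : ℝ), timeScale M R ≤ θ → θ / 8 ≤ t →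
      2 * M < r → tortoise M r ≤ t + R →
      (∀ j ∈ Finset.range J, φ j r ≤ C₀ * ((1 + (1 / 2 : ℝ) ^ j * r) ^ (-ν)
        * Real.exp ((1 / 2 : ℝ) ^ j * tortoise M r))) →
      waveSum (Finset.range J) (fun j => ((1 / 2 : ℝ) ^ j) ^ q) (fun j => (1 / 2 : ℝ) ^ j) φ t r
        ≤ C * θ ^ (-q) ∧
      waveSum (Finset.range J) (fun j => ((1 / 2 : ℝ) ^ j) ^ q * (1 / 2 : ℝ) ^ j)
        (fun j => (1 / 2 : ℝ) ^ j) φ t r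
        ≤ C * (θ ^ (-ν) * (1 + (t + R - tortoise M r)) ^ (-(q + 1 - ν))) := by
  obtain ⟨C₁, hC₁, h₁⟩ := exists_mode_decay hM hR (hq.trans hqν).le hC₀
  obtain ⟨S₁, hS₁, hs₁⟩ := exists_dyadic_sum_le hq hqν
  have hk0 : 0 < q + 1 - ν := by linarith
  set k := q + 1 - ν with hk
  obtain ⟨S₂, hS₂, hs₂⟩ := exists_dyadic_sum_le hk0 (by linarith : k < k + 1)
  obtain ⟨C₂, hC₂, h₂⟩ := exists_one_add_rpow_le (k + 1) (by norm_num : (0 : ℝ) < 1 / 2)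
  set C := C₁ * S₁ + C₁ * (Real.exp (1 / 2) * C₂) * S₂ with hC
  refine ⟨C, by positivity, fun J φ t r θ hθ ht hr hX hφ => ?_⟩
  have hθ0 : 0 < θ := by linarith [four_le_timeScale hM hR]
  set X := t + R - tortoise M r with hXd
  have hX0 : 0 ≤ X := by linarith
  have hl : ∀ j : ℕ, 0 < (1 / 2 : ℝ) ^ j ∧ (1 / 2 : ℝ) ^ j ≤ 1 := fun j =>
    ⟨by positivity, pow_le_one₀ (by norm_num) (by norm_num)⟩
  have hterm : ∀ j ∈ Finset.range J, Real.exp (-((1 / 2 : ℝ) ^ j * t)) * φ j r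
      ≤ C₁ * ((1 + (1 / 2 : ℝ) ^ j * θ) ^ (-ν) * Real.exp (-((1 / 2 : ℝ) ^ j * X) / 2)) :=
    fun j hj => h₁ _ t r θ _ (hl j).1 (hl j).2 hθ ht hr hX (hφ j hj)
  unfold waveSum
  constructor
  · calc ∑ j ∈ Finset.range J, ((1 / 2 : ℝ) ^ j) ^ q * (Real.exp (-((1 / 2 : ℝ) ^ j * t)) * φ j r)
        ≤ ∑ j ∈ Finset.range J, C₁ * θ ^ (-q)
          * (((1 / 2 : ℝ) ^ j * θ) ^ q * (1 + (1 / 2 : ℝ) ^ j * θ) ^ (-ν)) := by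
          refine Finset.sum_le_sum fun j hj => ?_
          set l := (1 / 2 : ℝ) ^ j with hlj
          have hl0 : 0 < l := (hl j).1
          have e1 : l ^ q = θ ^ (-q) * (l * θ) ^ q := by
            rw [Real.mul_rpow hl0.le hθ0.le, mul_left_comm, ← Real.rpow_add hθ0]
            simp
          have e2 : Real.exp (-(l * X) / 2) ≤ 1 := by
            rw [Real.exp_le_one_iff]
            have : 0 ≤ l * X := by positivity
            linarith
          calc l ^ q * (Real.exp (-(l * t)) * φ j r)
              ≤ l ^ q * (C₁ * ((1 + l * θ) ^ (-ν) * Real.exp (-(l * X) / 2))) := by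
                exact mul_le_mul_of_nonneg_left (hterm j hj) (by positivity)
            _ ≤ l ^ q * (C₁ * ((1 + l * θ) ^ (-ν) * 1)) := by gcongr
            _ = _ := by rw [e1]; ring
      _ ≤ C₁ * θ ^ (-q) * S₁ := by
          rw [← Finset.mul_sum]
          gcongr
          exact hs₁ θ hθ0 J
      _ ≤ C * θ ^ (-q) := by
          have : 0 ≤ C₁ * (Real.exp (1 / 2) * C₂) * S₂ := by positivity
          have h3 : 0 < θ ^ (-q) := by positivity
          rw [hC]
          nlinarith
  · calc ∑ j ∈ Finset.range J, ((1 / 2 : ℝ) ^ j) ^ q * (1 / 2 : ℝ) ^ j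
          * (Real.exp (-((1 / 2 : ℝ) ^ j * t)) * φ j r)
        ≤ ∑ j ∈ Finset.range J, C₁ * (Real.exp (1 / 2) * C₂) * (θ ^ (-ν) * (1 + X) ^ (-k))
          * (((1 / 2 : ℝ) ^ j * (1 + X)) ^ k * (1 + (1 / 2 : ℝ) ^ j * (1 + X)) ^ (-(k + 1))) := by
          refine Finset.sum_le_sum fun j hj => ?_
          set l := (1 / 2 : ℝ) ^ j with hlj
          have hl0 : 0 < l := (hl j).1
          have hY : 0 < 1 + X := by linarith
          have e1 : l ^ q * l = l ^ ν * ((1 + X) ^ (-k) * (l * (1 + X)) ^ k) := by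
            rw [Real.mul_rpow hl0.le hY.le, mul_left_comm ((1 + X) ^ (-k)), ← Real.rpow_add hY,
              neg_add_cancel, Real.rpow_zero, mul_one, ← Real.rpow_add hl0]
            nth_rewrite 2 [← Real.rpow_one l]
            rw [← Real.rpow_add hl0]
            congr 1
            rw [hk]
            ring
          have e2 : l ^ ν * (1 + l * θ) ^ (-ν) ≤ θ ^ (-ν) := by
            have h3 : (1 + l * θ) ^ (-ν) ≤ (l * θ) ^ (-ν) :=
              Real.rpow_le_rpow_of_nonpos (by positivity) (by linarith) (by linarith)
            calc l ^ ν * (1 + l * θ) ^ (-ν) ≤ l ^ ν * (l * θ) ^ (-ν) := by gcongr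
              _ = θ ^ (-ν) := by
                rw [Real.mul_rpow hl0.le hθ0.le, ← mul_assoc, ← Real.rpow_add hl0]
                simp
          have e3 : Real.exp (-(l * X) / 2)
              ≤ Real.exp (1 / 2) * C₂ * (1 + l * (1 + X)) ^ (-(k + 1)) := by
            have h3 := h₂ (l * (1 + X)) (by positivity)
            have p1 : 0 < (1 + l * (1 + X)) ^ (k + 1) := by positivity
            rw [Real.rpow_neg (by positivity), ← div_eq_mul_inv, le_div_iff₀ p1]
            calc Real.exp (-(l * X) / 2) * (1 + l * (1 + X)) ^ (k + 1)
                ≤ Real.exp (-(l * X) / 2) * (C₂ * Real.exp (1 / 2 * (l * (1 + X)))) := by gcongr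
              _ = C₂ * Real.exp (-(l * X) / 2 + 1 / 2 * (l * (1 + X))) := by
                  rw [Real.exp_add]; ring
              _ ≤ C₂ * Real.exp (1 / 2) := by
                  gcongr
                  linarith [(hl j).2]
              _ = _ := mul_comm _ _
          have h4 : l ^ q * l * (Real.exp (-(l * t)) * φ j r)
              ≤ l ^ q * l * (C₁ * ((1 + l * θ) ^ (-ν) * Real.exp (-(l * X) / 2))) :=
            mul_le_mul_of_nonneg_left (hterm j hj) (by positivity)
          calc l ^ q * l * (Real.exp (-(l * t)) * φ j r)
              ≤ l ^ q * l * (C₁ * ((1 + l * θ) ^ (-ν) * Real.exp (-(l * X) / 2))) := h4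
            _ = C₁ * ((1 + X) ^ (-k) * (l * (1 + X)) ^ k) * ((l ^ ν * (1 + l * θ) ^ (-ν))
                  * Real.exp (-(l * X) / 2)) := by rw [e1]; ring
            _ ≤ C₁ * ((1 + X) ^ (-k) * (l * (1 + X)) ^ k) * (θ ^ (-ν)
                  * (Real.exp (1 / 2) * C₂ * (1 + l * (1 + X)) ^ (-(k + 1)))) := by gcongr
            _ = _ := by ring
      _ ≤ C₁ * (Real.exp (1 / 2) * C₂) * (θ ^ (-ν) * (1 + X) ^ (-k)) * S₂ := by
          rw [← Finset.mul_sum]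
          gcongr
          exact hs₂ (1 + X) (by linarith) J
      _ ≤ _ := by
          have h3 : 0 < θ ^ (-ν) * (1 + X) ^ (-k) := by positivity
          have : 0 < C₁ * S₁ := by positivity
          rw [hC]
          nlinarith

/-- Of the dyadic rates the one comparable to `1 / θ` alone gives the lower bound `θ ^ (-q)`. -/
theorem superposition_ge {M R q c₀ : ℝ} (hM : 0 < M) (hR : 0 < R) (hq : 0 < q) (hc₀ : 0 < c₀)
    {T θ : ℝ} (hθ : timeScale M R ≤ θ) (hθT : θ < T) {J : ℕ} (hJ : 2 * T ≤ 2 ^ J) {φ : ℕ → ℝ → ℝ}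
    {t r : ℝ} (htθ : t ≤ θ) (hr : |tortoise M r| ≤ t + R)
    (hφ : ∀ j ∈ Finset.range J, ∀ S, 0 ≤ S → -S ≤ (1 / 2 : ℝ) ^ j * tortoise M r →
      c₀ * Real.exp (-S) ≤ φ j r) :
    c₀ * Real.exp (-3) * (1 / 2) ^ q * θ ^ (-q)
      ≤ waveSum (Finset.range J) (fun j => ((1 / 2 : ℝ) ^ j) ^ q) (fun j => (1 / 2 : ℝ) ^ j) φ t r := by
  have hθ4 := (four_le_timeScale hM hR).trans hθ
  have hθ0 : 0 < θ := by linarith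
  have hRθ : R ≤ θ := by
    unfold timeScale at hθ
    have := sq_nonneg M
    linarith
  obtain ⟨i, hi1, hi2⟩ := exists_nat_pow_near (by linarith : (1 : ℝ) ≤ θ) one_lt_two
  have hiJ : i + 1 < J := by
    have h1 : (2 : ℝ) ^ (i + 1) < 2 ^ J := by
      rw [pow_succ]
      linarith
    exact (pow_lt_pow_iff_right₀ one_lt_two).1 h1
  have hmem : i + 1 ∈ Finset.range J := Finset.mem_range.2 hiJ
  have hφ0 : ∀ j ∈ Finset.range J, 0 ≤ φ j r := fun j hj =>
    le_trans (by positivity) (hφ j hj (|(1 / 2 : ℝ) ^ j * tortoise M r|) (abs_nonneg _)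
      (neg_abs_le _))
  set l := (1 / 2 : ℝ) ^ (i + 1) with hl
  have hl' : l * 2 ^ (i + 1) = 1 := by rw [hl, ← mul_pow]; norm_num
  have hl0 : 0 < l := by positivity
  have hlθ : l * θ ≤ 1 := by
    rw [← hl']
    exact mul_le_mul_of_nonneg_left hi2.le hl0.le
  have hlθ' : 1 / 2 ≤ l * θ := by
    have h1 : l * 2 ^ (i + 1) ≤ l * (2 * θ) := by
      rw [pow_succ, mul_comm _ (2 : ℝ)]
      gcongr
    linarith
  have h1 : c₀ * Real.exp (-2) ≤ φ (i + 1) r := by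
    refine hφ _ hmem 2 (by norm_num) ?_
    have h2 := (abs_le.1 hr).1
    have h3 : l * -(2 * θ) ≤ l * tortoise M r := by gcongr; linarith
    rw [← hl]
    linarith
  have h2 : Real.exp (-1) ≤ Real.exp (-(l * t)) := by
    refine Real.exp_le_exp.2 ?_
    have : l * t ≤ l * θ := by gcongr
    linarith
  have h3 : (1 / 2) ^ q * θ ^ (-q) ≤ l ^ q := by
    rw [Real.rpow_neg hθ0.le, ← div_eq_mul_inv, ← Real.div_rpow (by norm_num) hθ0.le]
    refine Real.rpow_le_rpow (by positivity) ?_ hq.le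
    rw [div_le_iff₀ hθ0]
    exact hlθ'
  calc c₀ * Real.exp (-3) * (1 / 2) ^ q * θ ^ (-q)
      = ((1 / 2) ^ q * θ ^ (-q)) * (Real.exp (-1) * (c₀ * Real.exp (-2))) := by
        rw [show (-3 : ℝ) = -1 + -2 by norm_num, Real.exp_add]
        ring
    _ ≤ l ^ q * (Real.exp (-(l * t)) * φ (i + 1) r) := by gcongr
    _ ≤ _ := Finset.single_le_sum (f := fun j => ((1 / 2 : ℝ) ^ j) ^ q
          * (Real.exp (-((1 / 2 : ℝ) ^ j * t)) * φ j r))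
          (fun j hj => mul_nonneg (by positivity) (mul_nonneg (Real.exp_pos _).le (hφ0 j hj))) hmem

/-! ### A discrete blow-up argument -/

/-- A sequence whose increments dominate `b` and a power `p` of itself with the critical weight
`(1 + i) ^ (1 - p)`, but that grows at most linearly, has a length of at most `b ^ (1 - p)`: under
the linear bound the increments of `a ^ (1 - p)` are controlled from above. -/
theorem exists_length_le {p c C : ℝ} (hp : 1 < p) (hc : 0 < c) (hC : 0 < C) :
    ∃ K > (0 : ℝ), ∀ b, 0 < b → ∀ (m : ℕ) (a : ℕ → ℝ), 0 ≤ a 0 →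
      (∀ i < 2 * m, a i + c * b ≤ a (i + 1)) →
      (∀ i < 2 * m, a i + c * (a i ^ p * (1 + i) ^ (1 - p)) ≤ a (i + 1)) →
      (∀ i < 2 * m, a i ≤ C * (1 + i)) → (m : ℝ) ≤ K * b ^ (1 - p) := by
  have hp1 : 0 < p - 1 := by linarith
  set xm := c * C ^ (p - 1) with hxm
  have hxm0 : 0 < xm := by positivity
  set Y := (1 + xm) ^ (p - 1) with hY
  have hY0 : 0 < Y := by positivity
  set κ := (p - 1) / ((1 + xm) * Y) with hκ
  have hκ0 : 0 < κ := by positivity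
  have chord : ∀ x, 0 ≤ x → x ≤ xm → (1 + x) ^ (1 - p) ≤ 1 - κ * x := by
    intro x hx hxx
    set y := (1 + x) ^ (p - 1) with hy
    have hy1 : 1 + (p - 1) * (x / (1 + xm)) ≤ y := by
      have h1 := Real.one_sub_inv_le_log_of_pos (by linarith : 0 < 1 + x)
      have h2 : x / (1 + xm) ≤ Real.log (1 + x) := by
        refine le_trans ?_ h1
        rw [show 1 - (1 + x)⁻¹ = x / (1 + x) by field_simp; ring]
        gcongr
      rw [hy, Real.rpow_def_of_pos (by linarith)]
      have h3 := Real.add_one_le_exp (Real.log (1 + x) * (p - 1))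
      nlinarith
    have hyY : y ≤ Y := Real.rpow_le_rpow (by linarith) (by linarith) hp1.le
    have hy0 : 0 < y := by positivity
    have hyge : 1 ≤ y := le_trans (by
      have : 0 ≤ (p - 1) * (x / (1 + xm)) := by positivity
      linarith) hy1
    rw [show 1 - p = -(p - 1) by ring, Real.rpow_neg (by linarith), ← hy]
    have h4 : κ * x ≤ (y - 1) / Y := by
      rw [hκ, le_div_iff₀ hY0]
      calc (p - 1) / ((1 + xm) * Y) * x * Y = (p - 1) * (x / (1 + xm)) := by field_simp
        _ ≤ _ := by linarith
    have h5 : (y - 1) / Y ≤ (y - 1) / y := by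
      refine div_le_div_of_nonneg_left (by linarith) hy0 hyY
    have h6 : (y - 1) / y = 1 - y⁻¹ := by field_simp
    linarith
  refine ⟨c ^ (1 - p) * 2 ^ (p - 1) / (κ * c), by positivity,
    fun b hb m a ha0 h1 h2 h3 => ?_⟩
  rcases Nat.eq_zero_or_pos m with rfl | hm
  · simp only [Nat.cast_zero]
    positivity
  have hm0 : (0 : ℝ) < m := by exact_mod_cast hm
  have hlin : ∀ i ≤ 2 * m, c * b * i ≤ a i := by
    intro i
    induction i with
    | zero => intro _; simpa using ha0
    | succ k ih =>
      intro hk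
      have := ih (by omega)
      have := h1 k (by omega)
      push_cast
      linarith
  have hstep : ∀ k ≤ m, a (m + k) ^ (1 - p)
      ≤ a m ^ (1 - p) - k * (κ * c * (2 * m) ^ (1 - p)) := by
    intro k
    induction k with
    | zero => intro _; simp
    | succ k ih =>
      intro hk
      have ih' := ih (by omega)
      set i := m + k with hi
      have hi2 : i < 2 * m := by omega
      have hi0 : (0 : ℝ) < i := by exact_mod_cast (by omega : 0 < i)
      have hai : 0 < a i := lt_of_lt_of_le (by positivity) (hlin i hi2.le)
      set x := c * (a i ^ (p - 1) * (1 + i) ^ (1 - p)) with hx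
      have hx0 : 0 ≤ x := by positivity
      have hxx : x ≤ xm := by
        have h4 := Real.rpow_le_rpow hai.le (h3 i hi2) hp1.le
        rw [Real.mul_rpow hC.le (by positivity)] at h4
        rw [hx, hxm]
        gcongr
        calc a i ^ (p - 1) * (1 + i) ^ (1 - p)
            ≤ C ^ (p - 1) * (1 + (i : ℝ)) ^ (p - 1) * (1 + i) ^ (1 - p) := by gcongr
          _ = C ^ (p - 1) := by
            rw [mul_assoc, ← Real.rpow_add (by positivity)]
            simp
      have h5 : a i * (1 + x) ≤ a (i + 1) := by
        have h6 := h2 i hi2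
        have h7 : a i ^ p = a i * a i ^ (p - 1) := by
          nth_rewrite 2 [← Real.rpow_one (a i)]
          rw [← Real.rpow_add hai]
          ring_nf
        rw [h7] at h6
        rw [hx]
        linarith
      have h6 : a (i + 1) ^ (1 - p) ≤ a i ^ (1 - p) - κ * c * (2 * m) ^ (1 - p) := by
        calc a (i + 1) ^ (1 - p) ≤ (a i * (1 + x)) ^ (1 - p) :=
              Real.rpow_le_rpow_of_nonpos (by positivity) h5 (by linarith)
          _ = a i ^ (1 - p) * (1 + x) ^ (1 - p) := Real.mul_rpow hai.le (by linarith)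
          _ ≤ a i ^ (1 - p) * (1 - κ * x) := by gcongr; exact chord x hx0 hxx
          _ = a i ^ (1 - p) - κ * c * ((a i ^ (1 - p) * a i ^ (p - 1)) * (1 + i) ^ (1 - p)) := by
              rw [hx]; ring
          _ = a i ^ (1 - p) - κ * c * (1 + i) ^ (1 - p) := by
              rw [← Real.rpow_add hai]
              simp
          _ ≤ _ := by
              have h8 : (1 + (i : ℝ)) ≤ 2 * m := by
                have : 1 + i ≤ 2 * m := by omega
                exact_mod_cast this
              have h9 : (2 * (m : ℝ)) ^ (1 - p) ≤ (1 + (i : ℝ)) ^ (1 - p) :=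
                Real.rpow_le_rpow_of_nonpos (by positivity) h8 (by linarith)
              gcongr
      rw [← add_assoc, ← hi]
      push_cast
      linarith
  have hfin := hstep m le_rfl
  have ha2 : 0 ≤ a (m + m) ^ (1 - p) := by
    refine Real.rpow_nonneg (le_trans ?_ (hlin (m + m) (by omega))) _
    positivity
  have ham : a m ^ (1 - p) ≤ (c * b * m) ^ (1 - p) :=
    Real.rpow_le_rpow_of_nonpos (by positivity) (hlin m (by omega)) (by linarith)
  have h7 : m * (κ * c * (2 * m) ^ (1 - p)) ≤ (c * b * m) ^ (1 - p) := by linarith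
  rw [Real.mul_rpow two_pos.le hm0.le, Real.mul_rpow (by positivity) hm0.le,
    Real.mul_rpow hc.le hb.le] at h7
  have hmp : 0 < (m : ℝ) ^ (1 - p) := by positivity
  have h8 : m * (κ * c * 2 ^ (1 - p)) ≤ c ^ (1 - p) * b ^ (1 - p) := by
    refine le_of_mul_le_mul_right ?_ hmp
    linarith
  have h9 : (2 : ℝ) ^ (1 - p) * 2 ^ (p - 1) = 1 := by
    rw [← Real.rpow_add two_pos]
    simp
  have h10 : (0 : ℝ) < 2 ^ (p - 1) := by positivity
  rw [div_mul_eq_mul_div, le_div_iff₀ (by positivity)]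
  calc m * (κ * c) = m * (κ * c * 2 ^ (1 - p)) * 2 ^ (p - 1) := by
        linear_combination (-(m * (κ * c))) * h9
    _ ≤ c ^ (1 - p) * b ^ (1 - p) * 2 ^ (p - 1) := by gcongr
    _ = _ := by ring

/-! ### The critical case -/

section Setting

variable {n : ℕ} {M : ℝ} {D V : ℝ → ℝ} {β γ μ₁ μ₂ : ℝ} {u₀ u₁ : EuclideanSpace ℝ (Fin n) → ℝ}
  {R₁ R p p' Cη : ℝ} {η η₁ η₂ : ℝ → ℝ}

/-- The error terms of the test identity for the superposition: at the critical exponent the two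
parts of the integrand have the same power of `θ`, and the first produces the logarithm. -/
theorem exists_lintegral_superposition_le (hn : 3 ≤ n) (hM : 0 < M) (hR : 0 < R)
    (hβ : 1 < β) (hp' : 1 < p') {ν q K m : ℝ} (hK : 0 < K) (hm : n - (ν + 1) * p' = m)
    (hqm : n + 1 - 2 * p' - q * p' = m) (hqm' : 1 - p' - q * p' ≤ m) :
    ∃ C > (0 : ℝ), ∀ T θ : ℝ, timeScale M R ≤ θ →
      ∫⁻ z in transition n M R T θ, ENNReal.ofReal
          (K * (θ ^ (-ν - 1) * (1 + (z.1 + R - tortoise M ‖z.2‖)) ^ (-(1 / p')))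
            + θ ^ (-q) * (K * (‖z.2‖ ^ (-β) / θ + 1 / θ ^ 2))) ^ p'
      ≤ ENNReal.ofReal (C * (θ ^ m * Real.log θ)) := by
  obtain ⟨C₁, hC₁, h₁⟩ := exists_lintegral_log_le hn hM hR (ν := ν) hp' hK
  obtain ⟨C₂, hC₂, h₂⟩ := exists_lintegral_static_le hn hM hR hβ hp' hK
  refine ⟨2 ^ (p' - 1) * (C₁ + C₂ * 2), by positivity, fun T θ hθ => ?_⟩
  have hθ4 := (four_le_timeScale hM hR).trans hθ
  have hθ0 : 0 < θ := by linarith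
  have hlog : 1 ≤ Real.log θ := by
    rw [Real.le_log_iff_exp_le hθ0]
    linarith [Real.exp_one_lt_d9]
  have hmeas := measurable_tortoise (M := M)
  set G₁ : ℝ × EuclideanSpace ℝ (Fin n) → ℝ≥0∞ := fun z => ENNReal.ofReal
    (K * (θ ^ (-ν - 1) * (1 + (z.1 + R - tortoise M ‖z.2‖)) ^ (-(1 / p')))) ^ p' with hG₁
  set G₂ : ℝ × EuclideanSpace ℝ (Fin n) → ℝ≥0∞ := fun z => ENNReal.ofReal
    (K * (‖z.2‖ ^ (-β) / θ + 1 / θ ^ 2)) ^ p' with hG₂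
  have hG₁m : Measurable G₁ := by fun_prop
  have hG₂m : Measurable G₂ := by fun_prop
  have hp'0 : 0 ≤ p' := by linarith
  calc _ ≤ ∫⁻ z in transition n M R T θ, (2 : ℝ≥0∞) ^ (p' - 1)
          * (G₁ z + ENNReal.ofReal (θ ^ (-(q * p'))) * G₂ z) := by
        refine lintegral_mono fun z => ?_
        refine (ENNReal.rpow_le_rpow ENNReal.ofReal_add_le hp'0).trans
          ((ENNReal.rpow_add_le_mul_rpow_add_rpow _ _ hp'.le).trans (le_of_eq ?_))
        have e : ENNReal.ofReal (θ ^ (-q)) ^ p' = ENNReal.ofReal (θ ^ (-(q * p'))) := by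
          rw [ENNReal.ofReal_rpow_of_nonneg (by positivity) hp'0, ← Real.rpow_mul hθ0.le, neg_mul]
        rw [ENNReal.ofReal_mul (by positivity : 0 ≤ θ ^ (-q)), ENNReal.mul_rpow_of_nonneg _ _ hp'0, e]
    _ = (2 : ℝ≥0∞) ^ (p' - 1) * ((∫⁻ z in transition n M R T θ, G₁ z)
          + ENNReal.ofReal (θ ^ (-(q * p'))) * ∫⁻ z in transition n M R T θ, G₂ z) := by
        rw [lintegral_const_mul _ (by fun_prop), lintegral_add_left hG₁m,
          lintegral_const_mul _ hG₂m]
    _ ≤ (2 : ℝ≥0∞) ^ (p' - 1) * (ENNReal.ofReal (C₁ * (θ ^ (n - (ν + 1) * p') * Real.log θ))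
          + ENNReal.ofReal (θ ^ (-(q * p')))
            * ENNReal.ofReal (C₂ * (θ ^ (n + 1 - 2 * p') + θ ^ (1 - p')))) := by
        gcongr
        · exact h₁ T θ hθ
        · exact h₂ T θ hθ
    _ = ENNReal.ofReal (2 ^ (p' - 1) * (C₁ * (θ ^ m * Real.log θ)
          + θ ^ (-(q * p')) * (C₂ * (θ ^ (n + 1 - 2 * p') + θ ^ (1 - p'))))) := by
        have e : (2 : ℝ≥0∞) ^ (p' - 1) = ENNReal.ofReal (2 ^ (p' - 1)) := by
          rw [← ENNReal.ofReal_rpow_of_pos two_pos]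
          simp
        rw [e, hm, ← ENNReal.ofReal_mul (by positivity), ← ENNReal.ofReal_add (by positivity)
          (by positivity), ← ENNReal.ofReal_mul (by positivity)]
    _ ≤ _ := by
        refine ENNReal.ofReal_le_ofReal ?_
        have e1 : θ ^ (-(q * p')) * θ ^ (n + 1 - 2 * p') = θ ^ m := by
          rw [← Real.rpow_add hθ0, ← hqm]
          ring_nf
        have e2 : θ ^ (-(q * p')) * θ ^ (1 - p') ≤ θ ^ m := by
          rw [← Real.rpow_add hθ0]
          exact Real.rpow_le_rpow_of_exponent_le (by linarith) (by linarith)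
        have e3 : θ ^ m ≤ θ ^ m * Real.log θ := le_mul_of_one_le_right (by positivity) hlog
        rw [mul_assoc (2 ^ (p' - 1))]
        gcongr
        calc C₁ * (θ ^ m * Real.log θ)
              + θ ^ (-(q * p')) * (C₂ * (θ ^ (n + 1 - 2 * p') + θ ^ (1 - p')))
            = C₁ * (θ ^ m * Real.log θ) + C₂ * (θ ^ (-(q * p')) * θ ^ (n + 1 - 2 * p')
              + θ ^ (-(q * p')) * θ ^ (1 - p')) := by ring
          _ ≤ C₁ * (θ ^ m * Real.log θ) + C₂ * (θ ^ m * Real.log θ + θ ^ m * Real.log θ) := by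
              have := add_le_add (e1.le.trans e3) (e2.trans e3)
              gcongr _ + _ * ?_
          _ = _ := by ring

set_option maxHeartbeats 400000 in
/-- The functional `A`, the integral of `|u| ^ p` against the superposition of modes cut off at time
`θ`, grows at most logarithmically, but its increments over a fixed ratio of times are bounded from
below by `ε ^ p` and by a power of `A`. -/
theorem IsSetting.exists_growth (h : IsSetting n M D V β γ μ₁ μ₂ u₀ u₁ R₁ R)
    (hV : ∀ r, 2 * M < r → V r = 0) (hp : 1 < p) (hpS : p = straussExponent n) :
    ∃ c > (0 : ℝ), ∃ K > (0 : ℝ), ∃ θ₀ ≥ (4 : ℝ), ∀ ε : ℝ, 0 < ε → ∀ T u,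
      IsWeakSolution n M D V p (ε • u₀) (ε • u₁) T u → FiniteSpeed n M R T u →
      ∃ A : ℝ → ℝ, (∀ θ, 0 ≤ A θ) ∧ (∀ θ, θ₀ ≤ θ → θ < T → A θ ≤ K * Real.log θ) ∧
        ∀ θ, θ₀ ≤ θ → 4 * θ < T → A θ + c * ε ^ p ≤ A (4 * θ) ∧
          A θ + c * (A θ ^ p * Real.log (2 * θ) ^ (1 - p)) ≤ A (4 * θ) := by
  have hM := h.mass
  have hn := h.dim
  have hn' : (3 : ℝ) ≤ n := by exact_mod_cast hn
  have hRp := h.R_pos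
  have hν := one_le_decayRate hn
  have hνn : (n : ℝ) = 2 * decayRate n + 1 := by rw [decayRate]; ring
  set ν := decayRate n with hνd
  set p' := p / (p - 1) with hp'd
  have hpp' : p.HolderConjugate p' := Real.HolderConjugate.conjExponent hp
  have hp0 : 0 < p := by linarith
  have hp1 : 0 < p - 1 := by linarith
  have hp'1 : 1 < p' := hpp'.symm.lt
  have hp'0 : 0 < p' := by linarith
  -- the equation of the critical exponent, and its consequences
  have hcrit : ν * p ^ 2 = (ν + 1) * p + 1 := by
    have h0 := ((eq_straussExponent_iff n (by omega) p).2 hpS).2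
    unfold straussGamma at h0
    rw [hνn] at h0
    linarith
  set q := ν - 1 / p with hq
  have hpinv : 1 / p < 1 := by rw [div_lt_one hp0]; exact hp
  have hpinv0 : 0 < 1 / p := by positivity
  have hq0 : 0 < q := by linarith
  have hpi : p * (1 / p) = 1 := by field_simp
  have hνp : ν * p = ν + 1 + 1 / p := by
    field_simp
    linarith
  have hp'p : p' * (p - 1) = p := by rw [hp'd]; field_simp
  have hkq : q + 1 - ν = 1 / p' := by
    rw [hq, hp'd]
    field_simp
    ring
  have hqp' : q * p' = ν * p' - p' + 1 := by
    rw [hq, hp'd]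
    field_simp
    ring
  have hp'n : p' ≤ n := by
    rw [hp'd, div_le_iff₀ hp1]
    nlinarith
  set m := (n : ℝ) - (ν + 1) * p' with hm
  have hqm : q + m * (p - 1) = 0 := by
    have : m * (p - 1) = n * (p - 1) - (ν + 1) * (p' * (p - 1)) := by rw [hm]; ring
    rw [this, hp'p, hq, hνn]
    linarith
  have hnq : n - ν * p = q := by rw [hq, hνn]; linarith
  obtain ⟨Cη, hCη, η, η₁, η₂, hη⟩ := exists_isTimeCutoff hp
  obtain ⟨C₀, hC₀, hmode₀⟩ := exists_mode_uniform_bound hn hM h.one_lt_β h.β_le h.μ₁_nonneg h.boundD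
    hV
  obtain ⟨c₀, hc₀, hlow⟩ := exists_mode_lower_bound (D := D) (V := V) hn hM
    (fun r hr => (h.boundD r hr).1) (fun r hr => (h.boundV r hr).1)
  obtain ⟨c₁, hc₁, hdata⟩ := h.exists_lower_bound hpp' hη hCη
  set K₀ := Cη * (4 + (8 * M ^ 2 * C₀ + 4 * M * (decayRate n - 1)) * (2 * M) ^ (β - 2) + μ₁)
    with hK₀
  have hμ := h.μ₁_nonneg
  have hK₀0 : 0 < K₀ := by
    have : 0 ≤ decayRate n - 1 := by linarith
    positivity
  obtain ⟨C₁, hC₁, hsup⟩ := exists_superposition_le hM hRp hq0 (by linarith : q < ν)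
    (by linarith : ν < q + 1) hC₀
  obtain ⟨C₂, hC₂, hbound⟩ := exists_lintegral_superposition_le (n := n) hn hM hRp h.one_lt_β hp'1
    (ν := ν) (q := q) (m := m) (by positivity : 0 < K₀ * C₁) rfl (by rw [hqp', hm]; ring)
    (by rw [hqp', hm]; linarith)
  set c₂ := c₀ * Real.exp (-3) * (1 / 2) ^ q with hc₂
  have hc₂0 : 0 < c₂ := by positivity
  set θ₀ := max (timeScale M R) (2 * delay M (2 * M + R₁) + 1) with hθ₀
  have hθ₀4 : 4 ≤ θ₀ := (four_le_timeScale hM hRp).trans (le_max_left _ _)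
  set K₁ := c₂⁻¹ * C₂ ^ (p - 1) with hK₁
  have hK₁0 : 0 < K₁ := by positivity
  refine ⟨min (c₂ * c₁) K₁⁻¹, lt_min (by positivity) (by positivity), K₁ ^ (1 / (p - 1)),
    by positivity, θ₀, hθ₀4, fun ε hε T u hu hs => ?_⟩
  rcases lt_or_ge T θ₀ with hT | hT
  · exact ⟨fun _ => 0, fun _ => le_rfl, fun θ h1 h2 => by linarith, fun θ h1 h2 => by linarith⟩
  obtain ⟨a, a', b', b, ha2, ha4, ha, hb, hab, hrange⟩ := exists_radial_range hM
    (by linarith : 0 ≤ T + R)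
  obtain ⟨J, hJ⟩ := pow_unbounded_of_one_lt (2 * T) one_lt_two
  choose φ φ' hφ using fun j : ℕ => exists_isMode (l := (1 / 2 : ℝ) ^ j) hn hM h.contD h.contV
    (fun r hr => (h.boundD r hr).1) (fun r hr => (h.boundV r hr).1) ha2 hab (by positivity)
  have hl : ∀ j : ℕ, 0 < (1 / 2 : ℝ) ^ j ∧ (1 / 2 : ℝ) ^ j ≤ 1 := fun j =>
    ⟨by positivity, pow_le_one₀ (by norm_num) (by norm_num)⟩
  have hφb := fun j => hmode₀ a b _ _ _ ha2 ha4 hab (hl j).1 (hl j).2 (hφ j)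
  have hφl := fun j => hlow a b _ _ _ ha2 ha4 hab (hl j).1.le (hl j).2 (hφ j)
  have hdata₀ : ∀ x ∈ exterior n M, ((ε • u₀) x ≠ 0 ∨ (ε • u₁) x ≠ 0) → u₀ x ≠ 0 ∨ u₁ x ≠ 0 := by
    intro x _ hx
    simpa [hε.ne'] using hx
  set Ψ := waveSum (Finset.range J) (fun j => ((1 / 2 : ℝ) ^ j) ^ q) (fun j => (1 / 2 : ℝ) ^ j) φ
    with hΨ
  set W := Ioo 0 T ×ˢ exterior n M with hW
  have hWm : MeasurableSet W := measurableSet_Ioo.prod measurableSet_exterior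
  have hr' : ∀ z ∈ W, |tortoise M ‖z.2‖| ≤ z.1 + R → ‖z.2‖ ∈ Ioo a b := fun z hz h => by
    have hr := hrange ‖z.2‖ hz.2 (h.trans (by linarith [hz.1.2]))
    exact ⟨ha.trans hr.1, hr.2.trans hb⟩
  have hΨ0 : ∀ t, ∀ r ∈ Ioo a b, 0 ≤ Ψ t r := fun t r hr => waveSum_nonneg
    (fun j _ => by positivity) fun j _ => ((hφ j).pos r (Ioo_subset_Icc_self hr)).le
  set f : ℝ → ℝ × EuclideanSpace ℝ (Fin n) → ℝ≥0∞ := fun θ z =>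
    ENNReal.ofReal (|u z| ^ p * (Ψ z.1 ‖z.2‖ * η ((z.1 + delay M ‖z.2‖) / θ))) with hf
  have htr : ∀ θ, transition n M R T θ ⊆ W := fun θ z hz => hz.1
  have main : ∀ θ, θ₀ ≤ θ → θ < T → (∫⁻ z in W, f θ z) ≠ ∞ ∧
      (∫⁻ z in W, f θ z) ≤ (ENNReal.ofReal (θ ^ q / c₂) * ∫⁻ z in transition n M R T θ, f θ z)
        ^ (1 / p) * ENNReal.ofReal (C₂ * (θ ^ m * Real.log θ)) ^ (1 / p') ∧
      ENNReal.ofReal (c₂ * c₁ * ε ^ p) ≤ ∫⁻ z in transition n M R T θ, f θ z := by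
    intro θ hθ hθT
    have hθs : timeScale M R ≤ θ := (le_max_left _ _).trans hθ
    have hθd : 2 * delay M (2 * M + R₁) < θ := by
      have := (le_max_right (timeScale M R) (2 * delay M (2 * M + R₁) + 1)).trans hθ
      linarith
    have hθ0 : 0 < θ := by linarith
    obtain ⟨hfin, -, hle⟩ := hu.lintegral_le hn hM h.contD h.contV h.β_le h.boundD hpp' h.R₁_pos hs
      (fun x hx => smul_nonneg hε.le (h.nonneg₀ x hx))
      (fun x hx => smul_nonneg hε.le (h.nonneg₁ x hx))
      (fun x hx hfg => h.supp x hx (hdata₀ x hx hfg))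
      (fun x hx hfg => h.supp₁ x hx (hdata₀ x hx hfg))
      ha2 ha hb hθ0 hθT hθd hrange (s := Finset.range J) (w := fun j => ((1 / 2 : ℝ) ^ j) ^ q)
      (l := fun j => (1 / 2 : ℝ) ^ j)
      (φ := φ) (φ' := φ') (fun j _ => hφ j) (fun _ _ => by positivity)
      (fun j _ => (hl j).1.le) (Cm := C₀) (fun j _ r hr => (hφb j r hr).2) hη
      (G := fun t r => K₀ * C₁ * (θ ^ (-ν - 1) * (1 + (t + R - tortoise M r)) ^ (-(1 / p')))
            + θ ^ (-q) * (K₀ * C₁ * (r ^ (-β) / θ + 1 / θ ^ 2)))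
      (by
        have := measurable_tortoise (M := M)
        unfold Function.uncurry
        fun_prop) (fun t ht r hr hσ h1 h2 => by
        have hr2 : 2 * M < r := by linarith [hr.1]
        have hr0 : 0 < r := by linarith
        obtain ⟨ht8, -, -⟩ := transition_bounds hM hRp hθs ht.1 hr2 hσ h1 h2
        obtain ⟨b1, b2⟩ := hsup J φ t r θ hθs ht8 hr2 (abs_le.1 hσ).2
          fun j _ => (hφb j r (Ioo_subset_Icc_self hr)).1
        rw [← hΨ] at b1
        rw [hkq] at b2
        rw [← hK₀, ← hΨ]
        set E := waveSum (Finset.range J) (fun j => ((1 / 2 : ℝ) ^ j) ^ q * (1 / 2 : ℝ) ^ j)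
          (fun j => (1 / 2 : ℝ) ^ j) φ t r with hE
        have e1 : θ ^ (-ν - 1) = θ ^ (-ν) / θ := by rw [Real.rpow_sub_one hθ0.ne']
        calc K₀ * ((E + r ^ (-β) * Ψ t r) / θ + Ψ t r / θ ^ 2)
            ≤ K₀ * ((C₁ * (θ ^ (-ν) * (1 + (t + R - tortoise M r)) ^ (-(1 / p')))
                + r ^ (-β) * (C₁ * θ ^ (-q))) / θ + C₁ * θ ^ (-q) / θ ^ 2) := by gcongr
          _ = _ := by rw [e1]; ring)
    -- the superposition is bounded below in the transition region
    have hΨge : ∀ z ∈ transition n M R T θ, 1 ≤ θ ^ q / c₂ * Ψ z.1 ‖z.2‖ := by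
      intro z hz
      obtain ⟨h1, h2, h3, h4, h5⟩ := mem_transition_bounds hM hRp hθs hz
      have hzr := hr' z hz.1 hz.2.1
      have h6 := superposition_ge hM hRp hq0 hc₀ hθs hθT hJ.le h2 hz.2.1 (φ := φ)
        fun j _ S hS hS' => hφl j ‖z.2‖ (Ioo_subset_Icc_self hzr) S hS hS'
      rw [← hc₂, ← hΨ, Real.rpow_neg hθ0.le] at h6
      have h7 : 0 < θ ^ q := by positivity
      calc 1 = θ ^ q / c₂ * (c₂ * (θ ^ q)⁻¹) := by field_simp
        _ ≤ _ := by gcongr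
    have hY : ∫⁻ z in transition n M R T θ,
          ENNReal.ofReal (|u z| ^ p * η ((z.1 + delay M ‖z.2‖) / θ))
        ≤ ENNReal.ofReal (θ ^ q / c₂) * ∫⁻ z in transition n M R T θ, f θ z := by
      rw [← lintegral_const_mul' _ _ ENNReal.ofReal_ne_top]
      refine setLIntegral_mono' measurableSet_transition fun z hz => ?_
      rw [hf, ← ENNReal.ofReal_mul (by positivity)]
      refine ENNReal.ofReal_le_ofReal ?_
      have h0 : 0 ≤ |u z| ^ p * η ((z.1 + delay M ‖z.2‖) / θ) :=
        mul_nonneg (by positivity) (hη.nonneg _)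
      calc |u z| ^ p * η ((z.1 + delay M ‖z.2‖) / θ)
          ≤ |u z| ^ p * η ((z.1 + delay M ‖z.2‖) / θ) * (θ ^ q / c₂ * Ψ z.1 ‖z.2‖) :=
            le_mul_of_one_le_right h0 (hΨge z hz)
        _ = _ := by ring
    refine ⟨hfin, ?_, ?_⟩
    · refine (le_add_self.trans hle).trans ?_
      gcongr
      exact hbound T θ hθs
    · have h1 := (hdata ε hε T u hu hs θ hθs hθd hθT).trans hY
      have hθq : 0 < θ ^ q := by positivity
      rw [← hνd, hnq] at h1
      have h2 : ENNReal.ofReal (c₁ * (ε ^ p * θ ^ q))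
          = ENNReal.ofReal (θ ^ q / c₂) * ENNReal.ofReal (c₂ * c₁ * ε ^ p) := by
        rw [← ENNReal.ofReal_mul (by positivity)]
        congr 1
        field_simp
      rw [h2] at h1
      exact (ENNReal.mul_le_mul_iff_right (by simp; positivity) ENNReal.ofReal_ne_top).1 h1
  -- the increments of the functional
  have hincr : ∀ θ, 0 < θ → (∫⁻ z in W, f θ z) + (∫⁻ z in transition n M R T (2 * θ), f (2 * θ) z)
      ≤ ∫⁻ z in W, f (4 * θ) z := by
    intro θ hθ0
    rw [← inter_eq_left.2 (htr (2 * θ)), ← setLIntegral_indicator measurableSet_transition]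
    · refine (le_lintegral_add _ _).trans (lintegral_mono_ae ?_)
      filter_upwards [ae_restrict_mem hWm, hs] with z hz hsz
      by_cases huz : u z = 0
      · by_cases hzt : z ∈ transition n M R T (2 * θ) <;>
          simp [hf, huz, Real.zero_rpow hp0.ne', hzt]
      have hΨz := hΨ0 z.1 _ (hr' z hz (hsz huz))
      have hpz : 0 ≤ |u z| ^ p := by positivity
      have htm : 0 ≤ z.1 + delay M ‖z.2‖ := add_nonneg hz.1.1.le (delay_nonneg hM hz.2)
      by_cases hzt : z ∈ transition n M R T (2 * θ)
      · have ⟨_, _, h1, h2⟩ := hzt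
        rw [indicator_of_mem hzt]
        have e1 : η ((z.1 + delay M ‖z.2‖) / θ) = 0 := hη.eq_zero _ (by
          rw [le_div_iff₀ hθ0]; linarith)
        have e2 : η ((z.1 + delay M ‖z.2‖) / (4 * θ)) = 1 := hη.eq_one _ (by
          rw [div_le_iff₀ (by positivity)]; linarith)
        simp only [hf, e1, e2, mul_zero, ENNReal.ofReal_zero, zero_add]
        refine ENNReal.ofReal_le_ofReal ?_
        gcongr
        exact hη.le_one _
      · rw [indicator_of_notMem hzt, add_zero]
        refine ENNReal.ofReal_le_ofReal ?_
        gcongr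
        refine hη.antitone ?_
        gcongr
        linarith
  set A : ℝ → ℝ := fun θ => (∫⁻ z in W, f θ z).toReal with hA
  set B : ℝ → ℝ := fun θ => (∫⁻ z in transition n M R T θ, f θ z).toReal with hB
  have real : ∀ θ, θ₀ ≤ θ → θ < T → B θ ≤ A θ ∧ c₂ * c₁ * ε ^ p ≤ B θ ∧
      A θ ^ p ≤ K₁ * (B θ * Real.log θ ^ (p - 1)) := by
    intro θ hθ hθT
    obtain ⟨h1, h2, h3⟩ := main θ hθ hθT
    have hθ0 : 0 < θ := by linarith
    have hlog : 1 ≤ Real.log θ := by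
      rw [Real.le_log_iff_exp_le hθ0]
      linarith [Real.exp_one_lt_d9]
    have hBfin : (∫⁻ z in transition n M R T θ, f θ z) ≠ ∞ :=
      ne_top_of_le_ne_top h1 (lintegral_mono_set (htr θ))
    have hB0 : 0 ≤ B θ := ENNReal.toReal_nonneg
    refine ⟨ENNReal.toReal_mono h1 (lintegral_mono_set (htr θ)), ?_, ?_⟩
    · exact (ENNReal.ofReal_le_iff_le_toReal hBfin).1 h3
    · have h4 := ENNReal.rpow_le_rpow h2 hp0.le
      rw [ENNReal.mul_rpow_of_nonneg _ _ hp0.le, ← ENNReal.rpow_mul, ← ENNReal.rpow_mul,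
        one_div_mul_cancel hp0.ne', ENNReal.rpow_one, ← ENNReal.ofReal_toReal h1,
        ← ENNReal.ofReal_toReal hBfin, ← ENNReal.ofReal_mul (by positivity),
        ENNReal.ofReal_rpow_of_nonneg ENNReal.toReal_nonneg hp0.le,
        ENNReal.ofReal_rpow_of_nonneg (by positivity) (by positivity),
        ← ENNReal.ofReal_mul (by positivity), ENNReal.ofReal_le_ofReal_iff (by positivity)] at h4
      refine h4.trans (le_of_eq ?_)
      have e1 : 1 / p' * p = p - 1 := by
        rw [hp'd]
        field_simp
      have e2 : θ ^ q * θ ^ (m * (p - 1)) = 1 := by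
        rw [← Real.rpow_add hθ0, hqm, Real.rpow_zero]
      rw [e1, Real.mul_rpow hC₂.le (by positivity), Real.mul_rpow (by positivity) (by positivity),
        ← Real.rpow_mul hθ0.le, hK₁]
      show θ ^ q / c₂ * B θ * _ = _
      calc θ ^ q / c₂ * B θ * (C₂ ^ (p - 1) * (θ ^ (m * (p - 1)) * Real.log θ ^ (p - 1)))
          = (θ ^ q * θ ^ (m * (p - 1))) * (c₂⁻¹ * C₂ ^ (p - 1) * (B θ * Real.log θ ^ (p - 1))) := by
            ring
        _ = _ := by rw [e2, one_mul]
  refine ⟨A, fun θ => ENNReal.toReal_nonneg, fun θ hθ hθT => ?_, fun θ hθ hθT => ?_⟩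
  · obtain ⟨h1, h2, h3⟩ := real θ hθ hθT
    have hθ0 : 0 < θ := by linarith
    have hlog : 0 < Real.log θ := Real.log_pos (by linarith)
    have hApos : 0 < A θ := lt_of_lt_of_le (by positivity) (h2.trans h1)
    have h4 : A θ ^ (p - 1) ≤ K₁ * Real.log θ ^ (p - 1) := by
      refine le_of_mul_le_mul_right ?_ hApos
      calc A θ ^ (p - 1) * A θ = A θ ^ p := by
            nth_rewrite 2 [← Real.rpow_one (A θ)]
            rw [← Real.rpow_add hApos]
            ring_nf
        _ ≤ K₁ * (B θ * Real.log θ ^ (p - 1)) := h3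
        _ ≤ K₁ * (A θ * Real.log θ ^ (p - 1)) := by gcongr
        _ = _ := by ring
    have h5 := Real.rpow_le_rpow (by positivity) h4 (by positivity : 0 ≤ 1 / (p - 1))
    rwa [Real.mul_rpow hK₁0.le (by positivity), ← Real.rpow_mul hApos.le,
      ← Real.rpow_mul hlog.le, mul_one_div_cancel hp1.ne', Real.rpow_one, Real.rpow_one] at h5
  · have hθ0 : 0 < θ := by linarith
    obtain ⟨h1, h2, h3⟩ := real (2 * θ) (by linarith) (by linarith)
    have h4 := (main (4 * θ) (by linarith) hθT).1
    have hinc := hincr θ hθ0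
    have hAB : A θ + B (2 * θ) ≤ A (4 * θ) := by
      have hx : (∫⁻ z in W, f θ z) ≠ ∞ := (main θ hθ (by linarith)).1
      have hy : (∫⁻ z in transition n M R T (2 * θ), f (2 * θ) z) ≠ ∞ :=
        ne_top_of_le_ne_top h4 (le_add_self.trans hinc)
      have := ENNReal.toReal_mono h4 hinc
      rwa [ENNReal.toReal_add hx hy] at this
    have hAle : A θ ≤ A (2 * θ) := by
      refine ENNReal.toReal_mono (main (2 * θ) (by linarith) (by linarith)).1 ?_
      refine lintegral_mono_ae ?_
      filter_upwards [ae_restrict_mem hWm, hs] with z hz hsz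
      by_cases huz : u z = 0
      · simp [hf, huz, Real.zero_rpow hp0.ne']
      have hΨz := hΨ0 z.1 _ (hr' z hz (hsz huz))
      have htm : 0 ≤ z.1 + delay M ‖z.2‖ := add_nonneg hz.1.1.le (delay_nonneg hM hz.2)
      refine ENNReal.ofReal_le_ofReal ?_
      gcongr
      refine hη.antitone ?_
      gcongr
      linarith
    have hlog : 0 < Real.log (2 * θ) := Real.log_pos (by linarith)
    constructor
    · have : min (c₂ * c₁) K₁⁻¹ * ε ^ p ≤ c₂ * c₁ * ε ^ p := by
        gcongr
        exact min_le_left _ _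
      exact (add_le_add le_rfl (this.trans h2)).trans hAB
    · have hA0 : 0 ≤ A θ := ENNReal.toReal_nonneg
      have h5 : min (c₂ * c₁) K₁⁻¹ * (A θ ^ p * Real.log (2 * θ) ^ (1 - p))
          ≤ K₁⁻¹ * (A (2 * θ) ^ p * Real.log (2 * θ) ^ (1 - p)) := by
        gcongr
        exact min_le_right _ _
      have h6 : K₁⁻¹ * (A (2 * θ) ^ p * Real.log (2 * θ) ^ (1 - p)) ≤ B (2 * θ) := by
        rw [inv_mul_le_iff₀ hK₁0]
        calc A (2 * θ) ^ p * Real.log (2 * θ) ^ (1 - p)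
            ≤ K₁ * (B (2 * θ) * Real.log (2 * θ) ^ (p - 1)) * Real.log (2 * θ) ^ (1 - p) := by gcongr
          _ = K₁ * B (2 * θ) * (Real.log (2 * θ) ^ (p - 1) * Real.log (2 * θ) ^ (1 - p)) := by ring
          _ = K₁ * B (2 * θ) := by
              rw [← Real.rpow_add hlog]
              simp
      exact (add_le_add le_rfl (h5.trans h6)).trans hAB

/-- At the critical exponent the logarithm of the lifespan is at most of order `ε ^ (-p (p - 1))`. -/
theorem IsSetting.critical (h : IsSetting n M D V β γ μ₁ μ₂ u₀ u₁ R₁ R)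
    (hV : ∀ r, 2 * M < r → V r = 0) (hp : 1 < p) (hpS : p = straussExponent n) :
    ∃ C > (0 : ℝ), ∃ ε₀ > (0 : ℝ), ∀ ε : ℝ, 0 < ε → ε ≤ ε₀ →
      lifespan n M D V p (ε • u₀) (ε • u₁) R ≤
        ENNReal.ofReal (Real.exp (C * ε ^ (-(p * (p - 1))))) := by
  obtain ⟨c, hc, K, hK, θ₀, hθ₀, hgrow⟩ := h.exists_growth hV hp hpS
  have hp1 : 0 < p - 1 := by linarith
  have hθ₀0 : 0 < θ₀ := by linarith
  have hl4 : 0 < Real.log 4 := Real.log_pos (by norm_num)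
  set Λ := Real.log (2 * θ₀) + Real.log 4 with hΛ
  have hlθ : 0 < Real.log (2 * θ₀) := Real.log_pos (by linarith)
  have hΛ0 : 0 < Λ := by linarith
  set c' := min c (c * Λ ^ (1 - p)) with hc'
  have hc'0 : 0 < c' := lt_min hc (by positivity)
  obtain ⟨K', hK', hlen⟩ := exists_length_le hp hc'0 (by positivity : 0 < K * Λ)
  have hlθ₀ : 0 < Real.log θ₀ := Real.log_pos (by linarith)
  have hl16 : 0 < Real.log 16 := Real.log_pos (by norm_num)
  refine ⟨Real.log θ₀ + (K' + 1) * Real.log 16, by positivity, 1, one_pos,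
    fun ε hε hε1 => lifespan_le fun T u hu hs => ?_⟩
  obtain ⟨A, hA0, hAlog, hAinc⟩ := hgrow ε hε T u hu hs
  set x := ε ^ (-(p * (p - 1))) with hx
  have hx1 : 1 ≤ x := Real.one_le_rpow_of_pos_of_le_one_of_nonpos hε hε1
    (neg_nonpos.2 (by positivity))
  have hlen' : ∀ m : ℕ, θ₀ * 4 ^ (2 * m) < T → (m : ℝ) ≤ K' * x := by
    intro m hm
    have hT : ∀ i ≤ 2 * m, θ₀ * 4 ^ i < T := fun i hi => lt_of_le_of_lt (by
      gcongr
      norm_num) hm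
    have hθ : ∀ i : ℕ, θ₀ ≤ θ₀ * 4 ^ i := fun i =>
      le_mul_of_one_le_right hθ₀0.le (one_le_pow₀ (by norm_num))
    have hlog : ∀ i : ℕ, Real.log (2 * (θ₀ * 4 ^ i)) ≤ Λ * (1 + i) := by
      intro i
      have hi : (0 : ℝ) ≤ i := Nat.cast_nonneg i
      rw [← mul_assoc, Real.log_mul (by positivity) (by positivity), Real.log_pow, hΛ]
      nlinarith
    have := hlen (ε ^ p) (by positivity) m (fun i => A (θ₀ * 4 ^ i)) (hA0 _) ?_ ?_ ?_
    · rw [← Real.rpow_mul hε.le, show p * (1 - p) = -(p * (p - 1)) by ring] at this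
      exact this
    · intro i hi
      have e : θ₀ * 4 ^ (i + 1) = 4 * (θ₀ * 4 ^ i) := by rw [pow_succ]; ring
      have h1 := (hAinc (θ₀ * 4 ^ i) (hθ i) (by rw [← e]; exact hT _ (by omega))).1
      have h2 : c' * ε ^ p ≤ c * ε ^ p := by
        gcongr
        exact min_le_left _ _
      simp only [e]
      linarith
    · intro i hi
      have e : θ₀ * 4 ^ (i + 1) = 4 * (θ₀ * 4 ^ i) := by rw [pow_succ]; ring
      have h1 := (hAinc (θ₀ * 4 ^ i) (hθ i) (by rw [← e]; exact hT _ (by omega))).2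
      have hi0 : (0 : ℝ) < 1 + i := by positivity
      have hlp : 0 < Real.log (2 * (θ₀ * 4 ^ i)) := Real.log_pos (by linarith [hθ i])
      have h2 : Λ ^ (1 - p) * (1 + (i : ℝ)) ^ (1 - p) ≤ Real.log (2 * (θ₀ * 4 ^ i)) ^ (1 - p) := by
        rw [← Real.mul_rpow hΛ0.le hi0.le]
        exact Real.rpow_le_rpow_of_nonpos hlp (hlog i) (by linarith)
      have hAp : 0 ≤ A (θ₀ * 4 ^ i) ^ p := Real.rpow_nonneg (hA0 _) _
      have h3 : c' * (A (θ₀ * 4 ^ i) ^ p * (1 + (i : ℝ)) ^ (1 - p))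
          ≤ c * (A (θ₀ * 4 ^ i) ^ p * Real.log (2 * (θ₀ * 4 ^ i)) ^ (1 - p)) := by
        calc c' * (A (θ₀ * 4 ^ i) ^ p * (1 + (i : ℝ)) ^ (1 - p))
            ≤ c * Λ ^ (1 - p) * (A (θ₀ * 4 ^ i) ^ p * (1 + (i : ℝ)) ^ (1 - p)) := by
              gcongr
              exact min_le_right _ _
          _ = c * (A (θ₀ * 4 ^ i) ^ p * (Λ ^ (1 - p) * (1 + (i : ℝ)) ^ (1 - p))) := by ring
          _ ≤ _ := by gcongr
      simp only [e]
      linarith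
    · intro i hi
      refine (hAlog _ (hθ i) (hT i hi.le)).trans ?_
      rw [mul_assoc]
      gcongr
      refine le_trans (Real.log_le_log (by positivity) ?_) (hlog i)
      linarith [hθ i]
  set m := ⌊K' * x⌋₊ + 1 with hm
  have hm1 : K' * x < m := by rw [hm]; push_cast; exact Nat.lt_floor_add_one _
  have hm2 : (m : ℝ) ≤ K' * x + 1 := by
    rw [hm]
    push_cast
    linarith [Nat.floor_le (by positivity : 0 ≤ K' * x)]
  have hT : T ≤ θ₀ * 4 ^ (2 * m) := by
    by_contra hlt
    push Not at hlt
    linarith [hlen' m hlt]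
  refine hT.trans ?_
  have e1 : θ₀ * 4 ^ (2 * m) = Real.exp (Real.log θ₀ + m * Real.log 16) := by
    rw [Real.exp_add, Real.exp_log hθ₀0, mul_comm (m : ℝ), ← Real.rpow_def_of_pos (by norm_num),
      Real.rpow_natCast, pow_mul]
    norm_num
  rw [e1]
  refine Real.exp_le_exp.2 ?_
  calc Real.log θ₀ + m * Real.log 16 ≤ Real.log θ₀ + (K' * x + 1) * Real.log 16 := by gcongr
    _ ≤ Real.log θ₀ * x + (K' * x + 1 * x) * Real.log 16 := by
        gcongr
        · exact le_mul_of_one_le_right hlθ₀.le hx1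
        · linarith
    _ = _ := by ring

end Setting

theorem one_lt_straussExponent {n : ℕ} (hn : 2 ≤ n) : 1 < straussExponent n := by
  obtain ⟨hq, h0⟩ := (eq_straussExponent_iff n hn _).2 rfl
  have hn' : (2 : ℝ) ≤ n := by exact_mod_cast hn
  unfold straussGamma at h0
  by_contra hc
  push Not at hc
  have h1 : ((n : ℝ) - 1) * straussExponent n ^ 2 ≤ ((n : ℝ) - 1) * straussExponent n :=
    mul_le_mul_of_nonneg_left (by nlinarith) (by linarith)
  linarith

end Schwarzschild

theorem theorem1 (n : ℕ) (hn : 3 ≤ n) (M : ℝ) (hM : 0 < M)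
    (β γ μ₁ μ₂ : ℝ) (hβ : 1 < β) (hγ : 2 < γ) (hμ₁ : 0 ≤ μ₁) (hμ₂ : 0 ≤ μ₂)
    (D V : ℝ → ℝ) (hDc : ContinuousOn D (Set.Ioi (2 * M))) (hVc : ContinuousOn V (Set.Ioi (2 * M)))
    (hD : ∀ r, 2 * M < r → 0 ≤ D r ∧ D r ≤ μ₁ * r ^ (-β))
    (hV : ∀ r, 2 * M < r → 0 ≤ V r ∧ V r ≤ μ₂ * r ^ (-γ))
    (u₀ u₁ : EuclideanSpace ℝ (Fin n) → ℝ)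
    (hu₀i : MeasureTheory.IntegrableOn u₀ (Schwarzschild.exterior n M))
    (hu₁i : MeasureTheory.IntegrableOn u₁ (Schwarzschild.exterior n M))
    (hu₀ : ∀ x ∈ Schwarzschild.exterior n M, 0 ≤ u₀ x)
    (hu₁ : ∀ x ∈ Schwarzschild.exterior n M, 0 ≤ u₁ x)
    (hne : ¬ ((∀ᵐ x ∂(MeasureTheory.volume.restrict (Schwarzschild.exterior n M)), u₀ x = 0) ∧
      (∀ᵐ x ∂(MeasureTheory.volume.restrict (Schwarzschild.exterior n M)), u₁ x = 0)))
    (R₁ R₂ : ℝ) (hR₁ : 0 < R₁) (hR₂ : R₁ < R₂)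
    (hsupp : ∀ x ∈ Schwarzschild.exterior n M, (u₀ x ≠ 0 ∨ u₁ x ≠ 0) →
      2 * M + R₁ ≤ ‖x‖ ∧ ‖x‖ ≤ 2 * M + R₂)
    (R : ℝ) (hR : 0 < R)
    (hsuppR : ∀ x ∈ Schwarzschild.exterior n M, (u₀ x ≠ 0 ∨ u₁ x ≠ 0) →
      |Schwarzschild.tortoise M ‖x‖| ≤ R) :
    (∀ p : ℝ, 1 < p → p < Schwarzschild.straussExponent n →
      (∀ ε : ℝ, 0 < ε → Schwarzschild.lifespan n M D V p (ε • u₀) (ε • u₁) R < ⊤) ∧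
      ∃ C > (0 : ℝ), ∃ ε₀ > (0 : ℝ), ∀ ε : ℝ, 0 < ε → ε ≤ ε₀ →
        (p ≤ (n : ℝ) / ((n : ℝ) - 1) →
          Schwarzschild.lifespan n M D V p (ε • u₀) (ε • u₁) R ≤
            ENNReal.ofReal
              (C * ε ^ (-(2 * (p - 1) / ((n : ℝ) + 1 - ((n : ℝ) - 1) * p))))) ∧
        ((n : ℝ) / ((n : ℝ) - 1) < p →
          Schwarzschild.lifespan n M D V p (ε • u₀) (ε • u₁) R ≤
            ENNReal.ofReal
              (C * ε ^ (-(2 * p * (p - 1) / Schwarzschild.straussGamma p n))))) ∧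
    ((∀ r, 2 * M < r → V r = 0) →
      ∀ p : ℝ, p = Schwarzschild.straussExponent n →
      ∃ C > (0 : ℝ), ∃ ε₀ > (0 : ℝ), ∀ ε : ℝ, 0 < ε → ε ≤ ε₀ →
        Schwarzschild.lifespan n M D V p (ε • u₀) (ε • u₁) R ≤
          ENNReal.ofReal (Real.exp (C * ε ^ (-(p * (p - 1)))))) := by
  have hMp : (0 : ℝ) < 2 * M := by linarith
  -- larger decay rates may be lowered, at the expense of the constants
  have hset : Schwarzschild.IsSetting n M D V (min β 2) (min γ (5 / 2))
      (μ₁ * (2 * M) ^ (min β 2 - β)) (μ₂ * (2 * M) ^ (min γ (5 / 2) - γ)) u₀ u₁ R₁ R :=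
    { dim := hn
      mass := hM
      contD := hDc
      contV := hVc
      one_lt_β := lt_min hβ one_lt_two
      β_le := min_le_right _ _
      two_lt_γ := lt_min hγ (by norm_num)
      γ_le := min_le_right _ _
      μ₁_nonneg := mul_nonneg hμ₁ (Real.rpow_nonneg hMp.le _)
      μ₂_nonneg := mul_nonneg hμ₂ (Real.rpow_nonneg hMp.le _)
      boundD := fun r hr => ⟨(hD r hr).1, (hD r hr).2.trans (by
        rw [mul_assoc]
        exact mul_le_mul_of_nonneg_left
          (Schwarzschild.rpow_neg_le_mul_rpow_neg hM hr.le (min_le_left _ _)) hμ₁)⟩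
      boundV := fun r hr => ⟨(hV r hr).1, (hV r hr).2.trans (by
        rw [mul_assoc]
        exact mul_le_mul_of_nonneg_left
          (Schwarzschild.rpow_neg_le_mul_rpow_neg hM hr.le (min_le_left _ _)) hμ₂)⟩
      int₀ := hu₀i
      int₁ := hu₁i
      nonneg₀ := hu₀
      nonneg₁ := hu₁
      integral_pos := by
        have hmem := ae_restrict_mem (μ := volume)
          (Schwarzschild.measurableSet_exterior (n := n) (M := M))
        have hnn : ∀ x ∈ Schwarzschild.exterior n M, 0 ≤ u₀ x + u₁ x := fun x hx =>
          add_nonneg (hu₀ x hx) (hu₁ x hx)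
        refine lt_of_le_of_ne
          (setIntegral_nonneg Schwarzschild.measurableSet_exterior hnn) fun h0 => hne ?_
        have h1 := (integral_eq_zero_iff_of_nonneg_ae (hmem.mono hnn) (hu₀i.add hu₁i)).1 h0.symm
        constructor
        · filter_upwards [h1, hmem] with x hx hxm
          have hx : u₀ x + u₁ x = 0 := hx
          linarith [hu₀ x hxm, hu₁ x hxm]
        · filter_upwards [h1, hmem] with x hx hxm
          have hx : u₀ x + u₁ x = 0 := hx
          linarith [hu₀ x hxm, hu₁ x hxm]
      R₁_pos := hR₁
      R_pos := hR
      supp₁ := fun x hx h => (hsupp x hx h).1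
      supp := hsuppR }
  refine ⟨fun p hp hpS => hset.subcritical hp hpS, fun hV0 p hpS => ?_⟩
  exact hset.critical hV0 (hpS ▸ Schwarzschild.one_lt_straussExponent (by omega)) hpS
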